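/- **Model.** Let $n,K,T\ge 1$ and $s\ge 0$ be integers, $\alpha_n>0$. For $t=1,\dots,T$ let $\Theta_t\in\mathcal M_{n,K}$, the set of matrices in $\{0,1\}^{n\times K}$ with exactly one $1$ in each row, with communities $G_{t,k}=\{i:\Theta_t(i,k)=1\}$, all non-empty; let $n_t(k)=|G_{t,k}|$, $n_{\max}=\max_{t,k}n_t(k)$, $n_{\min}=\min_{t,k}n_t(k)$. Let $B_t=\alpha_nH_t$ be symmetric $K\times K$ matrices with entries in $[0,1]$ and $P_t=\Theta_tB_t\Theta_t^{T}$. The observed matrices $A_t$ are symmetric, $A_t(i,i)=a$ for a constant $a\ge 10$, and the entries $A_t(i,j)$, $i<j$, $1\le t\le T$, are independent Bernoulli variables with $\Pr(A_t(i,j)=1)=P_t(i,j)$. Assume, with constants $C_\alpha,C_\lambda\ge1$, $\beta,L,W_{\max},c_0>0$: * $C_\alpha^{-1}\alpha_n\le\|B_t\|_\infty\le C_\alpha\alpha_n$ for all $t$ (largest absolute value of an entry), and $\alpha_n\ge C_\alpha^{-1}c_0\log n/n$; * (A1) for all $k\le k'$ there is $f=f(\cdot;k,k')$ with $H_t(k,k')=f(t/T)$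 for all $t$, where $f$ is $l$ times differentiable on $[0,1]$ and $|f^{(l)}(x)-f^{(l)}(x')|\le L|x-x'|^{\beta-l}$, $l$ being the largest integer strictly smaller than $\beta$; * (A2) at most $s$ nodes change community between times $t$ and $t+1$, for every $t$; * (A3) $C_\lambda^{-1}\le\lambda_{\min}(H_t)\le\lambda_{\max}(H_t)\le C_\lambda$ for all $t$; * (A4) with $F_{r,1}=\{-r,\dots,r\}$, $F_{r,2}=\{0,\dots,r\}$, $F_{r,3}=\{-r,\dots,0\}$, the kernels satisfy $|W^{(j)}_r(i)|\le W_{\max}$ for $i\in F_{r,j}$ and $|F_{r,j}|^{-1}\sum_{i\in F_{r,j}}i^kW_r^{(j)}(i)=\mathbb 1(k=0)$ for $k=0,\dots,l$, for all $r\ge0$ and $j=1,2,3$. **Algorithm.** For $0\le r\le T/2$ let $\hat P_{t,r}=|F_{r,j}|^{-1}\sum_{i\in F_{r,j}}W^{(j)}_r(i)A_{t+i}$, where $j=1$ if $r<t\le T-r$, $j=2$ if $t\le r$, $j=3$ if $t>T-r$. With $\|\cdot\|$ the spectral norm and a tuning constant $C_0$, let $$\hat r_t=\max\Big\{0\le r\le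 T/2:\ \|\hat P_{t,r}-\hat P_{t,\rho}\|\le4C_0\sqrt{n\alpha_n/(\rho\vee1)}\ \text{ for all }\rho<r\Big\}.$$ Let $\hat U_t\in\mathbb R^{n\times K}$ consist of orthonormal eigenvectors of $\hat P_{t,\hat r_t}$ for its $K$ largest eigenvalues, and let $\hat\Theta_t\in\mathcal M_{n,K}$, together with some $\hat X_t\in\mathbb R^{K\times K}$, be a $(1+\epsilon)$-approximate solution of $\min_{\Theta\in\mathcal M_{n,K},X\in\mathbb R^{K\times K}}\|\Theta X-\hat U_t\|_F^2$, $\epsilon>0$. **Errors and rates.** With $J$ ranging over the $K\times K$ permutation matrices and $\|\cdot\|_0$ the number of non-zero entries, let $$R_t=\tfrac1n\min_J\|\hat\Theta_tJ-\Theta_t\|_0,\qquad \tilde R_t=\min_J\max_k\frac{\|(\hat\Theta_tJ-\Theta_t)_{G_{t,k},*}\|_0}{n_t(k)},$$ $R_{\max}=\max_tR_t$, $\tilde R_{\max}=\max_t\tilde R_t$, and $$\delta_1=\sqrt{n\alpha_n},\quad\delta_2=\Big(\frac{\alpha_n^{\beta+1}n^{\beta+1}}{T^\beta}\Big)^{\frac1{2\beta+1}}+(\alpha_n^3\,n\,n_{\max}\,s)^{1/4},\quad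 \mathcal B=C_R(2+\epsilon)\frac{K\min(\delta_1^2,\delta_2^2)}{\alpha_n^2n_{\min}^2}.$$ **Theorem.** For every $\tau>0$ there is a constant depending only on $\tau,c_0,C_\alpha,W_{\max}$ such that, if $C_0$ is at least this constant, there is $C_R$ depending only on $C_0,\tau,c_0,W_{\max},\beta,L,C_\alpha,C_\lambda$ for which the following holds under the assumptions above, provided that $\alpha_n\le\delta_2$ or $n_{\min}\ge C_\lambda^2$. 1. If $\alpha_n\le\delta_2$ or $\min(\epsilon,T)\le e^n$, then for every $t$, with probability at least $1-4n^{-\tau}$, every output $\hat\Theta_t$ of the algorithm satisfies $\tilde R_t\le\mathcal B$ and, if $\mathcal B\le1$, also $R_t\le\mathcal B\,n_{\max}/n$. 2. If $T\le n^{\tau_1}$ for a real number $\tau_1$, then with probability at least $1-4n^{-(\tau-\tau_1)}$ all outputs of the algorithm satisfy $\tilde R_{\max}\le\mathcal B$ and $R_{\max}\le\mathcal B\,n_{\max}/n$. -/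

import Mathlib

open MeasureTheory ProbabilityTheory

noncomputable section

namespace DSBM

/-! ### Norms and counts of matrix entries -/

/-- Largest absolute value of an entry. -/
def maxAbsEntry {m k : ℕ} (Q : Matrix (Fin m) (Fin k) ℝ) : ℝ :=
  ⨆ p : Fin m × Fin k, |Q p.1 p.2|

/-- Spectral norm (operator norm on Euclidean space). -/
def specNorm {n : ℕ} (Q : Matrix (Fin n) (Fin n) ℝ) : ℝ :=
  ‖Matrix.toEuclideanCLM (n := Fin n) (𝕜 := ℝ) Q‖

/-- Squared Frobenius norm. -/
def frobSq {m k : ℕ} (Q : Matrix (Fin m) (Fin k) ℝ) : ℝ :=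
  ∑ i, ∑ j, Q i j ^ 2

open Classical in
/-- Number of nonzero entries of `Q` in the rows that belong to `G`. -/
def zeroNormOn {m k : ℕ} (G : Finset (Fin m)) (Q : Matrix (Fin m) (Fin k) ℝ) : ℕ :=
  (Finset.univ.filter fun p : Fin m × Fin k => p.1 ∈ G ∧ Q p.1 p.2 ≠ 0).card

/-- Number of nonzero entries of `Q`. -/
def zeroNorm {m k : ℕ} (Q : Matrix (Fin m) (Fin k) ℝ) : ℕ :=
  zeroNormOn Finset.univ Q

/-! ### Clustering matrices and communities -/

/-- The `n × K` matrices with entries in `{0, 1}` and exactly one `1` in every row. -/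
def clusteringMatrices (n K : ℕ) : Set (Matrix (Fin n) (Fin K) ℝ) :=
  {Θ | (∀ i k, Θ i k = 0 ∨ Θ i k = 1) ∧ ∀ i, ∃! k, Θ i k = 1}

open Classical in
/-- The nodes of community `k`. -/
def community {n K : ℕ} (Θ : Matrix (Fin n) (Fin K) ℝ) (k : Fin K) : Finset (Fin n) :=
  Finset.univ.filter fun i => Θ i k = 1

/-- Largest community size over all communities and all times `1, …, T`. -/
def nMax {n K : ℕ} (T : ℕ) (Θ : ℤ → Matrix (Fin n) (Fin K) ℝ) : ℕ :=
  sSup {m | ∃ t ∈ Finset.Icc (1 : ℤ) T, ∃ k, m = (community (Θ t) k).card}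

/-- Smallest community size over all communities and all times `1, …, T`. -/
def nMin {n K : ℕ} (T : ℕ) (Θ : ℤ → Matrix (Fin n) (Fin K) ℝ) : ℕ :=
  sInf {m | ∃ t ∈ Finset.Icc (1 : ℤ) T, ∃ k, m = (community (Θ t) k).card}

/-! ### Clustering errors -/

/-- Overall relative clustering error, minimized over permutations of the labels. -/
def overallError {n K : ℕ} (Θhat Θ : Matrix (Fin n) (Fin K) ℝ) : ℝ :=
  (n : ℝ)⁻¹ * ⨅ σ : Equiv.Perm (Fin K), (zeroNorm (Θhat * σ.permMatrix ℝ - Θ) : ℝ)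

/-- Highest relative clustering error over the communities, minimized over permutations of the
labels. -/
def communityError {n K : ℕ} (Θhat Θ : Matrix (Fin n) (Fin K) ℝ) : ℝ :=
  ⨅ σ : Equiv.Perm (Fin K), ⨆ k : Fin K,
    ((community Θ k).card : ℝ)⁻¹ *
      (zeroNormOn (community Θ k) (Θhat * σ.permMatrix ℝ - Θ) : ℝ)

/-- The maximum over time of the overall relative error. -/
def maxOverallError {n K : ℕ} (T : ℕ) (Θhat Θ : ℤ → Matrix (Fin n) (Fin K) ℝ) : ℝ :=
  ⨆ t : Finset.Icc (1 : ℤ) T, overallError (Θhat t) (Θ t)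

/-- The maximum over time of the highest relative error over the communities. -/
def maxCommunityError {n K : ℕ} (T : ℕ) (Θhat Θ : ℤ → Matrix (Fin n) (Fin K) ℝ) : ℝ :=
  ⨆ t : Finset.Icc (1 : ℤ) T, communityError (Θhat t) (Θ t)

/-! ### The Hölder class -/

/-- The largest integer strictly smaller than `β` (for `β > 0`). -/
def holderOrder (β : ℝ) : ℕ := ⌈β⌉₊ - 1

/-- The Hölder class on `[0, 1]`. The Hölder bound makes the derivative of order `l` continuous,
so that `l` times differentiable and `C^l` agree here. -/
def HolderClass (β L : ℝ) (f : ℝ → ℝ) : Prop :=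
  ContDiffOn ℝ (holderOrder β) f (Set.Icc 0 1) ∧
  ∀ x ∈ Set.Icc (0 : ℝ) 1, ∀ x' ∈ Set.Icc (0 : ℝ) 1,
    |iteratedDerivWithin (holderOrder β) f (Set.Icc 0 1) x -
      iteratedDerivWithin (holderOrder β) f (Set.Icc 0 1) x'|
        ≤ L * |x - x'| ^ (β - holderOrder β)

/-! ### The model -/

/-- Connectivity matrices `α • H t`, `t = 1, …, T`: symmetric, entries in `[0, 1]`, and the largest
entry between `α / Cα` and `Cα * α`. -/
def IsConnectivity {K : ℕ} (T : ℕ) (α Cα : ℝ) (H : ℤ → Matrix (Fin K) (Fin K) ℝ) : Prop :=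
  ∀ t ∈ Finset.Icc (1 : ℤ) T,
    (H t).IsSymm ∧ (∀ k k', (α • H t) k k' ∈ Set.Icc (0 : ℝ) 1) ∧
    Cα⁻¹ * α ≤ maxAbsEntry (α • H t) ∧ maxAbsEntry (α • H t) ≤ Cα * α

/-- The entries of `H t` are the values at `t / T` of functions in the Hölder class. -/
def SmoothConnectivity {K : ℕ} (T : ℕ) (β L : ℝ) (H : ℤ → Matrix (Fin K) (Fin K) ℝ) : Prop :=
  ∀ k k' : Fin K, k ≤ k' → ∃ f : ℝ → ℝ, HolderClass β L f ∧
    ∀ t ∈ Finset.Icc (1 : ℤ) T, H t k k' = f ((t : ℝ) / (T : ℝ))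

open Classical in
/-- At most `s` nodes change their memberships between consecutive times. -/
def FewSwitches {n K : ℕ} (T s : ℕ) (Θ : ℤ → Matrix (Fin n) (Fin K) ℝ) : Prop :=
  ∀ t : ℤ, 1 ≤ t → t + 1 ≤ T →
    (Finset.univ.filter fun i : Fin n => Θ t i ≠ Θ (t + 1) i).card ≤ s

/-- All eigenvalues of `H t` lie between `Cl⁻¹` and `Cl`. -/
def EigenvalueBounds {K : ℕ} (T : ℕ) (Cl : ℝ) (H : ℤ → Matrix (Fin K) (Fin K) ℝ) : Prop :=
  ∀ t ∈ Finset.Icc (1 : ℤ) T, spectrum ℝ (H t) ⊆ Set.Icc Cl⁻¹ Cl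

/-- The edge probability matrix `Θ B Θᵀ` with `B = α • H`. -/
def edgeProb {n K : ℕ} (α : ℝ) (H : Matrix (Fin K) (Fin K) ℝ) (Θ : Matrix (Fin n) (Fin K) ℝ) :
    Matrix (Fin n) (Fin n) ℝ :=
  Θ * (α • H) * Θ.transpose

/-- `A t`, `t = 1, …, T`, are random symmetric matrices with the constant `a` on the diagonal and
with independent (over times and over pairs `i < j`) Bernoulli entries of success probabilities
`P t i j` above it. -/
structure IsAdjacencySample {Ω : Type*} [MeasurableSpace Ω] (μ : Measure Ω) {n : ℕ} (T : ℕ)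
    (a : ℝ) (P : ℤ → Matrix (Fin n) (Fin n) ℝ) (A : ℤ → Ω → Matrix (Fin n) (Fin n) ℝ) :
    Prop where
  symm : ∀ t ∈ Finset.Icc (1 : ℤ) T, ∀ ω, (A t ω).IsSymm
  diag : ∀ t ∈ Finset.Icc (1 : ℤ) T, ∀ ω i, A t ω i i = a
  zero_one : ∀ t ∈ Finset.Icc (1 : ℤ) T, ∀ ω i j, i < j → A t ω i j = 0 ∨ A t ω i j = 1
  meas : ∀ t ∈ Finset.Icc (1 : ℤ) T, ∀ i j, i < j → Measurable fun ω => A t ω i j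
  prob : ∀ t ∈ Finset.Icc (1 : ℤ) T, ∀ i j, i < j → μ.real {ω | A t ω i j = 1} = P t i j
  indep : iIndepFun
    (fun (e : {e : ℤ × Fin n × Fin n // e.1 ∈ Finset.Icc (1 : ℤ) T ∧ e.2.1 < e.2.2}) ω =>
      A e.1.1 ω e.1.2.1 e.1.2.2) μ

/-! ### The kernel estimator and the adaptive window -/

/-- The window offsets: interior, left boundary and right boundary. -/
def offsets (r : ℕ) : Fin 3 → Finset ℤ
  | 0 => Finset.Icc (-(r : ℤ)) r
  | 1 => Finset.Icc 0 (r : ℤ)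
  | 2 => Finset.Icc (-(r : ℤ)) 0

/-- The times at which the windows of the three kinds are used. -/
def windowTimes (T r : ℕ) : Fin 3 → Finset ℤ
  | 0 => Finset.Icc (1 + (r : ℤ)) (T - r)
  | 1 => Finset.Icc 1 (r : ℤ)
  | 2 => Finset.Icc ((T : ℤ) - r + 1) T

/-- Bounded discrete kernels of order `l`; `W j r i` is the value at the offset `i` of the kernel of
kind `j` and width `r`. -/
def IsKernel (l : ℕ) (Wmax : ℝ) (W : Fin 3 → ℕ → ℤ → ℝ) : Prop :=
  ∀ j r, (∀ i ∈ offsets r j, |W j r i| ≤ Wmax) ∧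
    ∀ k ≤ l, ((offsets r j).card : ℝ)⁻¹ * ∑ i ∈ offsets r j, (i : ℝ) ^ k * W j r i
      = if k = 0 then 1 else 0

/-- The kernel estimator of the edge probability matrix at time `t` with window width `r`. -/
def kernelEstimator {n : ℕ} (T : ℕ) (W : Fin 3 → ℕ → ℤ → ℝ)
    (A : ℤ → Matrix (Fin n) (Fin n) ℝ) (t : ℤ) (r : ℕ) : Matrix (Fin n) (Fin n) ℝ :=
  ∑ j : Fin 3, if t ∈ windowTimes T r j then
    ((offsets r j).card : ℝ)⁻¹ • ∑ i ∈ offsets r j, W j r i • A (t + i) else 0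

/-- The adaptive (Lepski) window width with tuning constant `C0`. The set is bounded and contains
`0`, so that the supremum is a maximum. -/
def adaptiveWidth {n : ℕ} (T : ℕ) (W : Fin 3 → ℕ → ℤ → ℝ) (C0 α : ℝ)
    (A : ℤ → Matrix (Fin n) (Fin n) ℝ) (t : ℤ) : ℕ :=
  sSup {r : ℕ | 2 * r ≤ T ∧ ∀ ρ < r,
    specNorm (kernelEstimator T W A t r - kernelEstimator T W A t ρ)
      ≤ 4 * C0 * Real.sqrt (n * α / (max ρ 1 : ℕ))}

/-! ### Spectral clustering -/

/-- The columns of `U` are the first `K` vectors of an orthonormal eigenbasis of `Q` sorted by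
decreasing eigenvalues. -/
def IsTopEigenvectors {n K : ℕ} (Q : Matrix (Fin n) (Fin n) ℝ) (U : Matrix (Fin n) (Fin K) ℝ) :
    Prop :=
  ∃ (V : Matrix (Fin n) (Fin n) ℝ) (lam : Fin n → ℝ) (hK : K ≤ n),
    V.transpose * V = 1 ∧ Antitone lam ∧ Q * V = V * Matrix.diagonal lam ∧
    U = V.submatrix id (Fin.castLE hK)

/-- `Θhat` is the clustering part of a `(1 + ε)`-approximate solution of the `K`-means problem for
the rows of `U`. -/
def IsApproxKMeans {n K : ℕ} (ε : ℝ) (U : Matrix (Fin n) (Fin K) ℝ)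
    (Θhat : Matrix (Fin n) (Fin K) ℝ) : Prop :=
  Θhat ∈ clusteringMatrices n K ∧ ∃ Xhat : Matrix (Fin K) (Fin K) ℝ,
    ∀ Θ ∈ clusteringMatrices n K, ∀ X : Matrix (Fin K) (Fin K) ℝ,
      frobSq (Θhat * Xhat - U) ≤ (1 + ε) * frobSq (Θ * X - U)

/-- `Θhat` is a possible output at time `t` of the clustering algorithm run on the adjacency
matrices `A`: adaptive kernel estimation, top `K` eigenvectors, approximate `K`-means. -/
def IsClusteringOutput {n K : ℕ} (T : ℕ) (W : Fin 3 → ℕ → ℤ → ℝ) (C0 α ε : ℝ)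
    (A : ℤ → Matrix (Fin n) (Fin n) ℝ) (t : ℤ) (Θhat : Matrix (Fin n) (Fin K) ℝ) : Prop :=
  ∃ U : Matrix (Fin n) (Fin K) ℝ,
    IsTopEigenvectors (kernelEstimator T W A t (adaptiveWidth T W C0 α A t)) U ∧
    IsApproxKMeans ε U Θhat

/-! ### Rates -/

/-- The rate of the estimator without averaging over time. -/
def δ₁ (n : ℕ) (α : ℝ) : ℝ := Real.sqrt (n * α)

/-- The rate of the estimator with averaging over time. -/
def δ₂ (n T s nmax : ℕ) (α β : ℝ) : ℝ :=
  (α ^ (β + 1) * (n : ℝ) ^ (β + 1) / (T : ℝ) ^ β) ^ (1 / (2 * β + 1)) +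
    (α ^ 3 * n * nmax * s) ^ ((1 : ℝ) / 4)

/-- The bound on the clustering error. -/
def errorBound (CR ε : ℝ) (n K T s nmin nmax : ℕ) (α β : ℝ) : ℝ :=
  CR * (2 + ε) * (K * min (δ₁ n α ^ 2) (δ₂ n T s nmax α β ^ 2) / (α ^ 2 * (nmin : ℝ) ^ 2))

end DSBM

end

/-! All kernels average to one, so every estimator has exactly `a` on its diagonal, and subtracting
`a` times the identity changes no eigenvector. The relevant error is therefore the spectral distance
of the shifted estimator to the edge probability matrix `P`, either with its diagonal removed or,
when `α ≤ δ₂`, with the diagonal counted as an extra error of order `α`.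

Spectral part. In both versions the target leaves the span of the community indicators and its
complement invariant, with a gap of order `α * nMin`. An error `e` thus gives a Davis–Kahan bound `2
* (e / gap) ^ 2` for the residual of the eigenvectors after projection (`residual_le_of_gap`). The
projected rows are one center per community, at squared distance at least half the sum of the
inverse community sizes (`center_dist`). A node is bad if its estimated center is far from its true
one; approximate optimality of K-means bounds the sum of the inverse community sizes over bad nodes,
and a combinatorial lemma turns this into a permutation (`exists_perm_of_separated`). This is
`clustering_error_le`.

Deviation. For a window of `N` times, the centred weighted sum has norm of order `√(N * n * α)`,
without logarithm. The proof is the Kahn–Szemerédi method on an integer net: pairs with `|k i * l j|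
≤ √d` are handled by a Chernoff bound and a union over the net, the remaining ones by bounded
degrees and discrepancy. Once `d ≥ (16 * n) ^ 2` all pairs are light and the failure probability is
exponentially small in `n`.

Bias and adaptation. Kernels annihilate the Taylor polynomials of the smooth entries, and changes of
membership are estimated in Frobenius norm (`specNorm_bias_le`). Lepski's rule is as good as any
width whose bias is below its deviation, and the largest such width attains `min δ₁ δ₂`
(`balanced_rate`).

Arbitrary `T`. The number of times is not bounded in terms of `n`, so a union over all widths is not
available. Only widths up to `widthCap`, exponential in `n`, are controlled: polynomially many of
them are sparse and pay a power of `n`, the others pay an exponential. If the balanced width lies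
above the cap, the width at the cap already has an error so small that no node is bad when `ε ≤ exp
n`, or, if `α ≤ δ₂`, an error below the rate. -/

namespace DSBM

open Matrix

/-! ### Euclidean norms and the spectral norm -/

/-- The Euclidean norm of a vector of coordinates. -/
noncomputable def l2 {ι : Type*} [Fintype ι] (x : ι → ℝ) : ℝ := √(x ⬝ᵥ x)

section l2
variable {ι : Type*} [Fintype ι]

lemma dot_self_nonneg (x : ι → ℝ) : 0 ≤ x ⬝ᵥ x :=
  Finset.sum_nonneg fun i _ => mul_self_nonneg (x i)

lemma l2_nonneg (x : ι → ℝ) : 0 ≤ l2 x := Real.sqrt_nonneg _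

lemma l2_sq (x : ι → ℝ) : l2 x ^ 2 = x ⬝ᵥ x := Real.sq_sqrt (dot_self_nonneg x)

lemma l2_sq_sum (x : ι → ℝ) : l2 x ^ 2 = ∑ i, x i ^ 2 := by
  rw [l2_sq]; exact Finset.sum_congr rfl fun i _ => (sq _).symm

lemma l2_eq_norm (x : ι → ℝ) : l2 x = ‖WithLp.toLp 2 x‖ := by
  rw [EuclideanSpace.norm_eq, l2]
  congr 1
  exact Finset.sum_congr rfl fun i _ => by simp [sq]

lemma dot_eq_inner (x y : ι → ℝ) : x ⬝ᵥ y = inner ℝ (WithLp.toLp 2 x) (WithLp.toLp 2 y) := by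
  simp [PiLp.inner_apply, dotProduct, mul_comm]

lemma abs_dot_le (x y : ι → ℝ) : |x ⬝ᵥ y| ≤ l2 x * l2 y := by
  rw [dot_eq_inner, l2_eq_norm, l2_eq_norm]
  exact abs_real_inner_le_norm _ _

lemma l2_sub_le (x y : ι → ℝ) : l2 (x - y) ≤ l2 x + l2 y := by
  simp only [l2_eq_norm, WithLp.toLp_sub]
  exact norm_sub_le _ _

lemma l2_smul (c : ℝ) (x : ι → ℝ) : l2 (c • x) = |c| * l2 x := by
  simp only [l2_eq_norm, WithLp.toLp_smul, norm_smul, Real.norm_eq_abs]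

lemma l2_zero : l2 (0 : ι → ℝ) = 0 := by simp [l2]

lemma l2_eq_zero {x : ι → ℝ} : l2 x = 0 ↔ x = 0 := by
  rw [l2_eq_norm]; simp

lemma l2_pos {x : ι → ℝ} (h : x ≠ 0) : 0 < l2 x :=
  lt_of_le_of_ne (l2_nonneg x) fun h0 => h (l2_eq_zero.1 h0.symm)

lemma l2_single [DecidableEq ι] (i : ι) : l2 (Pi.single i (1 : ℝ)) = 1 := by
  simp [l2]

end l2

section spec
variable {n : ℕ}

lemma specNorm_nonneg (Q : Matrix (Fin n) (Fin n) ℝ) : 0 ≤ specNorm Q := norm_nonneg _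

lemma l2_mulVec_le (Q : Matrix (Fin n) (Fin n) ℝ) (y : Fin n → ℝ) :
    l2 (Q *ᵥ y) ≤ specNorm Q * l2 y := by
  rw [l2_eq_norm, l2_eq_norm, ← toEuclideanCLM_toLp (𝕜 := ℝ)]
  exact ContinuousLinearMap.le_opNorm _ _

lemma abs_dot_mulVec_le (Q : Matrix (Fin n) (Fin n) ℝ) (x y : Fin n → ℝ) :
    |x ⬝ᵥ Q *ᵥ y| ≤ specNorm Q * (l2 x * l2 y) := by
  calc _ ≤ l2 x * l2 (Q *ᵥ y) := abs_dot_le _ _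
    _ ≤ l2 x * (specNorm Q * l2 y) := by
      gcongr
      · exact l2_nonneg _
      · exact l2_mulVec_le Q y
    _ = _ := by ring

lemma specNorm_le_of_mulVec {Q : Matrix (Fin n) (Fin n) ℝ} {c : ℝ} (hc : 0 ≤ c)
    (h : ∀ y, l2 (Q *ᵥ y) ≤ c * l2 y) : specNorm Q ≤ c := by
  refine ContinuousLinearMap.opNorm_le_bound _ hc fun x => ?_
  have := h x.ofLp
  rw [l2_eq_norm, l2_eq_norm, ← toEuclideanCLM_toLp (𝕜 := ℝ)] at this
  simpa using this

/-- Testing against `x = Q *ᵥ y` gives the square of `l2 (Q *ᵥ y)` on the left, and one factor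
cancels. -/
lemma specNorm_le_of_dot {Q : Matrix (Fin n) (Fin n) ℝ} {c : ℝ} (hc : 0 ≤ c)
    (h : ∀ x y, x ⬝ᵥ Q *ᵥ y ≤ c * (l2 x * l2 y)) : specNorm Q ≤ c := by
  refine specNorm_le_of_mulVec hc fun y => ?_
  have h1 := h (Q *ᵥ y) y
  rw [← l2_sq] at h1
  rcases (l2_nonneg (Q *ᵥ y)).eq_or_lt with h0 | h0
  · rw [← h0]; exact mul_nonneg hc (l2_nonneg _)
  · nlinarith

lemma specNorm_add_le (Q R : Matrix (Fin n) (Fin n) ℝ) :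
    specNorm (Q + R) ≤ specNorm Q + specNorm R := by
  unfold specNorm; rw [map_add]; exact norm_add_le _ _

lemma specNorm_sub_le (Q R : Matrix (Fin n) (Fin n) ℝ) :
    specNorm (Q - R) ≤ specNorm Q + specNorm R := by
  unfold specNorm; rw [map_sub]; exact norm_sub_le _ _

lemma specNorm_smul (c : ℝ) (Q : Matrix (Fin n) (Fin n) ℝ) :
    specNorm (c • Q) = |c| * specNorm Q := by
  unfold specNorm; rw [map_smul, norm_smul, Real.norm_eq_abs]

lemma specNorm_zero : specNorm (0 : Matrix (Fin n) (Fin n) ℝ) = 0 := by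
  unfold specNorm; rw [map_zero, norm_zero]

lemma specNorm_sum_le {κ : Type*} (s : Finset κ) (Q : κ → Matrix (Fin n) (Fin n) ℝ) :
    specNorm (∑ i ∈ s, Q i) ≤ ∑ i ∈ s, specNorm (Q i) := by
  unfold specNorm; rw [map_sum]; exact norm_sum_le _ _

lemma specNorm_transpose_le (Q : Matrix (Fin n) (Fin n) ℝ) : specNorm Qᵀ ≤ specNorm Q := by
  refine specNorm_le_of_dot (specNorm_nonneg _) fun x y => ?_
  rw [mulVec_transpose, dotProduct_comm, ← dotProduct_mulVec, mul_comm (l2 x)]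
  exact (le_abs_self _).trans (abs_dot_mulVec_le Q y x)

lemma specNorm_diagonal_le {d : Fin n → ℝ} {c : ℝ} (hc : 0 ≤ c) (h : ∀ i, |d i| ≤ c) :
    specNorm (diagonal d) ≤ c := by
  refine specNorm_le_of_mulVec hc fun y => ?_
  refine le_of_sq_le_sq ?_ (mul_nonneg hc (l2_nonneg _))
  rw [mul_pow, l2_sq_sum, l2_sq_sum, Finset.mul_sum]
  refine Finset.sum_le_sum fun i _ => ?_
  rw [mulVec_diagonal, mul_pow, ← sq_abs (d i)]
  gcongr
  exact h i

lemma abs_diag_le_specNorm (Q : Matrix (Fin n) (Fin n) ℝ) (i : Fin n) : |Q i i| ≤ specNorm Q := by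
  have := abs_dot_mulVec_le Q (Pi.single i 1) (Pi.single i 1)
  simpa [l2_single] using this

lemma specNorm_diagonal_diag_le (Q : Matrix (Fin n) (Fin n) ℝ) :
    specNorm (diagonal fun i => Q i i) ≤ specNorm Q :=
  specNorm_diagonal_le (specNorm_nonneg _) (abs_diag_le_specNorm Q)

end spec

/-! ### Frobenius norm. -/

section frob
variable {m k : ℕ}

lemma frobSq_nonneg (M : Matrix (Fin m) (Fin k) ℝ) : 0 ≤ frobSq M :=
  Finset.sum_nonneg fun _ _ => Finset.sum_nonneg fun _ _ => sq_nonneg _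

lemma frobSq_eq_sum_rows (M : Matrix (Fin m) (Fin k) ℝ) : frobSq M = ∑ i, l2 (M i) ^ 2 :=
  Finset.sum_congr rfl fun _ _ => (l2_sq_sum _).symm

lemma frobSq_transpose (M : Matrix (Fin m) (Fin k) ℝ) : frobSq Mᵀ = frobSq M := by
  unfold frobSq; rw [Finset.sum_comm]; rfl

lemma l2_mulVec_sq_le_frobSq (M : Matrix (Fin m) (Fin k) ℝ) (y : Fin k → ℝ) :
    l2 (M *ᵥ y) ^ 2 ≤ frobSq M * l2 y ^ 2 := by
  rw [l2_sq_sum, frobSq_eq_sum_rows, Finset.sum_mul]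
  refine Finset.sum_le_sum fun i _ => ?_
  rw [← mul_pow, ← sq_abs]
  gcongr
  exact abs_dot_le (M i) y

lemma l2_mulVec_le_frob (M : Matrix (Fin m) (Fin k) ℝ) (y : Fin k → ℝ) :
    l2 (M *ᵥ y) ≤ √(frobSq M) * l2 y := by
  refine le_of_sq_le_sq ?_ (mul_nonneg (Real.sqrt_nonneg _) (l2_nonneg _))
  rw [mul_pow, Real.sq_sqrt (frobSq_nonneg M)]
  exact l2_mulVec_sq_le_frobSq M y

lemma specNorm_le_frob (Q : Matrix (Fin m) (Fin m) ℝ) : specNorm Q ≤ √(frobSq Q) :=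
  specNorm_le_of_mulVec (Real.sqrt_nonneg _) (l2_mulVec_le_frob Q)

lemma frobSq_add_le (M N : Matrix (Fin m) (Fin k) ℝ) :
    frobSq (M + N) ≤ 2 * frobSq M + 2 * frobSq N := by
  unfold frobSq
  rw [Finset.mul_sum, Finset.mul_sum, ← Finset.sum_add_distrib]
  refine Finset.sum_le_sum fun i _ => ?_
  rw [Finset.mul_sum, Finset.mul_sum, ← Finset.sum_add_distrib]
  refine Finset.sum_le_sum fun j _ => ?_
  rw [Matrix.add_apply]
  nlinarith [sq_nonneg (M i j - N i j)]

/-- The comparison with the Frobenius norm is crude, but it suffices for the smooth part of the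
bias, which is controlled entry by entry. -/
lemma specNorm_le_of_entries {Q : Matrix (Fin m) (Fin m) ℝ} {c : ℝ} (hc : 0 ≤ c)
    (h : ∀ i j, |Q i j| ≤ c) : specNorm Q ≤ m * c := by
  refine (specNorm_le_frob Q).trans ?_
  refine Real.sqrt_le_iff.2 ⟨by positivity, ?_⟩
  calc frobSq Q ≤ ∑ _i : Fin m, ∑ _j : Fin m, c ^ 2 := by
        refine Finset.sum_le_sum fun _ _ => Finset.sum_le_sum fun _ _ => ?_
        rw [← sq_abs]; gcongr; exact h _ _
    _ = _ := by simp; ring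

end frob

/-! ### Labels and label permutations -/

/-- The number of nodes with label `k`. -/
def labelCount {n K : ℕ} (g : Fin n → Fin K) (k : Fin K) : ℕ :=
  (Finset.univ.filter fun i => g i = k).card

lemma labelCount_pos {n K : ℕ} (g : Fin n → Fin K) (i : Fin n) : 0 < labelCount g (g i) :=
  Finset.card_pos.2 ⟨i, by simp⟩

/-- If nodes outside `S` that differ in `g` differ in `g'`, then `g'` agrees with `g` up to a
permutation of the labels and up to errors controlled by the weight of `S`. -/
lemma exists_perm_of_separated {n K : ℕ} (g g' : Fin n → Fin K) (S : Finset (Fin n))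
    (hsep : ∀ i ∉ S, ∀ j ∉ S, g i ≠ g j → g' i ≠ g' j) (hne : ∀ k, ∃ i, g i = k)
    {N : ℝ} (hN0 : 0 ≤ N) (hN : ∀ k, (labelCount g k : ℝ) ≤ N) :
    ∃ σ : Equiv.Perm (Fin K),
      ((Finset.univ.filter fun i => σ (g' i) ≠ g i).card : ℝ)
          ≤ 2 * N * ∑ i ∈ S, ((labelCount g (g i) : ℝ))⁻¹ ∧
      ∀ k, ((Finset.univ.filter fun i => g i = k ∧ σ (g' i) ≠ k).card : ℝ)
          ≤ (∑ i ∈ S, ((labelCount g (g i) : ℝ))⁻¹) * labelCount g k := by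
  classical
  set D : ℝ := ∑ i ∈ S, ((labelCount g (g i) : ℝ))⁻¹ with hD
  have hpos : ∀ k, (0 : ℝ) < labelCount g k := fun k => by
    obtain ⟨i, rfl⟩ := hne k
    exact_mod_cast labelCount_pos g i
  have hD0 : 0 ≤ D := Finset.sum_nonneg fun i _ => by have := hpos (g i); positivity
  -- The communities that keep a node outside `S`. By separation their representatives carry
  -- distinct labels, so sending a community to the label of its representative extends to a
  -- permutation.
  set C : Finset (Fin K) := Finset.univ.filter fun k => ∃ i, i ∉ S ∧ g i = k with hC
  have hrep : ∀ k : Fin K, ∃ i : Fin n, k ∈ C → i ∉ S ∧ g i = k := fun k => by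
    by_cases hk : k ∈ C
    · obtain ⟨i, hi⟩ := (Finset.mem_filter.1 hk).2
      exact ⟨i, fun _ => hi⟩
    · obtain ⟨i, -⟩ := hne k
      exact ⟨i, fun h => absurd h hk⟩
  choose rep hrep using hrep
  have hinj : Set.InjOn (fun k => g' (rep k)) (C : Set (Fin K)) := by
    intro k hk k' hk' h
    by_contra hne'
    refine hsep _ (hrep k hk).1 _ (hrep k' hk').1 ?_ h
    rw [(hrep k hk).2, (hrep k' hk').2]; exact hne'
  obtain ⟨e, he⟩ := Finset.exists_equiv_extend_of_card_eq (t := (Finset.univ : Finset (Fin K)))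
    (by simp) (Finset.subset_univ (C.image fun k => g' (rep k))) hinj
  let π : Fin K ≃ Fin K := e.trans (Equiv.subtypeUnivEquiv (by simp))
  have hπ : ∀ k ∈ C, π k = g' (rep k) := fun k hk => he k hk
  -- If the relabelled node `i` landed in a community of `C` other than its own, it would share its
  -- label with that community's representative, against separation. Misplaced nodes outside `S`
  -- therefore only use labels of communities swallowed by `S`.
  have hbad : ∀ i ∉ S, π.symm (g' i) ≠ g i → π.symm (g' i) ∉ C := by
    intro i hi hne' hk
    refine hsep i hi _ (hrep _ hk).1 ?_ ?_
    · rw [(hrep _ hk).2]; exact hne'.symm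
    · rw [← hπ _ hk]; simp
  -- communities without good nodes
  have hfull : ∀ k ∉ C, 1 ≤ ∑ i ∈ S.filter (fun i => g i = k), ((labelCount g (g i) : ℝ))⁻¹ := by
    intro k hk
    have hsub : (Finset.univ.filter fun i => g i = k) ⊆ S.filter (fun i => g i = k) := by
      intro i hi
      have hi' := (Finset.mem_filter.1 hi).2
      refine Finset.mem_filter.2 ⟨?_, hi'⟩
      by_contra hS
      exact hk (Finset.mem_filter.2 ⟨Finset.mem_univ _, i, hS, hi'⟩)
    calc (1 : ℝ) = ∑ i ∈ Finset.univ.filter (fun i => g i = k), ((labelCount g k : ℝ))⁻¹ := by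
          rw [Finset.sum_const, nsmul_eq_mul]
          exact (mul_inv_cancel₀ (hpos k).ne').symm
      _ = ∑ i ∈ Finset.univ.filter (fun i => g i = k), ((labelCount g (g i) : ℝ))⁻¹ :=
          Finset.sum_congr rfl fun i hi => by rw [(Finset.mem_filter.1 hi).2]
      _ ≤ _ := Finset.sum_le_sum_of_subset_of_nonneg hsub fun i _ _ => by
          have := hpos (g i); positivity
  -- A community swallowed by `S` contributes weight at least one to `D`, so at most `D` communities
  -- are lost.
  have hM : ((Finset.univ \ C).card : ℝ) ≤ D := by
    calc ((Finset.univ \ C).card : ℝ) = ∑ k ∈ Finset.univ \ C, (1 : ℝ) := by simp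
      _ ≤ ∑ k ∈ Finset.univ \ C, ∑ i ∈ S.filter (fun i => g i = k),
            ((labelCount g (g i) : ℝ))⁻¹ :=
          Finset.sum_le_sum fun k hk => hfull k (Finset.mem_sdiff.1 hk).2
      _ ≤ ∑ k, ∑ i ∈ S.filter (fun i => g i = k), ((labelCount g (g i) : ℝ))⁻¹ :=
          Finset.sum_le_sum_of_subset_of_nonneg (Finset.subset_univ _) fun k _ _ =>
            Finset.sum_nonneg fun i _ => by have := hpos (g i); positivity
      _ = D := Finset.sum_fiberwise _ _ _
  have hS : (S.card : ℝ) ≤ N * D := by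
    calc (S.card : ℝ) = ∑ i ∈ S, (1 : ℝ) := by simp
      _ ≤ ∑ i ∈ S, N * ((labelCount g (g i) : ℝ))⁻¹ := Finset.sum_le_sum fun i _ => by
          rw [← div_eq_mul_inv, one_le_div (hpos _)]; exact hN _
      _ = N * D := by rw [hD, Finset.mul_sum]
  refine ⟨π.symm, ?_, fun k => ?_⟩
  · set F := Finset.univ.filter fun i => i ∉ S ∧ π.symm (g' i) ≠ g i with hF
    have hsub : (Finset.univ.filter fun i => π.symm (g' i) ≠ g i) ⊆ S ∪ F := by
      intro i hi
      by_cases h : i ∈ S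
      · exact Finset.mem_union_left _ h
      · exact Finset.mem_union_right _ (by simpa [hF, h] using hi)
    have hFc : (F.card : ℝ) ≤ N * D := by
      have himg : F.image (fun i => π.symm (g' i)) ⊆ Finset.univ \ C := by
        intro k hk
        obtain ⟨i, hi, rfl⟩ := Finset.mem_image.1 hk
        have := (Finset.mem_filter.1 hi).2
        exact Finset.mem_sdiff.2 ⟨Finset.mem_univ _, hbad i this.1 this.2⟩
      -- By separation, nodes of `F` with the same label lie in one community, so a fibre has at
      -- most `N` nodes.
      have hfib : ∀ k ∈ F.image (fun i => π.symm (g' i)),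
          ((F.filter fun i => π.symm (g' i) = k).card : ℝ) ≤ N := by
        intro k hk
        obtain ⟨i, hi, rfl⟩ := Finset.mem_image.1 hk
        refine le_trans ?_ (hN (g i))
        norm_cast
        refine Finset.card_le_card fun j hj => ?_
        have hj1 := (Finset.mem_filter.1 (Finset.mem_filter.1 hj).1).2
        have hj2 := (Finset.mem_filter.1 hj).2
        have hi1 := (Finset.mem_filter.1 hi).2
        refine Finset.mem_filter.2 ⟨Finset.mem_univ _, ?_⟩
        by_contra hgj
        exact hsep j hj1.1 i hi1.1 hgj (π.symm.injective hj2)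
      calc (F.card : ℝ)
          = ∑ k ∈ F.image (fun i => π.symm (g' i)),
              ((F.filter fun i => π.symm (g' i) = k).card : ℝ) := by
            rw [Finset.card_eq_sum_card_image (fun i => π.symm (g' i)) F]; push_cast; rfl
        _ ≤ ∑ k ∈ F.image (fun i => π.symm (g' i)), N := Finset.sum_le_sum hfib
        _ = ((F.image (fun i => π.symm (g' i))).card : ℝ) * N := by simp
        _ ≤ D * N := by
            refine mul_le_mul_of_nonneg_right (le_trans ?_ hM) hN0
            exact_mod_cast Finset.card_le_card himg
        _ = N * D := mul_comm _ _
    calc ((Finset.univ.filter fun i => π.symm (g' i) ≠ g i).card : ℝ) ≤ ((S ∪ F).card : ℝ) := by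
          exact_mod_cast Finset.card_le_card hsub
      _ ≤ S.card + F.card := by exact_mod_cast Finset.card_union_le _ _
      _ ≤ 2 * N * D := by linarith
  -- If no community is lost, all errors lie in `S`. If one is lost, then `D ≥ 1` and the bound is
  -- at least the size of the community.
  · by_cases hCu : C = Finset.univ
    · have hsub : (Finset.univ.filter fun i => g i = k ∧ π.symm (g' i) ≠ k)
          ⊆ S.filter (fun i => g i = k) := by
        intro i hi
        have hi' := (Finset.mem_filter.1 hi).2
        refine Finset.mem_filter.2 ⟨?_, hi'.1⟩
        by_contra hS'
        refine hbad i hS' (by rw [hi'.1]; exact hi'.2) ?_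
        rw [hCu]; exact Finset.mem_univ _
      calc _ ≤ ((S.filter (fun i => g i = k)).card : ℝ) := by
            exact_mod_cast Finset.card_le_card hsub
        _ = ∑ i ∈ S.filter (fun i => g i = k),
              ((labelCount g (g i) : ℝ))⁻¹ * labelCount g k := by
            rw [Finset.card_eq_sum_ones]; push_cast
            refine Finset.sum_congr rfl fun i hi => ?_
            rw [(Finset.mem_filter.1 hi).2, inv_mul_cancel₀ (hpos k).ne']
        _ = (∑ i ∈ S.filter (fun i => g i = k), ((labelCount g (g i) : ℝ))⁻¹) *
              labelCount g k := by rw [Finset.sum_mul]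
        _ ≤ D * labelCount g k := by
            refine mul_le_mul_of_nonneg_right ?_ (hpos k).le
            exact Finset.sum_le_sum_of_subset_of_nonneg (Finset.filter_subset _ _)
              fun i _ _ => by have := hpos (g i); positivity
    · have hD1 : 1 ≤ D := by
        refine le_trans ?_ hM
        have : (Finset.univ \ C).Nonempty := by
          rw [Finset.sdiff_nonempty]
          exact fun h => hCu (Finset.univ_subset_iff.1 h)
        exact_mod_cast this.card_pos
      calc _ ≤ (labelCount g k : ℝ) := by
            norm_cast
            exact Finset.card_le_card fun i hi => by
              simp only [Finset.mem_filter, Finset.mem_univ, true_and] at hi ⊢; exact hi.1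
        _ ≤ D * labelCount g k := le_mul_of_one_le_left (hpos k).le hD1

/-! ### Perturbation of the leading eigenvectors -/

/-- The clustering matrix of a labelling. -/
def ofLabels {n K : ℕ} (g : Fin n → Fin K) : Matrix (Fin n) (Fin K) ℝ :=
  Matrix.of fun i k => if g i = k then 1 else 0

section labels
variable {n K : ℕ} (g : Fin n → Fin K)

lemma ofLabels_apply (i : Fin n) (k : Fin K) : ofLabels g i k = if g i = k then 1 else 0 := rfl

lemma ofLabels_mulVec (c : Fin K → ℝ) (i : Fin n) : (ofLabels g *ᵥ c) i = c (g i) := by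
  simp [mulVec, dotProduct, ofLabels_apply]

lemma ofLabels_transpose_mulVec (x : Fin n → ℝ) (k : Fin K) :
    ((ofLabels g)ᵀ *ᵥ x) k = ∑ i ∈ Finset.univ.filter (fun i => g i = k), x i := by
  simp [mulVec, dotProduct, ofLabels_apply, Finset.sum_filter]

lemma ofLabels_mem : ofLabels g ∈ clusteringMatrices n K := by
  refine ⟨fun i k => ?_, fun i => ⟨g i, by simp [ofLabels_apply], fun k hk => ?_⟩⟩
  · by_cases h : g i = k <;> simp [ofLabels_apply, h]
  · by_contra h
    simp [ofLabels_apply, Ne.symm h] at hk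

lemma exists_eq_ofLabels {Θ : Matrix (Fin n) (Fin K) ℝ} (h : Θ ∈ clusteringMatrices n K) :
    ∃ g : Fin n → Fin K, Θ = ofLabels g := by
  choose g hg hu using h.2
  refine ⟨g, ?_⟩
  ext i k
  rw [ofLabels_apply]
  split_ifs with hk
  · rw [← hk]; exact hg i
  · rcases h.1 i k with h0 | h1
    · exact h0
    · exact absurd (hu i k h1).symm hk

lemma community_ofLabels (k : Fin K) :
    community (ofLabels g) k = Finset.univ.filter fun i => g i = k := by
  ext i
  simp [community, ofLabels_apply]

lemma card_community_ofLabels (k : Fin K) : (community (ofLabels g) k).card = labelCount g k := by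
  rw [community_ofLabels]; rfl

lemma l2_ofLabels_mulVec_sq (c : Fin K → ℝ) :
    l2 (ofLabels g *ᵥ c) ^ 2 = ∑ k, labelCount g k * c k ^ 2 := by
  rw [l2_sq_sum, ← Finset.sum_fiberwise _ g]
  refine Finset.sum_congr rfl fun k _ => ?_
  rw [labelCount, ← nsmul_eq_mul, ← Finset.sum_const]
  exact Finset.sum_congr rfl fun i hi => by
    rw [ofLabels_mulVec, (Finset.mem_filter.1 hi).2]

end labels

lemma dot_mulVec_eq {ι κ : Type*} [Fintype ι] [Fintype κ] (M : Matrix ι κ ℝ) (x : ι → ℝ)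
    (y : κ → ℝ) : x ⬝ᵥ M *ᵥ y = (Mᵀ *ᵥ x) ⬝ᵥ y := by
  rw [dotProduct_mulVec, mulVec_transpose]

/-- `Q` acts on the span of the columns of `Θ` and on its orthogonal complement, with quadratic
form at least `g₁` on the former and at most `g₀` on the latter. -/
structure SpectralGap {n K : ℕ} (Θ : Matrix (Fin n) (Fin K) ℝ) (Q : Matrix (Fin n) (Fin n) ℝ)
    (g₀ g₁ : ℝ) : Prop where
  lower : ∀ c : Fin K → ℝ, g₁ * l2 (Θ *ᵥ c) ^ 2 ≤ (Θ *ᵥ c) ⬝ᵥ Q *ᵥ (Θ *ᵥ c)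
  upper : ∀ w : Fin n → ℝ, Θᵀ *ᵥ w = 0 → w ⬝ᵥ Q *ᵥ w ≤ g₀ * l2 w ^ 2
  orth : ∀ w : Fin n → ℝ, Θᵀ *ᵥ w = 0 → ∀ c : Fin K → ℝ, w ⬝ᵥ Q *ᵥ (Θ *ᵥ c) = 0

section perturbation
variable {n K : ℕ}

lemma l2_mulVec_of_orthogonal {V : Matrix (Fin n) (Fin n) ℝ} (hV : Vᵀ * V = 1)
    (y : Fin n → ℝ) : l2 (V *ᵥ y) ^ 2 = l2 y ^ 2 := by
  rw [l2_sq, l2_sq, dot_mulVec_eq, mulVec_mulVec, hV, one_mulVec]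

lemma l2_mulVec_of_orthonormal {U : Matrix (Fin n) (Fin K) ℝ} (hU : Uᵀ * U = 1)
    (y : Fin K → ℝ) : l2 (U *ᵥ y) ^ 2 = l2 y ^ 2 := by
  rw [l2_sq, l2_sq, dot_mulVec_eq, mulVec_mulVec, hU, one_mulVec]

lemma IsTopEigenvectors.transpose_mul_self {Q : Matrix (Fin n) (Fin n) ℝ}
    {U : Matrix (Fin n) (Fin K) ℝ} (h : IsTopEigenvectors Q U) : Uᵀ * U = 1 := by
  obtain ⟨V, lam, hK, hV, -, -, rfl⟩ := h
  ext i j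
  have := congrFun (congrFun hV (Fin.castLE hK i)) (Fin.castLE hK j)
  simpa [Matrix.mul_apply, Matrix.one_apply] using this

/-- The eigenvectors do not change when a multiple of the identity is subtracted. -/
lemma IsTopEigenvectors.sub_smul_one {Q : Matrix (Fin n) (Fin n) ℝ}
    {U : Matrix (Fin n) (Fin K) ℝ} (h : IsTopEigenvectors Q U) (a : ℝ) :
    IsTopEigenvectors (Q - a • (1 : Matrix (Fin n) (Fin n) ℝ)) U := by
  obtain ⟨V, lam, hK, hV, hl, hQ, hU⟩ := h
  refine ⟨V, fun i => lam i - a, hK, hV, fun i j hij => sub_le_sub_right (hl hij) a, ?_, hU⟩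
  rw [sub_mul, hQ]
  have : (diagonal fun i => lam i - a) = diagonal lam - a • (1 : Matrix (Fin n) (Fin n) ℝ) := by
    ext i j
    by_cases hij : i = j <;> simp [hij]
  rw [this, mul_sub]
  simp

/-- Weyl's inequality for the eigenvalues above the gap. -/
lemma le_eigenvalue_of_gap {g : Fin n → Fin K} (hne : ∀ k, ∃ i, g i = k)
    {Q R : Matrix (Fin n) (Fin n) ℝ} {g₁ e : ℝ}
    (hlow : ∀ c : Fin K → ℝ,
      g₁ * l2 (ofLabels g *ᵥ c) ^ 2 ≤ (ofLabels g *ᵥ c) ⬝ᵥ Q *ᵥ (ofLabels g *ᵥ c))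
    (he : specNorm (R - Q) ≤ e) {V : Matrix (Fin n) (Fin n) ℝ} {lam : Fin n → ℝ}
    (hV : Vᵀ * V = 1) (hl : Antitone lam) (hR : R * V = V * diagonal lam) (hK : K ≤ n)
    (k : Fin K) : g₁ - e ≤ lam (Fin.castLE hK k) := by
  classical
  -- Row `j < k` expresses orthogonality of `ofLabels g *ᵥ c` to the eigenvector `j`, and the other
  -- rows vanish. The zero row `k` makes `M` singular, which replaces the dimension count of
  -- Courant–Fischer.
  let M : Matrix (Fin K) (Fin K) ℝ := Matrix.of fun j l =>
    if j < k then (Vᵀ * ofLabels g) (Fin.castLE hK j) l else 0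
  have hdet : M.det = 0 := det_eq_zero_of_row_eq_zero k fun l => by simp [M]
  obtain ⟨c, hc0, hc⟩ := Matrix.exists_mulVec_eq_zero_iff.2 hdet
  set x := ofLabels g *ᵥ c with hx
  set y := Vᵀ *ᵥ x with hy
  have hVV : V * Vᵀ = 1 := mul_eq_one_comm.1 hV
  have hxy : V *ᵥ y = x := by rw [hy, mulVec_mulVec, hVV, one_mulVec]
  have hy0 : ∀ j : Fin n, j < Fin.castLE hK k → y j = 0 := by
    intro j hj
    have hjK : (j : ℕ) < K := lt_trans (Fin.lt_def.1 hj) k.2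
    have h1 := congrFun hc ⟨j, hjK⟩
    have hlt : (⟨j, hjK⟩ : Fin K) < k := Fin.lt_def.1 hj
    rw [hy, hx, mulVec_mulVec]
    simpa [M, mulVec, dotProduct, hlt] using h1
  have hxx : 0 < l2 x ^ 2 := by
    refine pow_pos (l2_pos fun h => hc0 ?_) 2
    ext k'
    obtain ⟨i, rfl⟩ := hne k'
    have := congrFun h i
    rwa [hx, ofLabels_mulVec] at this
  have h1 : x ⬝ᵥ R *ᵥ x = ∑ j, lam j * y j ^ 2 := by
    have : R *ᵥ x = V *ᵥ (diagonal lam *ᵥ y) := by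
      rw [← hxy, mulVec_mulVec, hR, ← mulVec_mulVec]
    rw [this, dot_mulVec_eq, ← hy]
    simp only [dotProduct, mulVec_diagonal]
    exact Finset.sum_congr rfl fun j _ => by ring
  have h2 : ∑ j, lam j * y j ^ 2 ≤ lam (Fin.castLE hK k) * l2 x ^ 2 := by
    rw [← hxy, l2_mulVec_of_orthogonal hV, l2_sq_sum, Finset.mul_sum]
    refine Finset.sum_le_sum fun j _ => ?_
    rcases lt_or_ge j (Fin.castLE hK k) with hj | hj
    · rw [hy0 j hj]; simp
    · exact mul_le_mul_of_nonneg_right (hl hj) (sq_nonneg _)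
  have h3 : x ⬝ᵥ R *ᵥ x = x ⬝ᵥ Q *ᵥ x + x ⬝ᵥ (R - Q) *ᵥ x := by
    rw [sub_mulVec, dotProduct_sub]; ring
  have h4 := abs_dot_mulVec_le (R - Q) x x
  have h5 := hlow c
  have h6 : specNorm (R - Q) * (l2 x * l2 x) ≤ e * l2 x ^ 2 := by
    rw [← sq]; exact mul_le_mul_of_nonneg_right he (sq_nonneg _)
  have h7 := (abs_le.1 h4).1
  by_contra hcon
  push Not at hcon
  nlinarith

/-- The coefficients of the orthogonal projection of the columns of `U` to the span of the columns
of `ofLabels g`. -/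
noncomputable def centers (g : Fin n → Fin K) (U : Matrix (Fin n) (Fin K) ℝ) :
    Matrix (Fin K) (Fin K) ℝ :=
  diagonal (fun k => ((labelCount g k : ℝ))⁻¹) * (ofLabels g)ᵀ * U

lemma ofLabels_transpose_mul_self (g : Fin n → Fin K) :
    (ofLabels g)ᵀ * ofLabels g = diagonal fun k => (labelCount g k : ℝ) := by
  ext k l
  rw [Matrix.mul_apply]
  by_cases h : k = l
  · subst h
    simp [ofLabels_apply, labelCount, ← ite_and]
  · rw [diagonal_apply_ne _ h]
    refine Finset.sum_eq_zero fun i _ => ?_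
    simp only [transpose_apply, ofLabels_apply]
    by_cases h1 : g i = k
    · simp [h1, h]
    · simp [h1]

lemma ofLabels_transpose_mul_residual {g : Fin n → Fin K} (hne : ∀ k, ∃ i, g i = k)
    (U : Matrix (Fin n) (Fin K) ℝ) :
    (ofLabels g)ᵀ * (U - ofLabels g * centers g U) = 0 := by
  have hd : (diagonal fun k => (labelCount g k : ℝ)) *
      diagonal (fun k => ((labelCount g k : ℝ))⁻¹) = 1 := by
    rw [diagonal_mul_diagonal, ← diagonal_one]
    congr 1; ext k
    obtain ⟨i, rfl⟩ := hne k
    have : (labelCount g (g i) : ℝ) ≠ 0 := by exact_mod_cast (labelCount_pos g i).ne'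
    exact mul_inv_cancel₀ this
  rw [Matrix.mul_sub, centers, ← Matrix.mul_assoc, ofLabels_transpose_mul_self, Matrix.mul_assoc,
    ← Matrix.mul_assoc (diagonal _) (diagonal _), hd, Matrix.one_mul, sub_self]

/-- Davis–Kahan bound for the residual of the leading eigenvectors. -/
theorem residual_le_of_gap {g : Fin n → Fin K} (hne : ∀ k, ∃ i, g i = k)
    {Q R : Matrix (Fin n) (Fin n) ℝ} {g₀ g₁ e : ℝ} (hQ : SpectralGap (ofLabels g) Q g₀ g₁)
    (he : specNorm (R - Q) ≤ e) (hgap : 0 < g₁ - g₀) (hsmall : 4 * e ≤ g₁ - g₀)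
    {U : Matrix (Fin n) (Fin K) ℝ} (hU : IsTopEigenvectors R U) (v : Fin K → ℝ) :
    l2 ((U - ofLabels g * centers g U) *ᵥ v) ^ 2 ≤ 2 * (e / (g₁ - g₀)) ^ 2 * l2 v ^ 2 := by
  have hUU := hU.transpose_mul_self
  obtain ⟨V, lam, hK, hV, hl, hR, hUV⟩ := hU
  set W := U - ofLabels g * centers g U with hW
  have hTW : (ofLabels g)ᵀ * W = 0 := ofLabels_transpose_mul_residual hne U
  have hWU : Wᵀ * U = Wᵀ * W := by
    have : U = W + ofLabels g * centers g U := by rw [hW]; abel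
    conv_lhs => rw [this]
    have h0 : Wᵀ * ofLabels g = 0 := by
      have := congrArg Matrix.transpose hTW
      simpa [transpose_mul] using this
    rw [Matrix.mul_add, ← Matrix.mul_assoc, h0, Matrix.zero_mul, add_zero]
  have he0 : 0 ≤ e := (specNorm_nonneg _).trans he
  -- the eigenvalue relation for the columns of `U`
  let lamK : Fin K → ℝ := fun k => lam (Fin.castLE hK k)
  have hRU : R * U = U * diagonal lamK := by
    ext i k
    have := congrFun (congrFun hR i) (Fin.castLE hK k)
    rw [mul_diagonal] at this
    rw [mul_diagonal, hUV]
    simpa [Matrix.mul_apply] using this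
  have hlam : ∀ k, g₁ - e ≤ lamK k :=
    le_eigenvalue_of_gap hne hQ.lower he hV hl hR hK
  set c : ℝ := 2 * (e / (g₁ - g₀)) ^ 2 with hc
  -- For an eigenvector `v` of `Wᵀ * W`, the form `(W *ᵥ v) ⬝ᵥ R *ᵥ (U *ᵥ v)` is computed twice.
  -- Through `R * U = U * diagonal lamK` it is at least `μ * (g₁ - e) * l2 v ^ 2`; through `R = Q +
  -- (R - Q)` and the invariance of the span it is at most `(g₀ * μ + e * √μ) * l2 v ^ 2`.
  have key : ∀ (μ : ℝ) (v : Fin K → ℝ), v ≠ 0 → (Wᵀ * W) *ᵥ v = μ • v → μ ≤ c := by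
    intro μ v hv hμ
    have hvv : 0 < l2 v ^ 2 := pow_pos (l2_pos hv) 2
    have hWv : l2 (W *ᵥ v) ^ 2 = μ * l2 v ^ 2 := by
      rw [l2_sq, dot_mulVec_eq, mulVec_mulVec, hμ, smul_dotProduct, smul_eq_mul, l2_sq]
    have hμ0 : 0 ≤ μ := by
      by_contra h
      push Not at h
      nlinarith [sq_nonneg (l2 (W *ᵥ v))]
    have hortho : (ofLabels g)ᵀ *ᵥ (W *ᵥ v) = 0 := by rw [mulVec_mulVec, hTW, zero_mulVec]
    have hUv : U *ᵥ v = W *ᵥ v + ofLabels g *ᵥ (centers g U *ᵥ v) := by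
      rw [hW, sub_mulVec, mulVec_mulVec]; abel
    have h1 : (W *ᵥ v) ⬝ᵥ R *ᵥ (U *ᵥ v) = μ * ∑ k, lamK k * v k ^ 2 := by
      have h2 : (Uᵀ * W) *ᵥ v = μ • v := by
        have : Uᵀ * W = Wᵀ * W := by
          have := congrArg Matrix.transpose hWU
          simpa [transpose_mul] using this
        rw [this, hμ]
      rw [mulVec_mulVec, hRU, ← mulVec_mulVec, dot_mulVec_eq, mulVec_mulVec, h2,
        smul_dotProduct, smul_eq_mul]
      congr 1
      simp only [dotProduct, mulVec_diagonal]
      exact Finset.sum_congr rfl fun j _ => by ring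
    have h2 : (g₁ - e) * l2 v ^ 2 ≤ ∑ k, lamK k * v k ^ 2 := by
      rw [l2_sq_sum, Finset.mul_sum]
      exact Finset.sum_le_sum fun k _ => mul_le_mul_of_nonneg_right (hlam k) (sq_nonneg _)
    have h3 : (W *ᵥ v) ⬝ᵥ R *ᵥ (U *ᵥ v)
        = (W *ᵥ v) ⬝ᵥ Q *ᵥ (W *ᵥ v) + (W *ᵥ v) ⬝ᵥ (R - Q) *ᵥ (U *ᵥ v) := by
      have : R *ᵥ (U *ᵥ v) = Q *ᵥ (U *ᵥ v) + (R - Q) *ᵥ (U *ᵥ v) := by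
        rw [sub_mulVec]; abel
      rw [this, dotProduct_add]
      congr 1
      conv_lhs => rw [hUv, mulVec_add, dotProduct_add, hQ.orth _ hortho]
      rw [add_zero]
    have h4 := hQ.upper _ hortho
    have h5 : (W *ᵥ v) ⬝ᵥ (R - Q) *ᵥ (U *ᵥ v) ≤ e * (√μ * l2 v ^ 2) := by
      refine (le_abs_self _).trans ((abs_dot_mulVec_le _ _ _).trans ?_)
      have e1 : l2 (U *ᵥ v) = l2 v := by
        rw [← Real.sqrt_sq (l2_nonneg (U *ᵥ v)), l2_mulVec_of_orthonormal hUU,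
          Real.sqrt_sq (l2_nonneg _)]
      have e2 : l2 (W *ᵥ v) = √μ * l2 v := by
        rw [← Real.sqrt_sq (l2_nonneg (W *ᵥ v)), hWv, Real.sqrt_mul hμ0,
          Real.sqrt_sq (l2_nonneg _)]
      rw [e1, e2]
      calc _ ≤ e * (√μ * l2 v * l2 v) := by
            gcongr
            exact mul_nonneg (mul_nonneg (Real.sqrt_nonneg _) (l2_nonneg _)) (l2_nonneg _)
        _ = _ := by ring
    rw [hWv] at h4
    have hs : √μ ^ 2 = μ := Real.sq_sqrt hμ0
    have hs0 := Real.sqrt_nonneg μ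
    have h6 : μ * (g₁ - e) ≤ g₀ * μ + e * √μ := by
      have : (μ * (g₁ - e)) * l2 v ^ 2 ≤ (g₀ * μ + e * √μ) * l2 v ^ 2 := by
        have := mul_le_mul_of_nonneg_left h2 hμ0
        nlinarith
      exact le_of_mul_le_mul_right this hvv
    have h7 : √μ * (g₁ - g₀ - e) ≤ e := by
      rcases hs0.eq_or_lt with h0 | h0
      · rw [← h0]; simpa using he0
      · refine le_of_mul_le_mul_left (a := √μ) ?_ h0
        nlinarith
    -- Since `e` is at most a quarter of the gap, `√μ` is at most `4 / 3` of `e / (g₁ - g₀)`, and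
    -- `16 / 9 ≤ 2`.
    have h8 : √μ * (3 * (g₁ - g₀)) ≤ 4 * e := by nlinarith
    have h9 : 3 * √μ ≤ 4 * (e / (g₁ - g₀)) := by
      rw [← mul_div_assoc, le_div_iff₀ hgap]; linarith
    have h10 : 0 ≤ e / (g₁ - g₀) := by positivity
    rw [hc]
    nlinarith
  have hpsd : (c • (1 : Matrix (Fin K) (Fin K) ℝ) - Wᵀ * W).PosSemidef := by
    have hH : (c • (1 : Matrix (Fin K) (Fin K) ℝ) - Wᵀ * W).IsHermitian := by
      rw [IsHermitian, conjTranspose_eq_transpose_of_trivial]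
      simp [transpose_mul]
    rw [hH.posSemidef_iff_eigenvalues_nonneg]
    intro j
    have h1 := hH.mulVec_eigenvectorBasis j
    set v : Fin K → ℝ := (hH.eigenvectorBasis j).ofLp with hv
    have hv0 : v ≠ 0 := by
      intro h
      have h2 : hH.eigenvectorBasis j = 0 := by
        ext i; exact congrFun h i
      exact hH.eigenvectorBasis.orthonormal.ne_zero j h2
    have h2 : (Wᵀ * W) *ᵥ v = (c - hH.eigenvalues j) • v := by
      rw [sub_mulVec, smul_mulVec, one_mulVec] at h1
      rw [sub_smul, ← h1]; abel
    have := key _ v hv0 h2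
    simp only [Pi.zero_apply]; linarith
  have h1 := hpsd.dotProduct_mulVec_nonneg v
  rw [star_trivial, sub_mulVec, smul_mulVec, one_mulVec, dotProduct_sub, dotProduct_smul,
    ← mulVec_mulVec, dot_mulVec_eq Wᵀ, transpose_transpose, ← l2_sq, ← l2_sq, smul_eq_mul] at h1
  linarith

end perturbation

/-! ### From eigenvectors to clusters -/

section kmeans
variable {n K : ℕ} {g : Fin n → Fin K}

lemma mul_eq_rows (g : Fin n → Fin K) (X : Matrix (Fin K) (Fin K) ℝ) (i : Fin n) :
    (ofLabels g * X) i = X (g i) := by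
  ext k
  simp [Matrix.mul_apply, ofLabels_apply]

lemma ofLabels_mul_permMatrix (g : Fin n → Fin K) (σ : Equiv.Perm (Fin K)) :
    ofLabels g * σ.permMatrix ℝ = ofLabels (σ ∘ g) := by
  ext i k
  rw [mul_eq_rows]
  simp [Equiv.Perm.permMatrix, PEquiv.toMatrix_apply, ofLabels_apply, eq_comm]

/-- A misplaced node changes at most two entries, in its estimated and in its true column. This is
the factor between numbers of nodes and numbers of entries. -/
lemma zeroNormOn_ofLabels_sub_le (G : Finset (Fin n)) (g g' : Fin n → Fin K) :
    zeroNormOn G (ofLabels g' - ofLabels g) ≤ 2 * (G.filter fun i => g' i ≠ g i).card := by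
  classical
  unfold zeroNormOn
  have hsub : (Finset.univ.filter fun p : Fin n × Fin K =>
      p.1 ∈ G ∧ (ofLabels g' - ofLabels g) p.1 p.2 ≠ 0) ⊆
      (G.filter fun i => g' i ≠ g i).biUnion fun i => {(i, g' i), (i, g i)} := by
    rintro ⟨i, k⟩ hp
    replace hp := (Finset.mem_filter.1 hp).2
    simp only [Matrix.sub_apply, ofLabels_apply] at hp
    simp only [Finset.mem_biUnion, Finset.mem_filter, Finset.mem_insert, Finset.mem_singleton,
      Prod.mk.injEq]
    refine ⟨i, ⟨hp.1, fun h => hp.2 (by rw [h, sub_self])⟩, ?_⟩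
    by_contra hcon
    push Not at hcon
    have h1 : ¬ g' i = k := fun h => hcon.1 rfl h.symm
    have h2 : ¬ g i = k := fun h => hcon.2 rfl h.symm
    exact hp.2 (by simp [h1, h2])
  refine (Finset.card_le_card hsub).trans ?_
  rw [mul_comm]
  exact Finset.card_biUnion_le_card_mul _ _ _ fun i _ => Finset.card_le_two

lemma overallError_le_of_perm (g g' : Fin n → Fin K) (σ : Equiv.Perm (Fin K)) {c : ℝ}
    (h : ((Finset.univ.filter fun i => σ (g' i) ≠ g i).card : ℝ) ≤ c) :
    overallError (ofLabels g') (ofLabels g) ≤ (n : ℝ)⁻¹ * (2 * c) := by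
  unfold overallError
  refine mul_le_mul_of_nonneg_left ?_ (by positivity)
  refine (ciInf_le (Set.finite_range _).bddBelow σ).trans ?_
  rw [ofLabels_mul_permMatrix, zeroNorm]
  have := zeroNormOn_ofLabels_sub_le Finset.univ g (σ ∘ g')
  calc _ ≤ ((2 * (Finset.univ.filter fun i => σ (g' i) ≠ g i).card : ℕ) : ℝ) := by
        exact_mod_cast this
    _ ≤ 2 * c := by push_cast; linarith

lemma communityError_le_of_perm [Nonempty (Fin K)] (hne : ∀ k, ∃ i, g i = k) (g' : Fin n → Fin K)
    (σ : Equiv.Perm (Fin K)) {c : ℝ}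
    (h : ∀ k, ((Finset.univ.filter fun i => g i = k ∧ σ (g' i) ≠ k).card : ℝ)
      ≤ c * labelCount g k) :
    communityError (ofLabels g') (ofLabels g) ≤ 2 * c := by
  unfold communityError
  refine (ciInf_le (Set.finite_range _).bddBelow σ).trans ?_
  refine ciSup_le fun k => ?_
  have hpos : (0 : ℝ) < labelCount g k := by
    obtain ⟨i, rfl⟩ := hne k
    exact_mod_cast labelCount_pos g i
  rw [ofLabels_mul_permMatrix, card_community_ofLabels, inv_mul_le_iff₀ hpos]
  have h1 := zeroNormOn_ofLabels_sub_le (community (ofLabels g) k) g (σ ∘ g')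
  have h2 : ((community (ofLabels g) k).filter fun i => (σ ∘ g') i ≠ g i)
      = Finset.univ.filter fun i => g i = k ∧ σ (g' i) ≠ k := by
    ext i
    simp only [community_ofLabels, Finset.mem_filter, Finset.mem_univ, true_and,
      Function.comp_apply]
    constructor
    · rintro ⟨h, h'⟩; exact ⟨h, h ▸ h'⟩
    · rintro ⟨h, h'⟩; exact ⟨h, h ▸ h'⟩
  rw [h2] at h1
  calc _ ≤ ((2 * (Finset.univ.filter fun i => g i = k ∧ σ (g' i) ≠ k).card : ℕ) : ℝ) := by
        exact_mod_cast h1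
    _ ≤ labelCount g k * (2 * c) := by push_cast; linarith [h k]

/-- The rows of the projected eigenvectors are well separated when the residual is small. -/
lemma half_le_transpose_mulVec (hne : ∀ k, ∃ i, g i = k) {U : Matrix (Fin n) (Fin K) ℝ}
    (hU : Uᵀ * U = 1)
    (hW : ∀ v, l2 ((U - ofLabels g * centers g U) *ᵥ v) ^ 2 ≤ 1 / 2 * l2 v ^ 2)
    (c : Fin K → ℝ) : 1 / 2 * l2 (ofLabels g *ᵥ c) ^ 2 ≤ l2 (Uᵀ *ᵥ (ofLabels g *ᵥ c)) ^ 2 := by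
  set W := U - ofLabels g * centers g U with hWdef
  have hTW : (ofLabels g)ᵀ * W = 0 := ofLabels_transpose_mul_residual hne U
  have hUv : ∀ v, U *ᵥ v = W *ᵥ v + ofLabels g *ᵥ (centers g U *ᵥ v) := fun v => by
    rw [hWdef, sub_mulVec, mulVec_mulVec]; abel
  have horth : ∀ (a v : Fin K → ℝ), (ofLabels g *ᵥ a) ⬝ᵥ (W *ᵥ v) = 0 := fun a v => by
    rw [dotProduct_comm, dot_mulVec_eq (ofLabels g), mulVec_mulVec, hTW, zero_mulVec,
      zero_dotProduct]
  have hbig : ∀ v, 1 / 2 * l2 v ^ 2 ≤ l2 (ofLabels g *ᵥ (centers g U *ᵥ v)) ^ 2 := fun v => by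
    have h1 : l2 v ^ 2 = l2 (W *ᵥ v) ^ 2 + l2 (ofLabels g *ᵥ (centers g U *ᵥ v)) ^ 2 := by
      rw [← l2_mulVec_of_orthonormal hU, hUv, l2_sq, dotProduct_add, add_dotProduct,
        add_dotProduct, horth, dotProduct_comm (W *ᵥ v) (ofLabels g *ᵥ _), horth, l2_sq, l2_sq]
      ring
    linarith [hW v]
  -- Injectivity of the square matrix of centers makes every `u` in the span a projection of some `U
  -- *ᵥ v` with `l2 v ^ 2 ≤ 2 * l2 u ^ 2`. Then `l2 u ^ 2 = (Uᵀ *ᵥ u) ⬝ᵥ v`, and Cauchy–Schwarz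
  -- gives the lower bound.
  have hinj : Function.Injective (centers g U).mulVec := by
    intro a b hab
    have h0 : centers g U *ᵥ (a - b) = 0 := by rw [mulVec_sub, sub_eq_zero]; exact hab
    have h1 := hbig (a - b)
    rw [h0, mulVec_zero, l2_zero] at h1
    have h2 : l2 (a - b) = 0 := by nlinarith [l2_nonneg (a - b)]
    exact sub_eq_zero.1 (l2_eq_zero.1 h2)
  obtain ⟨v, rfl⟩ := mulVec_surjective_iff_isUnit.2 (mulVec_injective_iff_isUnit.1 hinj) c
  set u := ofLabels g *ᵥ (centers g U *ᵥ v) with hu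
  have h1 : l2 u ^ 2 = (Uᵀ *ᵥ u) ⬝ᵥ v := by
    rw [← dot_mulVec_eq, hUv, dotProduct_add, hu, horth, zero_add, l2_sq]
  have h2 := (le_abs_self _).trans (abs_dot_le (Uᵀ *ᵥ u) v)
  have h3 := hbig v
  rw [← h1] at h2
  have h4 : (l2 u ^ 2) ^ 2 ≤ l2 (Uᵀ *ᵥ u) ^ 2 * l2 v ^ 2 := by
    rw [← mul_pow]
    exact pow_le_pow_left₀ (sq_nonneg _) h2 2
  rcases (sq_nonneg (l2 u)).eq_or_lt with h0 | h0
  · rw [← h0, mul_zero]; exact sq_nonneg _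
  · have h5 : l2 u ^ 2 * (l2 u ^ 2) ≤ l2 u ^ 2 * (2 * l2 (Uᵀ *ᵥ u) ^ 2) := by
      nlinarith [sq_nonneg (l2 (Uᵀ *ᵥ u))]
    linarith [le_of_mul_le_mul_left h5 h0]

/-- Distance between two rows of the centers. -/
lemma center_dist (hne : ∀ k, ∃ i, g i = k) {U : Matrix (Fin n) (Fin K) ℝ}
    (hU : Uᵀ * U = 1)
    (hW : ∀ v, l2 ((U - ofLabels g * centers g U) *ᵥ v) ^ 2 ≤ 1 / 2 * l2 v ^ 2)
    {k k' : Fin K} (hk : k ≠ k') :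
    1 / 2 * ((labelCount g k : ℝ)⁻¹ + (labelCount g k' : ℝ)⁻¹)
      ≤ l2 (centers g U k - centers g U k') ^ 2 := by
  have hpos : ∀ k, (0 : ℝ) < labelCount g k := fun k => by
    obtain ⟨i, rfl⟩ := hne k
    exact_mod_cast labelCount_pos g i
  -- The corresponding vector in the span is the difference of the normalised indicators of the two
  -- communities; `Uᵀ` maps it to the difference of the two centers.
  set c : Fin K → ℝ := fun j => if j = k then (labelCount g k : ℝ)⁻¹ else
    if j = k' then -(labelCount g k' : ℝ)⁻¹ else 0 with hc
  have h1 : l2 (ofLabels g *ᵥ c) ^ 2 = (labelCount g k : ℝ)⁻¹ + (labelCount g k' : ℝ)⁻¹ := by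
    rw [l2_ofLabels_mulVec_sq, ← Finset.sum_subset (Finset.subset_univ {k, k'}),
      Finset.sum_pair hk]
    · simp only [hc, if_true, if_neg hk.symm]
      have := hpos k; have := hpos k'
      field_simp
    · intro j _ hj
      simp only [Finset.mem_insert, Finset.mem_singleton, not_or] at hj
      simp [hc, hj.1, hj.2]
  have h2 : Uᵀ *ᵥ (ofLabels g *ᵥ c) = centers g U k - centers g U k' := by
    have hcd : c = diagonal (fun k => ((labelCount g k : ℝ))⁻¹) *ᵥ
        (Pi.single k 1 - Pi.single k' 1) := by
      ext j
      rw [mulVec_diagonal]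
      by_cases h : j = k
      · subst h; simp [hc, hk]
      · by_cases h' : j = k'
        · subst h'; simp [hc, h]
        · simp [hc, h, h']
    have hct : Uᵀ * (ofLabels g * diagonal (fun k => ((labelCount g k : ℝ))⁻¹))
        = (centers g U)ᵀ := by
      simp [centers, transpose_mul, Matrix.mul_assoc]
    rw [hcd, mulVec_mulVec, mulVec_mulVec, Matrix.mul_assoc, hct, mulVec_sub]
    simp only [mulVec_single_one]
    rfl
  rw [← h1, ← h2]
  exact half_le_transpose_mulVec hne hU hW c

/-- The operator bound is summed over the `K` coordinate vectors; the factor `K` of the error bound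
arises here. -/
lemma frobSq_le_of_mulVec {m : ℕ} {M : Matrix (Fin m) (Fin K) ℝ} {c : ℝ}
    (h : ∀ v, l2 (M *ᵥ v) ^ 2 ≤ c * l2 v ^ 2) : frobSq M ≤ K * c := by
  rw [← frobSq_transpose, frobSq_eq_sum_rows]
  calc _ ≤ ∑ _k : Fin K, c := by
        refine Finset.sum_le_sum fun k _ => ?_
        have := h (Pi.single k 1)
        rw [mulVec_single_one, l2_single, one_pow, mul_one] at this
        exact this
    _ = _ := by simp

end kmeans

/-- Clustering errors of spectral clustering in terms of the relative error of the matrix. -/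
theorem clustering_error_le {n K : ℕ} (hK : 0 < K) {g : Fin n → Fin K} (hne : ∀ k, ∃ i, g i = k)
    {Q R : Matrix (Fin n) (Fin n) ℝ} {g₀ g₁ e a ε N : ℝ}
    (hQ : SpectralGap (ofLabels g) Q g₀ g₁)
    (he : specNorm (R - a • (1 : Matrix (Fin n) (Fin n) ℝ) - Q) ≤ e) (hgap : 0 < g₁ - g₀)
    (hε : 0 < ε) (hN : ∀ k, (labelCount g k : ℝ) ≤ N)
    {U Θhat : Matrix (Fin n) (Fin K) ℝ} (hU : IsTopEigenvectors R U)
    (hΘ : IsApproxKMeans ε U Θhat) :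
    communityError Θhat (ofLabels g) ≤ 128 * (2 + ε) * K * (e / (g₁ - g₀)) ^ 2 ∧
    overallError Θhat (ofLabels g) ≤ 128 * (2 + ε) * K * (e / (g₁ - g₀)) ^ 2 * (N / n) ∧
    (128 * (2 + ε) * K * (e / (g₁ - g₀)) ^ 2 * n < 1 →
      communityError Θhat (ofLabels g) ≤ 0 ∧ overallError Θhat (ofLabels g) ≤ 0) := by
  classical
  have : Nonempty (Fin K) := ⟨⟨0, hK⟩⟩
  obtain ⟨hΘ1, X, hX⟩ := hΘ
  obtain ⟨g', rfl⟩ := exists_eq_ofLabels hΘ1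
  have hpos : ∀ k, (0 : ℝ) < labelCount g k := fun k => by
    obtain ⟨i, rfl⟩ := hne k
    exact_mod_cast labelCount_pos g i
  have hN0 : 0 < N := (hpos ⟨0, hK⟩).trans_le (hN _)
  have he0 : 0 ≤ e := (specNorm_nonneg _).trans he
  have hKn : (K : ℝ) ≤ n := by obtain ⟨_, _, h, _⟩ := hU; exact_mod_cast h
  have hK1 : (1 : ℝ) ≤ K := by exact_mod_cast hK
  have hn0 : (0 : ℝ) < n := by linarith
  have hsum : (n : ℝ) ≤ K * N := by
    calc (n : ℝ) = ∑ k, (labelCount g k : ℝ) := by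
          have := Finset.card_eq_sum_card_fiberwise (f := g) (s := Finset.univ)
            (t := Finset.univ) (fun _ _ => Finset.mem_univ _)
          rw [Finset.card_univ, Fintype.card_fin] at this
          exact_mod_cast this
      _ ≤ ∑ _k : Fin K, N := Finset.sum_le_sum fun k _ => hN k
      _ = _ := by simp
  set x := (e / (g₁ - g₀)) ^ 2 with hx
  have hx0 : 0 ≤ x := sq_nonneg _
  -- If `e` exceeds a quarter of the gap, the factor in front is at least `8 * K`, whereas the
  -- errors are trivially at most `2` and `2 * K * (N / n)`.
  by_cases hsmall : 4 * e ≤ g₁ - g₀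
  · have hres := residual_le_of_gap hne hQ he hgap hsmall (hU.sub_smul_one a)
    have hx16 : x ≤ 1 / 16 := by
      have : e / (g₁ - g₀) ≤ 1 / 4 := by rw [div_le_iff₀ hgap]; linarith
      have h0 : 0 ≤ e / (g₁ - g₀) := by positivity
      rw [hx]; nlinarith
    have hUU := hU.transpose_mul_self
    have hW : ∀ v, l2 ((U - ofLabels g * centers g U) *ᵥ v) ^ 2 ≤ 1 / 2 * l2 v ^ 2 := fun v =>
      (hres v).trans (mul_le_mul_of_nonneg_right (by linarith) (sq_nonneg _))
    have hWF := frobSq_le_of_mulVec hres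
    -- distance between estimated and true centers
    have hneg : ∀ M : Matrix (Fin n) (Fin K) ℝ, frobSq (-M) = frobSq M := fun M => by
      simp [frobSq]
    -- The true labels with the projected centers compete in the K-means problem. The constant is `2
    -- * (1 + ε) + 2` times the residual, which is at most `2 * K * x`.
    have hZ : frobSq (ofLabels g' * X - ofLabels g * centers g U) ≤ 4 * (2 + ε) * K * x := by
      have h1 := hX _ (ofLabels_mem g) (centers g U)
      have h2 : ofLabels g' * X - ofLabels g * centers g U
          = (ofLabels g' * X - U) + (U - ofLabels g * centers g U) := by abel
      rw [h2]
      refine (frobSq_add_le _ _).trans ?_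
      rw [← neg_sub U (ofLabels g * centers g U), hneg] at h1
      have h3 := mul_le_mul_of_nonneg_left hWF (by linarith : 0 ≤ 2 + ε)
      nlinarith
    -- With the threshold `1 / 8`, two good nodes of different communities sharing a label would put
    -- their centers at less than half of the squared distance guaranteed by `center_dist`.
    set S : Finset (Fin n) := Finset.univ.filter fun i =>
      (8 * labelCount g (g i) : ℝ)⁻¹ ≤ l2 (X (g' i) - centers g U (g i)) ^ 2 with hS
    have hsep : ∀ i ∉ S, ∀ j ∉ S, g i ≠ g j → g' i ≠ g' j := by
      intro i hi j hj hij h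
      have hi' : l2 (X (g' i) - centers g U (g i)) ^ 2 < (8 * labelCount g (g i) : ℝ)⁻¹ := by
        simpa [hS] using hi
      have hj' : l2 (X (g' j) - centers g U (g j)) ^ 2 < (8 * labelCount g (g j) : ℝ)⁻¹ := by
        simpa [hS] using hj
      have h1 := center_dist hne hUU hW hij
      have h2 : centers g U (g i) - centers g U (g j)
          = (X (g' j) - centers g U (g j)) - (X (g' i) - centers g U (g i)) := by
        rw [h]; abel
      rw [h2] at h1
      have h3 := pow_le_pow_left₀ (l2_nonneg _)
        (l2_sub_le (X (g' j) - centers g U (g j)) (X (g' i) - centers g U (g i))) 2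
      rw [mul_inv] at hi' hj'
      have := hpos (g i)
      have := hpos (g j)
      have h4 : (0 : ℝ) < (labelCount g (g i) : ℝ)⁻¹ := by positivity
      have h5 : (0 : ℝ) < (labelCount g (g j) : ℝ)⁻¹ := by positivity
      nlinarith [sq_nonneg (l2 (X (g' j) - centers g U (g j)) -
        l2 (X (g' i) - centers g U (g i)))]
    have hD : ∑ i ∈ S, ((labelCount g (g i) : ℝ))⁻¹ ≤ 32 * (2 + ε) * K * x := by
      calc _ ≤ ∑ i ∈ S, 8 * l2 (X (g' i) - centers g U (g i)) ^ 2 := by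
            refine Finset.sum_le_sum fun i hi => ?_
            have := (Finset.mem_filter.1 hi).2
            rw [mul_inv] at this; linarith
        _ ≤ ∑ i, 8 * l2 (X (g' i) - centers g U (g i)) ^ 2 :=
            Finset.sum_le_sum_of_subset_of_nonneg (Finset.subset_univ _)
              fun i _ _ => by positivity
        _ = 8 * frobSq (ofLabels g' * X - ofLabels g * centers g U) := by
            rw [← Finset.mul_sum, frobSq_eq_sum_rows]
            congr 1
            refine Finset.sum_congr rfl fun i _ => ?_
            rw [← mul_eq_rows g' X i, ← mul_eq_rows g (centers g U) i]; rfl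
        _ ≤ _ := by linarith
    set D := ∑ i ∈ S, ((labelCount g (g i) : ℝ))⁻¹ with hDdef
    have hD0 : 0 ≤ D := Finset.sum_nonneg fun i _ => by have := hpos (g i); positivity
    obtain ⟨σ, h1, h2⟩ := exists_perm_of_separated g g' S hsep hne hN0.le hN
    refine ⟨?_, ?_, fun hlt => ?_⟩
    · refine (communityError_le_of_perm hne g' σ h2).trans ?_
      have : 0 ≤ (2 + ε) * K * x := by positivity
      linarith
    · refine (overallError_le_of_perm g g' σ h1).trans ?_
      calc (n : ℝ)⁻¹ * (2 * (2 * N * D)) = 4 * D * (N / n) := by rw [div_eq_mul_inv]; ring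
        _ ≤ _ := by
          refine mul_le_mul_of_nonneg_right ?_ (by positivity)
          linarith
    · have hDn : D * n < 1 := by
        refine lt_of_le_of_lt (mul_le_mul_of_nonneg_right ?_ hn0.le) hlt
        have : 0 ≤ (2 + ε) * K * x := by positivity
        linarith
      -- A bad node has weight at least `1 / n`, so `D * n < 1` leaves no bad node.
      have hSe : S = ∅ := by
        by_contra hne'
        obtain ⟨i, hi⟩ := Finset.nonempty_iff_ne_empty.2 hne'
        have h3 : (labelCount g (g i) : ℝ)⁻¹ ≤ D :=
          Finset.single_le_sum (f := fun i => (labelCount g (g i) : ℝ)⁻¹)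
            (fun i _ => by have := hpos (g i); positivity) hi
        have h4 : (labelCount g (g i) : ℝ) ≤ n := by
          have : labelCount g (g i) ≤ n := by
            unfold labelCount
            simpa using Finset.card_le_univ (Finset.univ.filter fun j => g j = g i)
          exact_mod_cast this
        have h5 : 1 ≤ (labelCount g (g i) : ℝ)⁻¹ * n := by
          rw [← div_eq_inv_mul, one_le_div (hpos _)]; exact h4
        nlinarith
      rw [hSe, Finset.sum_empty] at h1 h2
      constructor
      · simpa using communityError_le_of_perm hne g' σ h2
      · simpa using overallError_le_of_perm g g' σ h1
  · have hx16 : 1 / 16 ≤ x := by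
      push Not at hsmall
      have : 1 / 4 ≤ e / (g₁ - g₀) := by rw [le_div_iff₀ hgap]; linarith
      rw [hx]; nlinarith
    have hbig : 8 * (K : ℝ) ≤ 128 * (2 + ε) * K * x := by
      have : (0 : ℝ) ≤ K * x := by positivity
      nlinarith
    refine ⟨?_, ?_, fun hlt => ?_⟩
    · refine (communityError_le_of_perm (c := 1) hne g' 1 fun k => ?_).trans (by linarith)
      rw [one_mul]
      refine Nat.cast_le.2 (Finset.card_le_card fun i hi => ?_)
      exact Finset.mem_filter.2 ⟨Finset.mem_univ _, (Finset.mem_filter.1 hi).2.1⟩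
    · refine (overallError_le_of_perm (c := n) g g' 1 ?_).trans ?_
      · norm_cast
        simpa using Finset.card_le_univ
          (Finset.univ.filter fun i => (1 : Equiv.Perm (Fin K)) (g' i) ≠ g i)
      · calc (n : ℝ)⁻¹ * (2 * n) ≤ (n : ℝ)⁻¹ * (2 * (K * N)) := by gcongr
          _ = 2 * K * (N / n) := by rw [div_eq_mul_inv]; ring
          _ ≤ _ := by
            refine mul_le_mul_of_nonneg_right ?_ (by positivity)
            linarith
    · exfalso
      nlinarith

/-! ### The spectral gap of the edge probability matrix -/

lemma dot_mulVec_le_of_eigenvalues {K : ℕ} {M : Matrix (Fin K) (Fin K) ℝ} (hM : M.IsSymm) {c : ℝ}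
    (h : ∀ μ ∈ spectrum ℝ M, μ ≤ c) (x : Fin K → ℝ) : x ⬝ᵥ M *ᵥ x ≤ c * l2 x ^ 2 := by
  have hH : (c • (1 : Matrix (Fin K) (Fin K) ℝ) - M).IsHermitian := by
    rw [IsHermitian, conjTranspose_eq_transpose_of_trivial]
    simp [hM.eq]
  have hpsd : (c • (1 : Matrix (Fin K) (Fin K) ℝ) - M).PosSemidef := by
    rw [hH.posSemidef_iff_eigenvalues_nonneg]
    intro j
    have h1 := hH.eigenvalues_mem_spectrum_real j
    have h2 : c - hH.eigenvalues j ∈ spectrum ℝ M := by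
      rw [spectrum.mem_iff] at h1 ⊢
      rw [← IsUnit.neg_iff] at h1
      convert h1 using 2
      rw [Algebra.algebraMap_eq_smul_one, Algebra.algebraMap_eq_smul_one, sub_smul]
      abel
    have := h _ h2
    simp only [Pi.zero_apply]; linarith
  have h1 := hpsd.dotProduct_mulVec_nonneg x
  rw [star_trivial, sub_mulVec, smul_mulVec, one_mulVec, dotProduct_sub, dotProduct_smul,
    ← l2_sq, smul_eq_mul] at h1
  linarith

lemma le_dot_mulVec_of_eigenvalues {K : ℕ} {M : Matrix (Fin K) (Fin K) ℝ} (hM : M.IsSymm) {c : ℝ}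
    (h : ∀ μ ∈ spectrum ℝ M, c ≤ μ) (x : Fin K → ℝ) : c * l2 x ^ 2 ≤ x ⬝ᵥ M *ᵥ x := by
  have h1 := dot_mulVec_le_of_eigenvalues (M := -M) (c := -c) (by
    rw [IsSymm, transpose_neg, hM.eq]) (fun μ hμ => by
      rw [← spectrum.neg_eq] at hμ
      have := h _ (Set.mem_neg.1 hμ)
      linarith) x
  rw [neg_mulVec, dotProduct_neg] at h1
  linarith

lemma l2_mulVec_le_of_eigenvalues {K : ℕ} {M : Matrix (Fin K) (Fin K) ℝ} (hM : M.IsSymm) {c : ℝ}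
    (hc : 0 < c) (h : ∀ μ ∈ spectrum ℝ M, 0 ≤ μ ∧ μ ≤ c) (x : Fin K → ℝ) :
    l2 (M *ᵥ x) ≤ c * l2 x := by
  have hup := dot_mulVec_le_of_eigenvalues hM fun μ hμ => (h μ hμ).2
  have hlow := le_dot_mulVec_of_eigenvalues hM fun μ hμ => (h μ hμ).1
  set y := M *ᵥ x with hy
  -- Adding the bounds at `c • x + y` and `c • x - y` eliminates `y ⬝ᵥ M *ᵥ y` and leaves `3 * c *
  -- l2 y ^ 2 ≤ c ^ 3 * l2 x ^ 2 + 2 * c ^ 2 * (x ⬝ᵥ y)`.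
  have h1 := hup (c • x + y)
  have h2 := hlow (c • x - y)
  have h3 : y ⬝ᵥ M *ᵥ x = l2 y ^ 2 := by rw [l2_sq, ← hy]
  have h4 : x ⬝ᵥ M *ᵥ y = l2 y ^ 2 := by rw [dot_mulVec_eq, hM.eq, l2_sq, ← hy]
  have h5 := hup x
  have h6 := hup y
  have h7 := hlow y
  rw [l2_sq] at h1
  simp only [mulVec_add, mulVec_sub, mulVec_smul, dotProduct_add, add_dotProduct, dotProduct_sub,
    sub_dotProduct, smul_dotProduct, dotProduct_smul, smul_eq_mul] at h1 h2
  rw [← hy, ← l2_sq x, ← l2_sq y, dotProduct_comm y x, h4] at h1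
  rw [← hy, h4, ← l2_sq] at h2
  have hxy : x ⬝ᵥ y ≤ c * l2 x ^ 2 := h5
  have hxy0 : 0 ≤ x ⬝ᵥ y := by have := hlow x; rwa [zero_mul] at this
  refine le_of_sq_le_sq ?_ (mul_nonneg hc.le (l2_nonneg x))
  rw [mul_pow]
  nlinarith

section gap
variable {n K : ℕ} {g : Fin n → Fin K}

/-- The squared norm of the vector of community sums. -/
lemma le_l2_transpose_mulVec {m : ℝ} (hm : ∀ k, m ≤ labelCount g k) (c : Fin K → ℝ) :
    m * l2 (ofLabels g *ᵥ c) ^ 2 ≤ l2 ((ofLabels g)ᵀ *ᵥ (ofLabels g *ᵥ c)) ^ 2 := by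
  rw [mulVec_mulVec, ofLabels_transpose_mul_self, l2_ofLabels_mulVec_sq, l2_sq_sum, Finset.mul_sum]
  refine Finset.sum_le_sum fun k _ => ?_
  rw [mulVec_diagonal, mul_pow]
  have : (0 : ℝ) ≤ labelCount g k := Nat.cast_nonneg _
  have h1 := mul_le_mul_of_nonneg_right (hm k) (mul_nonneg this (sq_nonneg (c k)))
  nlinarith

lemma edgeProb_dot (α : ℝ) (H : Matrix (Fin K) (Fin K) ℝ) (Θ : Matrix (Fin n) (Fin K) ℝ)
    (x y : Fin n → ℝ) :
    x ⬝ᵥ edgeProb α H Θ *ᵥ y = α * ((Θᵀ *ᵥ x) ⬝ᵥ H *ᵥ (Θᵀ *ᵥ y)) := by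
  rw [edgeProb, ← mulVec_mulVec, ← mulVec_mulVec, dot_mulVec_eq, smul_mulVec, dotProduct_smul,
    smul_eq_mul]

lemma edgeProb_ofLabels_apply (α : ℝ) (H : Matrix (Fin K) (Fin K) ℝ) (g : Fin n → Fin K)
    (i j : Fin n) : edgeProb α H (ofLabels g) i j = (α • H) (g i) (g j) := by
  rw [edgeProb, Matrix.mul_assoc]
  simp [Matrix.mul_apply, ofLabels_apply]

/-- The form factors through the community sums: these vanish on the complement, and on the span
they multiply the squared norm by at least `m`. -/
lemma spectralGap_edgeProb {α m Cl : ℝ} (hα : 0 < α) (hCl : 0 < Cl)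
    (hm : ∀ k, m ≤ labelCount g k) {H : Matrix (Fin K) (Fin K) ℝ} (hH : H.IsSymm)
    (hs : spectrum ℝ H ⊆ Set.Icc Cl⁻¹ Cl) :
    SpectralGap (ofLabels g) (edgeProb α H (ofLabels g)) 0 (α * (m / Cl)) where
  lower c := by
    rw [edgeProb_dot]
    have h1 := le_dot_mulVec_of_eigenvalues hH (fun μ hμ => (hs hμ).1)
      ((ofLabels g)ᵀ *ᵥ (ofLabels g *ᵥ c))
    have h2 := le_l2_transpose_mulVec hm c
    have h3 := mul_le_mul_of_nonneg_left h2 (inv_nonneg.2 hCl.le)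
    calc _ = α * (Cl⁻¹ * (m * l2 (ofLabels g *ᵥ c) ^ 2)) := by rw [div_eq_mul_inv]; ring
      _ ≤ _ := mul_le_mul_of_nonneg_left (h3.trans h1) hα.le
  upper w hw := by rw [edgeProb_dot, hw]; simp
  orth w hw c := by rw [edgeProb_dot, hw]; simp

lemma diag_mem_of_spectrum {Cl : ℝ} {H : Matrix (Fin K) (Fin K) ℝ} (hH : H.IsSymm)
    (hs : spectrum ℝ H ⊆ Set.Icc Cl⁻¹ Cl) (k : Fin K) : Cl⁻¹ ≤ H k k ∧ H k k ≤ Cl := by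
  have h1 := le_dot_mulVec_of_eigenvalues hH (fun μ hμ => (hs hμ).1) (Pi.single k 1)
  have h2 := dot_mulVec_le_of_eigenvalues hH (fun μ hμ => (hs hμ).2) (Pi.single k 1)
  simp only [l2_single, one_pow, mul_one, mulVec_single_one, single_dotProduct, col_apply,
    one_mul] at h1 h2
  exact ⟨h1, h2⟩

/-- The matrix `Q` with its diagonal replaced by zero. -/
def offDiag (Q : Matrix (Fin n) (Fin n) ℝ) : Matrix (Fin n) (Fin n) ℝ :=
  Q - diagonal fun i => Q i i

lemma specNorm_offDiag_le (Q : Matrix (Fin n) (Fin n) ℝ) : specNorm (offDiag Q) ≤ 2 * specNorm Q :=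
  (specNorm_sub_le _ _).trans (by linarith [specNorm_diagonal_diag_le Q])

/-- The diagonal of `P` is constant on each community, so removing it preserves the invariance of
the span. It lowers the form by at most `α * Cl` on the span and by at least `α / Cl` on the
complement. -/
lemma spectralGap_offDiag {α m Cl : ℝ} (hα : 0 < α) (hCl : 0 < Cl)
    (hm : ∀ k, m ≤ labelCount g k) {H : Matrix (Fin K) (Fin K) ℝ} (hH : H.IsSymm)
    (hs : spectrum ℝ H ⊆ Set.Icc Cl⁻¹ Cl) :
    SpectralGap (ofLabels g) (offDiag (edgeProb α H (ofLabels g))) (-(α * Cl⁻¹))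
      (α * (m / Cl - Cl)) := by
  have hP := spectralGap_edgeProb hα hCl hm hH hs
  have hd : (fun i => edgeProb α H (ofLabels g) i i) = fun i => α * H (g i) (g i) := by
    ext i; rw [edgeProb_ofLabels_apply]; rfl
  have hq : ∀ x : Fin n → ℝ, x ⬝ᵥ (diagonal fun i => α * H (g i) (g i)) *ᵥ x
      = ∑ i, α * H (g i) (g i) * x i ^ 2 := fun x => by
    simp only [dotProduct, mulVec_diagonal]
    exact Finset.sum_congr rfl fun i _ => by ring
  refine ⟨fun c => ?_, fun w hw => ?_, fun w hw c => ?_⟩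
  · rw [offDiag, hd, sub_mulVec, dotProduct_sub, hq]
    have h1 := hP.lower c
    have h2 : ∑ i, α * H (g i) (g i) * (ofLabels g *ᵥ c) i ^ 2
        ≤ α * Cl * l2 (ofLabels g *ᵥ c) ^ 2 := by
      rw [l2_sq_sum, Finset.mul_sum]
      refine Finset.sum_le_sum fun i _ => mul_le_mul_of_nonneg_right ?_ (sq_nonneg _)
      exact mul_le_mul_of_nonneg_left (diag_mem_of_spectrum hH hs _).2 hα.le
    rw [mul_sub, sub_mul]; linarith
  · rw [offDiag, hd, sub_mulVec, dotProduct_sub, hq]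
    have h1 := hP.upper w hw
    have h2 : α * Cl⁻¹ * l2 w ^ 2 ≤ ∑ i, α * H (g i) (g i) * w i ^ 2 := by
      rw [l2_sq_sum, Finset.mul_sum]
      refine Finset.sum_le_sum fun i _ => mul_le_mul_of_nonneg_right ?_ (sq_nonneg _)
      exact mul_le_mul_of_nonneg_left (diag_mem_of_spectrum hH hs _).1 hα.le
    linarith
  · rw [offDiag, hd, sub_mulVec, dotProduct_sub, hP.orth w hw c, zero_sub, neg_eq_zero]
    have h1 : (diagonal fun i => α * H (g i) (g i)) *ᵥ (ofLabels g *ᵥ c)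
        = ofLabels g *ᵥ fun k => α * H k k * c k := by
      ext i; rw [mulVec_diagonal, ofLabels_mulVec, ofLabels_mulVec]
    rw [h1, dot_mulVec_eq, hw, zero_dotProduct]

/-- At `m = Cl ^ 2` the terms `m / Cl` and `Cl` cancel, and the gap consists only of the negative
bound `-(α / Cl)` on the complement. From there on the gap stays a fixed fraction of `α * m`. -/
lemma gap_offDiag_lower {α m Cl : ℝ} (hα : 0 < α) (hCl : 1 ≤ Cl) (hm : Cl ^ 2 ≤ m) :
    α * m / (2 * Cl ^ 3) ≤ α * (m / Cl - Cl) - -(α * Cl⁻¹) := by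
  have h0 : (0 : ℝ) < Cl := by linarith
  have h1 : m / (2 * Cl ^ 3) ≤ m / Cl - Cl + Cl⁻¹ := by
    have : m / Cl - Cl + Cl⁻¹ - m / (2 * Cl ^ 3)
        = (m * (2 * Cl ^ 2 - 1) - 2 * Cl ^ 4 + 2 * Cl ^ 2) / (2 * Cl ^ 3) := by
      field_simp
      ring
    have h2 : 0 ≤ m / Cl - Cl + Cl⁻¹ - m / (2 * Cl ^ 3) := by
      rw [this]
      apply div_nonneg _ (by positivity)
      have h3 : 0 ≤ 2 * Cl ^ 2 - 1 := by nlinarith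
      nlinarith [mul_le_mul_of_nonneg_right hm h3]
    linarith
  calc α * m / (2 * Cl ^ 3) = α * (m / (2 * Cl ^ 3)) := by ring
    _ ≤ α * (m / Cl - Cl + Cl⁻¹) := mul_le_mul_of_nonneg_left h1 hα.le
    _ = _ := by ring

end gap

/-! ### Extremal community sizes. -/

section sizes
variable {n K T : ℕ} {Θ : ℤ → Matrix (Fin n) (Fin K) ℝ}

lemma community_card_le_nMax {t : ℤ} (ht : t ∈ Finset.Icc (1 : ℤ) T) (k : Fin K) :
    (community (Θ t) k).card ≤ nMax T Θ := by
  refine le_csSup ⟨n, ?_⟩ ⟨t, ht, k, rfl⟩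
  rintro m ⟨t, -, k, rfl⟩
  simpa using Finset.card_le_univ (community (Θ t) k)

lemma nMin_le_community_card {t : ℤ} (ht : t ∈ Finset.Icc (1 : ℤ) T) (k : Fin K) :
    nMin T Θ ≤ (community (Θ t) k).card :=
  Nat.sInf_le ⟨t, ht, k, rfl⟩

lemma nMin_pos (hK : 0 < K) (hT : 0 < T)
    (hne : ∀ t ∈ Finset.Icc (1 : ℤ) T, ∀ k, (community (Θ t) k).Nonempty) : 0 < nMin T Θ := by
  have hmem : (1 : ℤ) ∈ Finset.Icc (1 : ℤ) T := Finset.mem_Icc.2 ⟨le_rfl, by exact_mod_cast hT⟩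
  have h := Nat.sInf_mem (s := {m | ∃ t ∈ Finset.Icc (1 : ℤ) T, ∃ k, m = (community (Θ t) k).card})
    ⟨_, 1, hmem, ⟨0, hK⟩, rfl⟩
  obtain ⟨t, ht, k, hk⟩ := h
  rw [nMin, hk]
  exact (hne t ht k).card_pos

end sizes

/-! ### Taylor expansion and the bias of the kernel estimator -/

/-- Induction on the order: expand the derivative, integrate the polynomial term by term, and apply
the mean value inequality to the difference. Only the constant coefficient matters later, so
factorials are not tracked. -/
lemma exists_taylor_of_holder (l : ℕ) {γ L : ℝ} (hγ : 0 < γ) (hL : 0 ≤ L) (f : ℝ → ℝ)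
    (hf : ContDiffOn ℝ l f (Set.Icc 0 1))
    (hH : ∀ x ∈ Set.Icc (0 : ℝ) 1, ∀ x' ∈ Set.Icc (0 : ℝ) 1,
      |iteratedDerivWithin l f (Set.Icc 0 1) x - iteratedDerivWithin l f (Set.Icc 0 1) x'|
        ≤ L * |x - x'| ^ γ) {x₀ : ℝ} (hx₀ : x₀ ∈ Set.Icc (0 : ℝ) 1) :
    ∃ c : ℕ → ℝ, c 0 = f x₀ ∧ ∀ x ∈ Set.Icc (0 : ℝ) 1,
      |f x - ∑ k ∈ Finset.range (l + 1), c k * (x - x₀) ^ k| ≤ L * |x - x₀| ^ (γ + l) := by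
  induction l generalizing f with
  | zero =>
    refine ⟨fun _ => f x₀, rfl, fun x hx => ?_⟩
    simpa using hH x hx x₀ hx₀
  | succ l ih =>
    have hu := uniqueDiffOn_Icc (zero_lt_one' ℝ)
    have hf' : ContDiffOn ℝ l (derivWithin f (Set.Icc 0 1)) (Set.Icc 0 1) :=
      hf.derivWithin hu (by exact_mod_cast le_rfl)
    obtain ⟨c, hc0, hc⟩ := ih (derivWithin f (Set.Icc 0 1)) hf' (fun x hx x' hx' => by
      have := hH x hx x' hx'
      rwa [iteratedDerivWithin_succ'] at this)
    have hdiff : DifferentiableOn ℝ f (Set.Icc 0 1) :=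
      hf.differentiableOn (by exact_mod_cast Nat.succ_ne_zero l)
    let C : ℕ → ℝ := fun k => match k with
      | 0 => f x₀
      | k + 1 => c k / (k + 1)
    refine ⟨C, rfl, fun x hx => ?_⟩
    set F : ℝ → ℝ := fun y => f y - ∑ k ∈ Finset.range (l + 2), C k * (y - x₀) ^ k with hF
    have hseg : segment ℝ x₀ x ⊆ Set.Icc 0 1 := (convex_Icc 0 1).segment_subset hx₀ hx
    have hder : ∀ y ∈ segment ℝ x₀ x, HasDerivWithinAt F (derivWithin f (Set.Icc 0 1) y -
        ∑ k ∈ Finset.range (l + 1), c k * (y - x₀) ^ k) (segment ℝ x₀ x) y := by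
      intro y hy
      have h1 : HasDerivWithinAt f (derivWithin f (Set.Icc 0 1) y) (segment ℝ x₀ x) y :=
        ((hdiff y (hseg hy)).hasDerivWithinAt).mono hseg
      refine h1.sub ?_
      have h2 : HasDerivAt (fun y => ∑ k ∈ Finset.range (l + 2), C k * (y - x₀) ^ k)
          (∑ k ∈ Finset.range (l + 2), C k * (k * (y - x₀) ^ (k - 1))) y := by
        refine HasDerivAt.fun_sum fun k _ => ?_
        have := (((hasDerivAt_id y).sub_const x₀).pow k).const_mul (C k)
        simpa using this
      have h3 : ∑ k ∈ Finset.range (l + 2), C k * (k * (y - x₀) ^ (k - 1))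
          = ∑ k ∈ Finset.range (l + 1), c k * (y - x₀) ^ k := by
        rw [Finset.sum_range_succ']
        simp only [Nat.cast_zero, zero_mul, mul_zero, add_zero]
        refine Finset.sum_congr rfl fun k _ => ?_
        simp only [C, Nat.add_sub_cancel, Nat.cast_add, Nat.cast_one]
        have : (k : ℝ) + 1 ≠ 0 := by positivity
        field_simp
      rw [← h3]
      exact h2.hasDerivWithinAt
    have hbound : ∀ y ∈ segment ℝ x₀ x, ‖derivWithin f (Set.Icc 0 1) y -
        ∑ k ∈ Finset.range (l + 1), c k * (y - x₀) ^ k‖ ≤ L * |x - x₀| ^ (γ + l) := by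
      intro y hy
      refine (hc y (hseg hy)).trans ?_
      refine mul_le_mul_of_nonneg_left ?_ hL
      refine Real.rpow_le_rpow (abs_nonneg _) ?_ (by positivity)
      have := norm_sub_le_of_mem_segment hy
      simpa [Real.norm_eq_abs, abs_sub_comm] using this
    have h := (convex_segment x₀ x).norm_image_sub_le_of_norm_hasDerivWithin_le hder hbound
      (left_mem_segment ℝ x₀ x) (right_mem_segment ℝ x₀ x)
    have hF0 : F x₀ = 0 := by
      simp only [hF]
      rw [Finset.sum_range_succ']
      simp [C]
    rw [hF0, sub_zero, Real.norm_eq_abs, Real.norm_eq_abs] at h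
    refine h.trans (le_of_eq ?_)
    rcases (abs_nonneg (x - x₀)).eq_or_lt with h0 | h0
    · rw [← h0, Real.zero_rpow (by positivity), Real.zero_rpow (by positivity)]; simp
    · rw [mul_assoc]
      congr 1
      have : γ + ((l + 1 : ℕ) : ℝ) = (γ + l) + 1 := by push_cast; ring
      rw [this, Real.rpow_add_one h0.ne']

lemma holderOrder_lt {β : ℝ} (hβ : 0 < β) : (holderOrder β : ℝ) < β := by
  unfold holderOrder
  have h1 : 0 < ⌈β⌉₊ := Nat.ceil_pos.2 hβ
  rw [Nat.cast_sub h1]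
  have := Nat.ceil_lt_add_one hβ.le
  push_cast; linarith

lemma HolderClass.exists_taylor {β L : ℝ} (hβ : 0 < β) (hL : 0 ≤ L) {f : ℝ → ℝ}
    (hf : HolderClass β L f) {x₀ : ℝ} (hx₀ : x₀ ∈ Set.Icc (0 : ℝ) 1) :
    ∃ c : ℕ → ℝ, c 0 = f x₀ ∧ ∀ x ∈ Set.Icc (0 : ℝ) 1,
      |f x - ∑ k ∈ Finset.range (holderOrder β + 1), c k * (x - x₀) ^ k| ≤ L * |x - x₀| ^ β := by
  obtain ⟨c, h0, h⟩ := exists_taylor_of_holder (holderOrder β) (sub_pos.2 (holderOrder_lt hβ)) hL f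
    hf.1 hf.2 hx₀
  exact ⟨c, h0, fun x hx => by simpa using h x hx⟩

lemma offsets_abs_le {r : ℕ} {j : Fin 3} {i : ℤ} (hi : i ∈ offsets r j) : |i| ≤ r := by
  fin_cases j <;> simp [offsets] at hi <;> rw [abs_le] <;> constructor <;> omega

lemma offsets_card (r : ℕ) (j : Fin 3) :
    (offsets r j).card = 2 * r + 1 ∨ (offsets r j).card = r + 1 := by
  fin_cases j <;> simp only [offsets, Int.card_Icc] <;> omega

lemma offsets_card_ge (r : ℕ) (j : Fin 3) : r + 1 ≤ (offsets r j).card := by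
  have := offsets_card r j; omega

lemma offsets_card_le (r : ℕ) (j : Fin 3) : (offsets r j).card ≤ 2 * r + 1 := by
  have := offsets_card r j; omega

lemma offsets_card_pos (r : ℕ) (j : Fin 3) : (0 : ℝ) < (offsets r j).card := by
  have := offsets_card_ge r j
  exact_mod_cast (by omega : 0 < (offsets r j).card)

/-- The condition `2 * r ≤ T` makes the three ranges of times disjoint and keeps each window inside
`1, …, T`, so the estimator is a single kernel average. -/
lemma exists_window {T r : ℕ} (hr : 2 * r ≤ T) {t : ℤ} (ht : t ∈ Finset.Icc (1 : ℤ) T) :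
    ∃ j : Fin 3, t ∈ windowTimes T r j ∧ (∀ i ∈ offsets r j, t + i ∈ Finset.Icc (1 : ℤ) T) ∧
      ∀ j' ≠ j, t ∉ windowTimes T r j' := by
  rw [Finset.mem_Icc] at ht
  by_cases h1 : t ≤ r
  · refine ⟨1, ?_, fun i hi => ?_, fun j' hj' => ?_⟩
    · simp [windowTimes]; omega
    · simp [offsets] at hi; rw [Finset.mem_Icc]; omega
    · fin_cases j' <;> simp [windowTimes] at * <;> omega
  · by_cases h2 : t ≤ T - r
    · refine ⟨0, ?_, fun i hi => ?_, fun j' hj' => ?_⟩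
      · simp [windowTimes]; omega
      · simp [offsets] at hi; rw [Finset.mem_Icc]; omega
      · fin_cases j' <;> simp [windowTimes] at * <;> omega
    · refine ⟨2, ?_, fun i hi => ?_, fun j' hj' => ?_⟩
      · simp [windowTimes]; omega
      · simp [offsets] at hi; rw [Finset.mem_Icc]; omega
      · fin_cases j' <;> simp [windowTimes] at * <;> omega

lemma kernelEstimator_eq {n T r : ℕ} (W : Fin 3 → ℕ → ℤ → ℝ) (A : ℤ → Matrix (Fin n) (Fin n) ℝ)
    {t : ℤ} {j : Fin 3} (hj : t ∈ windowTimes T r j) (hj' : ∀ j' ≠ j, t ∉ windowTimes T r j') :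
    kernelEstimator T W A t r
      = ((offsets r j).card : ℝ)⁻¹ • ∑ i ∈ offsets r j, W j r i • A (t + i) := by
  unfold kernelEstimator
  rw [Finset.sum_eq_single j (fun j' _ h => if_neg (hj' j' h)) (by simp), if_pos hj]

/-- A kernel reproduces polynomials, so that the error of a kernel average at the centre of a Taylor
expansion is of the order of the remainder. -/
lemma kernel_average_sub_le {β L Wmax : ℝ} (hβ : 0 < β) (hL : 0 ≤ L)
    {W : Fin 3 → ℕ → ℤ → ℝ} (hW : IsKernel (holderOrder β) Wmax W) {f : ℝ → ℝ}
    (hf : HolderClass β L f) {T r : ℕ} (hT : 0 < T) {j : Fin 3} {t : ℤ}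
    (ht : t ∈ Finset.Icc (1 : ℤ) T) (hti : ∀ i ∈ offsets r j, t + i ∈ Finset.Icc (1 : ℤ) T) :
    |((offsets r j).card : ℝ)⁻¹ * ∑ i ∈ offsets r j, W j r i * (f (((t + i : ℤ) : ℝ) / T) -
      f ((t : ℝ) / T))| ≤ Wmax * (L * ((r : ℝ) / T) ^ β) := by
  have hT0 : (0 : ℝ) < T := by exact_mod_cast hT
  have hmem : ∀ u ∈ Finset.Icc (1 : ℤ) T, (u : ℝ) / T ∈ Set.Icc (0 : ℝ) 1 := fun u hu => by
    rw [Finset.mem_Icc] at hu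
    refine ⟨div_nonneg (by exact_mod_cast (by omega : (0 : ℤ) ≤ u)) hT0.le, ?_⟩
    rw [div_le_one hT0]; exact_mod_cast hu.2
  obtain ⟨c, hc0, hc⟩ := hf.exists_taylor hβ hL (hmem t ht)
  have hN := offsets_card_pos r j
  obtain ⟨hWb, hWm⟩ := hW j r
  have hW0 : 0 ≤ Wmax := by
    have : (0 : ℤ) ∈ offsets r j := by fin_cases j <;> simp [offsets]
    exact (abs_nonneg _).trans (hWb 0 this)
  set N := ((offsets r j).card : ℝ) with hNdef
  -- Without its constant term, the Taylor polynomial is a combination of the powers `1, …, l` of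
  -- the offset, all annihilated by the kernel.
  have hsum0 : N⁻¹ * ∑ i ∈ offsets r j, W j r i * (∑ k ∈ Finset.range (holderOrder β + 1),
      c k * (((t + i : ℤ) : ℝ) / T - (t : ℝ) / T) ^ k - f ((t : ℝ) / T)) = 0 := by
    have h1 : ∀ i ∈ offsets r j, W j r i * (∑ k ∈ Finset.range (holderOrder β + 1),
        c k * (((t + i : ℤ) : ℝ) / T - (t : ℝ) / T) ^ k - f ((t : ℝ) / T))
        = ∑ k ∈ Finset.range (holderOrder β),
          c (k + 1) / (T : ℝ) ^ (k + 1) * ((i : ℝ) ^ (k + 1) * W j r i) := by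
      intro i _
      rw [Finset.sum_range_succ', pow_zero, mul_one, hc0, add_sub_cancel_right, Finset.mul_sum]
      refine Finset.sum_congr rfl fun k _ => ?_
      have : ((t + i : ℤ) : ℝ) / T - (t : ℝ) / T = i / T := by push_cast; ring
      rw [this, div_pow]; ring
    rw [Finset.sum_congr rfl h1, Finset.sum_comm, Finset.mul_sum]
    refine Finset.sum_eq_zero fun k hk => ?_
    have := hWm (k + 1) (Finset.mem_range.1 hk)
    rw [if_neg (Nat.succ_ne_zero k)] at this
    rw [← Finset.mul_sum, mul_left_comm, this, mul_zero]
  rw [← sub_zero (N⁻¹ * _), ← hsum0, ← mul_sub, ← Finset.sum_sub_distrib, abs_mul,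
    abs_of_pos (inv_pos.2 hN), inv_mul_le_iff₀ hN]
  calc _ ≤ ∑ i ∈ offsets r j, |W j r i * (f (((t + i : ℤ) : ℝ) / T) - f ((t : ℝ) / T)) -
        W j r i * (∑ k ∈ Finset.range (holderOrder β + 1),
      c k * (((t + i : ℤ) : ℝ) / T - (t : ℝ) / T) ^ k - f ((t : ℝ) / T))| :=
        Finset.abs_sum_le_sum_abs _ _
    _ ≤ ∑ i ∈ offsets r j, Wmax * (L * ((r : ℝ) / T) ^ β) := by
        refine Finset.sum_le_sum fun i hi => ?_
        rw [← mul_sub, sub_sub_sub_cancel_right, abs_mul]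
        refine mul_le_mul (hWb i hi) ?_ (abs_nonneg _) hW0
        refine (hc _ (hmem _ (hti i hi))).trans (mul_le_mul_of_nonneg_left ?_ hL)
        refine Real.rpow_le_rpow (abs_nonneg _) ?_ hβ.le
        have : ((t + i : ℤ) : ℝ) / T - (t : ℝ) / T = i / T := by push_cast; ring
        rw [this, abs_div, abs_of_pos hT0]
        gcongr
        exact_mod_cast offsets_abs_le hi
    _ = _ := by simp [hNdef]

/-! ### Changes of the memberships. -/

section switches
variable {n K T s : ℕ} {Θ : ℤ → Matrix (Fin n) (Fin K) ℝ}

open Classical in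
lemma FewSwitches.card_le (h : FewSwitches T s Θ) {u : ℤ} (hu : 1 ≤ u) (d : ℕ)
    (hd : u + d ≤ T) :
    (Finset.univ.filter fun i : Fin n => Θ u i ≠ Θ (u + d) i).card ≤ d * s := by
  induction d with
  | zero => simp
  | succ d ih =>
    push_cast at hd ⊢
    have h1 := ih (by linarith)
    have h2 := h (u + d) (by omega) (by linarith)
    have hsub : (Finset.univ.filter fun i : Fin n => Θ u i ≠ Θ (u + (d + 1)) i) ⊆
        (Finset.univ.filter fun i : Fin n => Θ u i ≠ Θ (u + d) i) ∪
        (Finset.univ.filter fun i : Fin n => Θ (u + d) i ≠ Θ (u + d + 1) i) := by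
      intro i hi
      have hi' := (Finset.mem_filter.1 hi).2
      rw [Finset.mem_union, Finset.mem_filter, Finset.mem_filter]
      by_contra hcon
      push Not at hcon
      refine hi' ?_
      rw [← add_assoc, ← hcon.2 (Finset.mem_univ _)]
      exact hcon.1 (Finset.mem_univ _)
    calc _ ≤ _ := Finset.card_le_card hsub
      _ ≤ _ := Finset.card_union_le _ _
      _ ≤ d * s + s := add_le_add h1 h2
      _ = _ := by ring

open Classical in
lemma frobSq_ofLabels_sub_le (g g' : Fin n → Fin K) :
    frobSq (ofLabels g' - ofLabels g)
      ≤ 2 * (Finset.univ.filter fun i : Fin n => ofLabels g i ≠ ofLabels g' i).card := by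
  rw [frobSq_eq_sum_rows, Finset.card_filter]
  push_cast
  rw [Finset.mul_sum]
  refine Finset.sum_le_sum fun i _ => ?_
  have hrow : (ofLabels g' - ofLabels g) i = ofLabels g' i - ofLabels g i := rfl
  rw [hrow]
  split_ifs with h
  · have h1 : ∀ f : Fin n → Fin K, ofLabels f i = Pi.single (f i) 1 := fun f => by
      ext k; rw [ofLabels_apply, Pi.single_apply]; simp only [eq_comm]
    rw [h1, h1, l2_sq, dotProduct_sub, sub_dotProduct, sub_dotProduct]
    have h2 : (0 : ℝ) ≤ (Pi.single (g i) 1 : Fin K → ℝ) ⬝ᵥ Pi.single (g' i) 1 := by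
      rw [single_dotProduct, one_mul, Pi.single_apply]; split_ifs <;> norm_num
    have h3 : (0 : ℝ) ≤ (Pi.single (g' i) 1 : Fin K → ℝ) ⬝ᵥ Pi.single (g i) 1 := by
      rw [dotProduct_comm]; exact h2
    have h4 : ∀ k : Fin K, (Pi.single k 1 : Fin K → ℝ) ⬝ᵥ Pi.single k 1 = 1 := fun k => by simp
    rw [h4, h4]; linarith
  · push Not at h
    rw [h, sub_self, l2_zero]; simp

/-- At most `r * s` rows differ between times at distance at most `r`, and each differing row
contributes at most two. -/
lemma frobSq_switch_le (h : FewSwitches T s Θ)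
    (hΘ : ∀ t ∈ Finset.Icc (1 : ℤ) T, Θ t ∈ clusteringMatrices n K) {u v : ℤ}
    (hu : u ∈ Finset.Icc (1 : ℤ) T) (hv : v ∈ Finset.Icc (1 : ℤ) T) {r : ℕ} (hr : |v - u| ≤ r) :
    frobSq (Θ v - Θ u) ≤ 2 * (r * s) := by
  wlog huv : u ≤ v generalizing u v
  · have := this hv hu (by rwa [abs_sub_comm]) (by omega)
    simp only [frobSq, Matrix.sub_apply] at this ⊢
    simpa only [sub_sq_comm] using this
  obtain ⟨d, hd⟩ := Int.eq_ofNat_of_zero_le (sub_nonneg.2 huv)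
  obtain rfl : v = u + d := by omega
  rw [Finset.mem_Icc] at hu hv
  have hdr : d ≤ r := by
    have : ((d : ℕ) : ℤ) ≤ r := by simpa using hr
    exact_mod_cast this
  have h1 := h.card_le hu.1 d hv.2
  obtain ⟨g, hg⟩ := exists_eq_ofLabels (hΘ u (Finset.mem_Icc.2 hu))
  obtain ⟨g', hg'⟩ := exists_eq_ofLabels (hΘ (u + d) (Finset.mem_Icc.2 hv))
  rw [hg, hg'] at h1 ⊢
  refine (frobSq_ofLabels_sub_le g g').trans ?_
  gcongr
  calc _ ≤ ((d * s : ℕ) : ℝ) := by exact_mod_cast h1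
    _ ≤ r * s := by push_cast; gcongr

end switches

/-- Cauchy–Schwarz within each community. This is the source of the factor `nmax` in `δ₂`. -/
lemma l2_ofLabels_transpose_le {n K : ℕ} {g : Fin n → Fin K} {N : ℝ}
    (hN : ∀ k, (labelCount g k : ℝ) ≤ N) (x : Fin n → ℝ) :
    l2 ((ofLabels g)ᵀ *ᵥ x) ≤ √N * l2 x := by
  rcases isEmpty_or_nonempty (Fin K) with hK | ⟨⟨k⟩⟩
  · rw [l2, dotProduct, Finset.univ_eq_empty, Finset.sum_empty, Real.sqrt_zero]
    exact mul_nonneg (Real.sqrt_nonneg _) (l2_nonneg _)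
  have hN0 : 0 ≤ N := (Nat.cast_nonneg _).trans (hN k)
  refine le_of_sq_le_sq ?_ (mul_nonneg (Real.sqrt_nonneg _) (l2_nonneg x))
  rw [mul_pow, Real.sq_sqrt hN0, l2_sq_sum, l2_sq_sum, ← Finset.sum_fiberwise _ g, Finset.mul_sum]
  refine Finset.sum_le_sum fun k _ => ?_
  rw [ofLabels_transpose_mulVec]
  exact sq_sum_le_card_mul_sum_sq.trans
    (mul_le_mul_of_nonneg_right (hN k) (Finset.sum_nonneg fun _ _ => sq_nonneg _))

lemma edgeProb_sub_H {n K : ℕ} (α : ℝ) (H H' : Matrix (Fin K) (Fin K) ℝ)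
    (Θ : Matrix (Fin n) (Fin K) ℝ) :
    edgeProb α H' Θ - edgeProb α H Θ = edgeProb α (H' - H) Θ := by
  unfold edgeProb
  rw [smul_sub, Matrix.mul_sub, Matrix.sub_mul]

/-- Effect of a change of the memberships on the edge probabilities. -/
lemma specNorm_edgeProb_sub_le {n K : ℕ} {g g' : Fin n → Fin K} {N α Cl D : ℝ} (hα : 0 ≤ α)
    (hCl : 0 ≤ Cl) (hN : ∀ k, (labelCount g k : ℝ) ≤ N) (hN' : ∀ k, (labelCount g' k : ℝ) ≤ N)
    {H : Matrix (Fin K) (Fin K) ℝ} (hH : ∀ x, l2 (H *ᵥ x) ≤ Cl * l2 x)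
    (hD : frobSq (ofLabels g' - ofLabels g) ≤ D) :
    specNorm (edgeProb α H (ofLabels g') - edgeProb α H (ofLabels g))
      ≤ 2 * √D * (α * Cl) * √N := by
  have hbil : ∀ x y : Fin K → ℝ, x ⬝ᵥ H *ᵥ y ≤ Cl * (l2 x * l2 y) := fun x y => by
    calc _ ≤ l2 x * l2 (H *ᵥ y) := (le_abs_self _).trans (abs_dot_le _ _)
      _ ≤ l2 x * (Cl * l2 y) := mul_le_mul_of_nonneg_left (hH y) (l2_nonneg x)
      _ = _ := by ring
  have hDx : ∀ x, l2 ((ofLabels g' - ofLabels g)ᵀ *ᵥ x) ≤ √D * l2 x := fun x => by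
    refine (l2_mulVec_le_frob _ x).trans ?_
    rw [frobSq_transpose]
    exact mul_le_mul_of_nonneg_right (Real.sqrt_le_sqrt hD) (l2_nonneg x)
  refine specNorm_le_of_dot (by positivity) fun x y => ?_
  have h1 : x ⬝ᵥ (edgeProb α H (ofLabels g') - edgeProb α H (ofLabels g)) *ᵥ y
      = α * (((ofLabels g' - ofLabels g)ᵀ *ᵥ x) ⬝ᵥ H *ᵥ ((ofLabels g')ᵀ *ᵥ y)) +
        α * (((ofLabels g)ᵀ *ᵥ x) ⬝ᵥ H *ᵥ ((ofLabels g' - ofLabels g)ᵀ *ᵥ y)) := by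
    rw [sub_mulVec, dotProduct_sub, edgeProb_dot, edgeProb_dot]
    simp only [transpose_sub, sub_mulVec, sub_dotProduct, mulVec_sub, dotProduct_sub]
    ring
  rw [h1]
  have hx := l2_nonneg x
  have hy := l2_nonneg y
  have a1 : ((ofLabels g' - ofLabels g)ᵀ *ᵥ x) ⬝ᵥ H *ᵥ ((ofLabels g')ᵀ *ᵥ y)
      ≤ Cl * ((√D * l2 x) * (√N * l2 y)) := by
    refine (hbil _ _).trans ?_
    gcongr
    · exact l2_nonneg _
    · exact hDx x
    · exact l2_ofLabels_transpose_le hN' y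
  have a2 : ((ofLabels g)ᵀ *ᵥ x) ⬝ᵥ H *ᵥ ((ofLabels g' - ofLabels g)ᵀ *ᵥ y)
      ≤ Cl * ((√N * l2 x) * (√D * l2 y)) := by
    refine (hbil _ _).trans ?_
    gcongr
    · exact l2_nonneg _
    · exact l2_ofLabels_transpose_le hN x
    · exact hDx y
  have b1 := mul_le_mul_of_nonneg_left a1 hα
  have b2 := mul_le_mul_of_nonneg_left a2 hα
  calc _ ≤ _ := add_le_add b1 b2
    _ = _ := by ring

/-- The bias of the kernel estimator. -/
theorem specNorm_bias_le {n K T s r : ℕ} {α β L Wmax Cα Cl : ℝ} (hβ : 0 < β) (hL : 0 ≤ L)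
    (hα : 0 ≤ α) (hCl : 1 ≤ Cl) (hT : 0 < T) {W : Fin 3 → ℕ → ℤ → ℝ}
    (hW : IsKernel (holderOrder β) Wmax W) {H : ℤ → Matrix (Fin K) (Fin K) ℝ}
    {Θ : ℤ → Matrix (Fin n) (Fin K) ℝ}
    (hΘ : ∀ t ∈ Finset.Icc (1 : ℤ) T, Θ t ∈ clusteringMatrices n K)
    (hconn : IsConnectivity T α Cα H) (hsm : SmoothConnectivity T β L H) (hsw : FewSwitches T s Θ)
    (hev : EigenvalueBounds T Cl H) {j : Fin 3} {t : ℤ} (ht : t ∈ Finset.Icc (1 : ℤ) T)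
    (hti : ∀ i ∈ offsets r j, t + i ∈ Finset.Icc (1 : ℤ) T) :
    specNorm (((offsets r j).card : ℝ)⁻¹ • ∑ i ∈ offsets r j,
        W j r i • (edgeProb α (H (t + i)) (Θ (t + i)) - edgeProb α (H t) (Θ t)))
      ≤ n * (α * (Wmax * (L * ((r : ℝ) / T) ^ β))) +
        Wmax * (2 * √(2 * (r * s)) * (α * Cl) * √(nMax T Θ)) := by
  have hN := offsets_card_pos r j
  obtain ⟨hWb, -⟩ := hW j r
  have hW0 : 0 ≤ Wmax := by
    have : (0 : ℤ) ∈ offsets r j := by fin_cases j <;> simp [offsets]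
    exact (abs_nonneg _).trans (hWb 0 this)
  have hCl0 : 0 < Cl := by linarith
  set N := ((offsets r j).card : ℝ) with hNdef
  obtain ⟨g, hg⟩ := exists_eq_ofLabels (hΘ t ht)
  -- Intermediate matrices with the memberships frozen at `t` separate two effects. In the first sum
  -- only `H` moves and the kernel cancels polynomials entrywise; in the second only the memberships
  -- move, and there is no cancellation, so it is bounded term by term.
  have hdec : N⁻¹ • ∑ i ∈ offsets r j,
        W j r i • (edgeProb α (H (t + i)) (Θ (t + i)) - edgeProb α (H t) (Θ t))
      = N⁻¹ • ∑ i ∈ offsets r j, W j r i • edgeProb α (H (t + i) - H t) (Θ t) +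
        N⁻¹ • ∑ i ∈ offsets r j, W j r i •
          (edgeProb α (H (t + i)) (Θ (t + i)) - edgeProb α (H (t + i)) (Θ t)) := by
    rw [← smul_add, ← Finset.sum_add_distrib]
    congr 1
    refine Finset.sum_congr rfl fun i _ => ?_
    rw [← smul_add, ← edgeProb_sub_H]
    congr 1; abel
  rw [hdec]
  refine (specNorm_add_le _ _).trans (add_le_add ?_ ?_)
  · refine specNorm_le_of_entries (by positivity) fun a b => ?_
    have hent : (N⁻¹ • ∑ i ∈ offsets r j, W j r i • edgeProb α (H (t + i) - H t) (Θ t)) a b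
        = α * (N⁻¹ * ∑ i ∈ offsets r j, W j r i *
          (H (t + i) (g a) (g b) - H t (g a) (g b))) := by
      rw [hg, Matrix.smul_apply, Matrix.sum_apply, smul_eq_mul, mul_left_comm]
      refine congrArg (N⁻¹ * ·) ?_
      rw [Finset.mul_sum]
      refine Finset.sum_congr rfl fun i _ => ?_
      rw [Matrix.smul_apply, edgeProb_ofLabels_apply]
      simp only [Matrix.smul_apply, Matrix.sub_apply, smul_eq_mul]
      ring
    have hker : ∀ k k' : Fin K, k ≤ k' → |N⁻¹ * ∑ i ∈ offsets r j, W j r i *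
        (H (t + i) k k' - H t k k')| ≤ Wmax * (L * ((r : ℝ) / T) ^ β) := by
      intro k k' hkk
      obtain ⟨f, hf, hfH⟩ := hsm k k' hkk
      have := kernel_average_sub_le hβ hL hW hf hT ht hti
      rw [← hNdef] at this
      convert this using 5 with i hi
      rw [hfH _ (hti i hi), hfH t ht]
    rw [hent, abs_mul, abs_of_nonneg hα]
    refine mul_le_mul_of_nonneg_left ?_ hα
    rcases le_total (g a) (g b) with h | h
    · exact hker _ _ h
    · have hsymm : ∑ i ∈ offsets r j, W j r i * (H (t + i) (g a) (g b) - H t (g a) (g b))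
          = ∑ i ∈ offsets r j, W j r i * (H (t + i) (g b) (g a) - H t (g b) (g a)) :=
        Finset.sum_congr rfl fun i hi => by
          rw [(hconn _ (hti i hi)).1.apply, (hconn t ht).1.apply]
      rw [hsymm]
      exact hker _ _ h
  · rw [specNorm_smul, abs_of_pos (inv_pos.2 hN), inv_mul_le_iff₀ hN]
    refine (specNorm_sum_le _ _).trans ?_
    rw [← nsmul_eq_mul, ← Finset.sum_const]
    refine Finset.sum_le_sum fun i hi => ?_
    rw [specNorm_smul]
    refine mul_le_mul (hWb i hi) ?_ (specNorm_nonneg _) hW0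
    obtain ⟨g', hg'⟩ := exists_eq_ofLabels (hΘ (t + i) (hti i hi))
    have hc1 : ∀ k, (labelCount g k : ℝ) ≤ nMax T Θ := fun k => by
      rw [← card_community_ofLabels, ← hg]; exact_mod_cast community_card_le_nMax ht k
    have hc2 : ∀ k, (labelCount g' k : ℝ) ≤ nMax T Θ := fun k => by
      rw [← card_community_ofLabels, ← hg']; exact_mod_cast community_card_le_nMax (hti i hi) k
    have hfr := frobSq_switch_le hsw hΘ ht (hti i hi) (r := r) (by
      rw [add_sub_cancel_left]; exact offsets_abs_le hi)
    rw [hg, hg'] at hfr ⊢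
    refine specNorm_edgeProb_sub_le hα hCl0.le hc1 hc2 (fun x => ?_) hfr
    refine l2_mulVec_le_of_eigenvalues (hconn _ (hti i hi)).1 hCl0 (fun μ hμ => ?_) x
    have := hev _ (hti i hi) hμ
    exact ⟨(inv_pos.2 hCl0).le.trans this.1, this.2⟩

/-! ### Heavy pairs -/

/-- A geometric sum of ratio `√2` is comparable to its last term, which is at most one. The second
bound carries the induction: `1 + 2.5 = 2.5 * 1.4` and `1.4 ≤ √2`. -/
lemma sum_sqrt_geometric_le {w : ℝ} (hw : 0 < w) (S : ℕ) :
    ∑ s ∈ Finset.range S, (if w * 2 ^ s ≤ 1 then √(w * 2 ^ s) else 0) ≤ 4 := by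
  have h2 : (1.4 : ℝ) ≤ √2 := Real.le_sqrt_of_sq_le (by norm_num)
  suffices h : ∑ s ∈ Finset.range S, (if w * 2 ^ s ≤ 1 then √(w * 2 ^ s) else 0) ≤ 4 ∧
      ∑ s ∈ Finset.range S, (if w * 2 ^ s ≤ 1 then √(w * 2 ^ s) else 0) ≤ 2.5 * √(w * 2 ^ S) from
    h.1
  induction S with
  | zero => simp; positivity
  | succ S ih =>
    obtain ⟨ih1, ih2⟩ := ih
    rw [Finset.sum_range_succ]
    have hs : √(w * 2 ^ (S + 1)) = √2 * √(w * 2 ^ S) := by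
      rw [← Real.sqrt_mul (by norm_num)]; congr 1; ring
    have h0 := Real.sqrt_nonneg (w * 2 ^ S)
    split_ifs with h
    · have h1 : √(w * 2 ^ S) ≤ 1 := Real.sqrt_le_one.2 h
      rw [hs]
      constructor <;> nlinarith
    · rw [hs, add_zero]
      exact ⟨ih1, ih2.trans (by nlinarith)⟩

/-- Entropy term of a level set. -/
lemma mul_one_add_log_le {n b : ℝ} (hn : 0 < n) (hb : 0 < b) (t : ℕ) :
    b * (1 + Real.log (n / b)) ≤
      16 * n / 4 ^ t * (4 ^ t * b / (16 * n) * (1 + 3 * t) + Real.exp (-t)) := by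
  -- The share of level `t` in the total squared length `16 * n`; over all levels these shares add
  -- up to at most one.
  set β := 4 ^ t * b / (16 * n) with hβ
  have hβ0 : 0 < β := by positivity
  have hbβ : b = 16 * n / 4 ^ t * β := by rw [hβ]; field_simp
  have hnb : n / b = 4 ^ t / 16 * β⁻¹ := by rw [hβ]; field_simp
  have hlog : Real.log (n / b) ≤ 2 * t - Real.log β := by
    rw [hnb, Real.log_mul (by positivity) (by positivity), Real.log_inv,
      Real.log_div (by positivity) (by norm_num), Real.log_pow]
    have h1 : Real.log 4 ≤ 2 := by
      rw [show (4 : ℝ) = 2 ^ 2 by norm_num, Real.log_pow]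
      have := Real.log_two_lt_d9; push_cast; linarith
    have h2 : 0 ≤ Real.log 16 := Real.log_nonneg (by norm_num)
    have h3 := mul_le_mul_of_nonneg_left h1 (Nat.cast_nonneg (α := ℝ) t)
    linarith
  -- The inequality `log x ≤ x - 1` at `x = exp (-t) / β` trades the logarithm of a small share for
  -- the summable term `exp (-t)`.
  have hneg : -Real.log β ≤ t + Real.exp (-t) / β - 1 := by
    have h1 := Real.log_le_sub_one_of_pos (x := Real.exp (-t) / β) (by positivity)
    rw [Real.log_div (Real.exp_pos _).ne' hβ0.ne', Real.log_exp] at h1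
    linarith
  have h1 : β * (1 + Real.log (n / b)) ≤ β * (1 + 3 * t) + Real.exp (-t) := by
    calc β * (1 + Real.log (n / b)) ≤ β * (1 + (2 * t + (t + Real.exp (-t) / β - 1))) := by
          gcongr; linarith
      _ = β * (3 * t) + Real.exp (-t) := by field_simp; ring
      _ ≤ _ := by nlinarith
  calc b * (1 + Real.log (n / b)) = 16 * n / 4 ^ t * (β * (1 + Real.log (n / b))) := by
        conv_lhs => rw [show b * (1 + Real.log (n / b))
          = (16 * n / 4 ^ t * β) * (1 + Real.log (n / b)) from by rw [← hbβ]]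
        ring
    _ ≤ _ := mul_le_mul_of_nonneg_left h1 (by positivity)

/-- The logarithmic factor of the entropy term is compensated by `1 + log (4 * 4 ^ t * v)`. -/
lemma mul_one_add_three_mul_le {v : ℝ} (hv : 0 < v) (hv1 : v ≤ 1) {t : ℕ}
    (hσ : 1 ≤ 4 * 4 ^ t * v) :
    v * (1 + 3 * t) ≤ 10 * √v * (1 + Real.log (4 * 4 ^ t * v)) := by
  set lam := 1 + Real.log (4 * 4 ^ t * v) with hlam
  have hlam1 : 1 ≤ lam := by have := Real.log_nonneg hσ; linarith
  have hs0 : 0 < √v := Real.sqrt_pos.2 hv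
  have hs1 : √v ≤ 1 := Real.sqrt_le_one.2 hv1
  have hsv : √v * √v = v := Real.mul_self_sqrt hv.le
  have h1 : lam = 1 + Real.log 4 + t * Real.log 4 + Real.log v := by
    rw [hlam, Real.log_mul (by positivity) hv.ne', Real.log_mul (by norm_num) (by positivity),
      Real.log_pow]
    ring
  have hl4 : 1.38 ≤ Real.log 4 := by
    rw [show (4 : ℝ) = 2 ^ 2 by norm_num, Real.log_pow]
    have := Real.log_two_gt_d9; push_cast; linarith
  -- Bounding the logarithm by the inverse square root leaves a factor `√v`, which is summed
  -- geometrically later.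
  have hlv : -Real.log v ≤ 2 * (√v)⁻¹ - 2 := by
    have h2 := Real.log_le_sub_one_of_pos (x := (√v)⁻¹) (by positivity)
    rw [Real.log_inv] at h2
    have h3 : Real.log v = 2 * Real.log (√v) := by rw [Real.log_sqrt hv.le]; ring
    linarith
  have ht := mul_le_mul_of_nonneg_left hl4 (Nat.cast_nonneg (α := ℝ) t)
  have h4 : 1 + 3 * (t : ℝ) ≤ 4 * lam + 5 * (√v)⁻¹ := by linarith
  have h5 : 1 ≤ (√v)⁻¹ := (one_le_inv₀ hs0).2 hs1
  have h6 : 1 + 3 * (t : ℝ) ≤ 10 * (√v)⁻¹ * lam := by nlinarith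
  calc v * (1 + 3 * t) ≤ v * (10 * (√v)⁻¹ * lam) := mul_le_mul_of_nonneg_left h6 hv.le
    _ = _ := by
      rw [show v * (10 * (√v)⁻¹ * lam) = 10 * (v / √v) * lam by ring, Real.div_sqrt]

/-- The weighted number of edges between level sets, over pairs of levels whose first level set is
the smaller one, under the bounded degree and discrepancy properties. -/
theorem heavy_levels_le {S : ℕ} {n d c c₁ : ℝ} (hn : 0 < n) (hd : 0 < d) (hc : 0 ≤ c) (hc₁ : 0 ≤ c₁)
    {a b : ℕ → ℝ} {E : ℕ → ℕ → ℝ} (ha : ∀ s, 0 ≤ a s) (hb : ∀ t, 0 ≤ b t)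
    (hA : ∑ s ∈ Finset.range S, 4 ^ s * a s ≤ 16 * n)
    (hB : ∑ t ∈ Finset.range S, 4 ^ t * b t ≤ 16 * n)
    (hdeg : ∀ s t, E s t ≤ c₁ * d * a s)
    (hdisc : ∀ s < S, ∀ t < S, 0 < b t → a s ≤ b t → 1 ≤ 4 * 2 ^ (s + t) / √d →
      (1 + Real.log (4 * 2 ^ (s + t) / √d)) * E s t ≤
        a s * b t * (d / n) * Real.exp (1 + Real.log (4 * 2 ^ (s + t) / √d)) +
        c * (b t * (1 + Real.log (n / b t)))) :
    ∑ s ∈ Finset.range S, ∑ t ∈ Finset.range S,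
      (if 1 ≤ 4 * 2 ^ (s + t) / √d ∧ a s ≤ b t then 2 ^ (s + t) * E s t else 0)
      ≤ (64 * c₁ + 3072 + 768 * c) * (n * √d) := by
  have hsd : 0 < √d := Real.sqrt_pos.2 hd
  have hdd : √d * √d = d := Real.mul_self_sqrt hd.le
  -- The quantities `w s * 2 ^ t` and `w' t * 2 ^ s` are inverse to each other. When the first is at
  -- most one, the degree bound is used and `X` makes the sum over `t` converge; otherwise the
  -- discrepancy bound is used and `Y` does so for the sum over `s`.
  let w : ℕ → ℝ := fun s => √d / 2 ^ s
  let w' : ℕ → ℝ := fun t => 1 / (√d * 2 ^ t)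
  let X : ℕ → ℕ → ℝ := fun s t => if w s * 2 ^ t ≤ 1 then √(w s * 2 ^ t) else 0
  let Y : ℕ → ℕ → ℝ := fun t s => if w' t * 2 ^ s ≤ 1 then √(w' t * 2 ^ s) else 0
  have hX0 : ∀ s t, 0 ≤ X s t := fun s t => by simp only [X]; split_ifs <;> positivity
  have hY0 : ∀ s t, 0 ≤ Y s t := fun s t => by simp only [Y]; split_ifs <;> positivity
  have hX : ∀ s, ∑ t ∈ Finset.range S, X s t ≤ 4 := fun s =>
    sum_sqrt_geometric_le (by positivity) S
  have hY : ∀ t, ∑ s ∈ Finset.range S, Y t s ≤ 4 := fun t =>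
    sum_sqrt_geometric_le (by positivity) S
  have hpt : ∀ s ∈ Finset.range S, ∀ t ∈ Finset.range S,
      (if 1 ≤ 4 * 2 ^ (s + t) / √d ∧ a s ≤ b t then 2 ^ (s + t) * E s t else 0)
      ≤ c₁ * √d * (4 ^ s * a s) * X s t + 12 * √d / n * ((4 ^ s * a s) * (4 ^ t * b t)) +
        16 * c * n * √d * (10 * (4 ^ t * b t / (16 * n)) + Real.exp (-t)) * Y t s := by
    intro s hs t ht
    have has := ha s
    have hbt := hb t
    have p1 : 0 ≤ c₁ * √d * (4 ^ s * a s) * X s t := mul_nonneg (by positivity) (hX0 s t)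
    have p2 : 0 ≤ 12 * √d / n * ((4 ^ s * a s) * (4 ^ t * b t)) := by positivity
    have p3 : 0 ≤ 16 * c * n * √d * (10 * (4 ^ t * b t / (16 * n)) + Real.exp (-t)) * Y t s :=
      mul_nonneg (by positivity) (hY0 t s)
    split_ifs with hcond
    swap
    · linarith
    obtain ⟨hσ, hab⟩ := hcond
    by_cases hq : w s * 2 ^ t ≤ 1
    · have hXe : X s t = √(w s * 2 ^ t) := if_pos hq
      have hq0 : 0 < w s * 2 ^ t := by positivity
      have hqq : w s * 2 ^ t ≤ √(w s * 2 ^ t) := by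
        refine Real.le_sqrt_of_sq_le ?_
        nlinarith
      have h1 : 2 ^ (s + t) * E s t ≤ c₁ * √d * (4 ^ s * a s) * X s t := by
        calc 2 ^ (s + t) * E s t ≤ 2 ^ (s + t) * (c₁ * d * a s) :=
              mul_le_mul_of_nonneg_left (hdeg s t) (by positivity)
          _ = c₁ * √d * (4 ^ s * a s) * (w s * 2 ^ t) := by
              simp only [w]
              rw [show (4 : ℝ) ^ s = 2 ^ s * 2 ^ s by rw [← mul_pow]; norm_num, pow_add]
              conv_lhs => rw [← hdd]
              field_simp
          _ ≤ _ := by rw [hXe]; exact mul_le_mul_of_nonneg_left hqq (by positivity)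
      linarith
    · push Not at hq
      rcases hbt.eq_or_lt with hb0 | hb0
      · have ha0 : a s = 0 := le_antisymm (hab.trans hb0.symm.le) has
        have := hdeg s t
        rw [ha0, mul_zero] at this
        have : 2 ^ (s + t) * E s t ≤ 0 := mul_nonpos_of_nonneg_of_nonpos (by positivity) this
        linarith
      set v := w' t * 2 ^ s with hv
      have hv0 : 0 < v := by positivity
      have hvq : v * (w s * 2 ^ t) = 1 := by simp only [hv, w, w']; field_simp
      have hv1 : v ≤ 1 := by nlinarith
      have hYe : Y t s = √v := if_pos hv1
      have hσv : 4 * 2 ^ (s + t) / √d = 4 * 4 ^ t * v := by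
        simp only [hv, w']
        rw [show (4 : ℝ) ^ t = 2 ^ t * 2 ^ t by rw [← mul_pow]; norm_num, pow_add]
        field_simp
      have hD := hdisc s (Finset.mem_range.1 hs) t (Finset.mem_range.1 ht) hb0 hab hσ
      rw [hσv] at hσ hD
      set lam := 1 + Real.log (4 * 4 ^ t * v) with hlam
      have hlam1 : 1 ≤ lam := by have := Real.log_nonneg hσ; linarith
      have hlam0 : 0 < lam := by linarith
      have hexp : Real.exp lam ≤ 3 * (4 * 4 ^ t * v) := by
        rw [hlam, Real.exp_add, Real.exp_log (by linarith)]
        have := Real.exp_one_lt_d9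
        gcongr; linarith
      have hent := mul_one_add_log_le hn hb0 t
      have hkey := mul_one_add_three_mul_le hv0 hv1 hσ
      rw [← hlam] at hkey
      have h2v : (2 : ℝ) ^ (s + t) = √d * 4 ^ t * v := by
        rw [eq_comm, ← mul_right_inj' (show (4 : ℝ) / √d ≠ 0 by positivity)]
        rw [show 4 / √d * (2 : ℝ) ^ (s + t) = 4 * 2 ^ (s + t) / √d by ring, hσv]
        field_simp
      -- the two parts of the discrepancy bound
      have hvs : v ≤ √v := Real.le_sqrt_of_sq_le (by nlinarith)
      -- The exponential is at most `3 * (4 * 2 ^ (s + t) / √d)`. Its extra power `2 ^ (s + t)`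
      -- makes the summand a product of a term in `s` and a term in `t`, each summing to at most `16
      -- * n`.
      have q1 : 2 ^ (s + t) * (a s * b t * (d / n) * Real.exp lam)
          ≤ lam * (12 * √d / n * ((4 ^ s * a s) * (4 ^ t * b t))) := by
        have h3 : 2 ^ (s + t) * (a s * b t * (d / n) * Real.exp lam)
            ≤ 2 ^ (s + t) * (a s * b t * (d / n) * (3 * (4 * 4 ^ t * v))) := by gcongr
        have h4 : (2 : ℝ) ^ (s + t) * (a s * b t * (d / n) * (3 * (4 * 4 ^ t * v)))
            = 12 * √d / n * ((4 ^ s * a s) * (4 ^ t * b t)) := by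
          rw [← hσv, pow_add, show (4 : ℝ) ^ t = 2 ^ t * 2 ^ t by rw [← mul_pow]; norm_num,
            show (4 : ℝ) ^ s = 2 ^ s * 2 ^ s by rw [← mul_pow]; norm_num]
          rw [show d / n = √d * √d / n by rw [hdd]]
          field_simp
          ring
        rw [h4] at h3
        exact h3.trans (le_mul_of_one_le_left p2 hlam1)
      have q2 : 2 ^ (s + t) * (c * (b t * (1 + Real.log (n / b t))))
          ≤ lam * (16 * c * n * √d * (10 * (4 ^ t * b t / (16 * n)) + Real.exp (-t)) * √v) := by
        set β := 4 ^ t * b t / (16 * n) with hβ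
        have hβ0 : 0 ≤ β := by positivity
        calc _ ≤ 2 ^ (s + t) * (c * (16 * n / 4 ^ t * (β * (1 + 3 * t) + Real.exp (-t)))) := by
              gcongr
          _ = 16 * c * n * √d * (β * (v * (1 + 3 * t)) + Real.exp (-t) * v) := by
              rw [h2v]; field_simp
          _ ≤ 16 * c * n * √d * (β * (10 * √v * lam) + Real.exp (-t) * (√v * lam)) := by
              gcongr
              exact hvs.trans (le_mul_of_one_le_right (Real.sqrt_nonneg _) hlam1)
          _ = _ := by ring
      have h5 : lam * (2 ^ (s + t) * E s t) ≤ lam *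
          (12 * √d / n * ((4 ^ s * a s) * (4 ^ t * b t)) +
          16 * c * n * √d * (10 * (4 ^ t * b t / (16 * n)) + Real.exp (-t)) * √v) := by
        calc lam * (2 ^ (s + t) * E s t) = 2 ^ (s + t) * (lam * E s t) := by ring
          _ ≤ 2 ^ (s + t) * (a s * b t * (d / n) * Real.exp lam +
              c * (b t * (1 + Real.log (n / b t)))) :=
            mul_le_mul_of_nonneg_left hD (by positivity)
          _ ≤ _ := by
            rw [mul_add (2 ^ (s + t)), mul_add lam]; exact add_le_add q1 q2
      have h6 := le_of_mul_le_mul_left h5 hlam0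
      rw [hYe] at p3 ⊢
      linarith
  refine (Finset.sum_le_sum fun s hs => Finset.sum_le_sum fun t ht => hpt s hs t ht).trans ?_
  simp only [Finset.sum_add_distrib]
  have s1 : ∑ s ∈ Finset.range S, ∑ t ∈ Finset.range S, c₁ * √d * (4 ^ s * a s) * X s t
      ≤ 64 * c₁ * (n * √d) := by
    calc _ = ∑ s ∈ Finset.range S, c₁ * √d * (4 ^ s * a s) * ∑ t ∈ Finset.range S, X s t := by
          simp only [Finset.mul_sum]
      _ ≤ ∑ s ∈ Finset.range S, c₁ * √d * (4 ^ s * a s) * 4 :=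
          Finset.sum_le_sum fun s _ => mul_le_mul_of_nonneg_left (hX s)
            (by have := ha s; positivity)
      _ = c₁ * √d * 4 * ∑ s ∈ Finset.range S, 4 ^ s * a s := by
          rw [Finset.mul_sum]; exact Finset.sum_congr rfl fun s _ => by ring
      _ ≤ c₁ * √d * 4 * (16 * n) := mul_le_mul_of_nonneg_left hA (by positivity)
      _ = _ := by ring
  have s2 : ∑ s ∈ Finset.range S, ∑ t ∈ Finset.range S,
      12 * √d / n * ((4 ^ s * a s) * (4 ^ t * b t)) ≤ 3072 * (n * √d) := by
    have hA0 : 0 ≤ ∑ s ∈ Finset.range S, 4 ^ s * a s :=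
      Finset.sum_nonneg fun s _ => by have := ha s; positivity
    calc _ = 12 * √d / n * ((∑ s ∈ Finset.range S, 4 ^ s * a s) *
          ∑ t ∈ Finset.range S, 4 ^ t * b t) := by
          rw [Finset.sum_mul_sum, Finset.mul_sum]
          exact Finset.sum_congr rfl fun s _ => by rw [Finset.mul_sum]
      _ ≤ 12 * √d / n * ((16 * n) * (16 * n)) := by
          gcongr
          exact Finset.sum_nonneg fun s _ => by have := hb s; positivity
      _ = _ := by field_simp; ring
  have s3 : ∑ s ∈ Finset.range S, ∑ t ∈ Finset.range S,
      16 * c * n * √d * (10 * (4 ^ t * b t / (16 * n)) + Real.exp (-t)) * Y t s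
      ≤ 768 * c * (n * √d) := by
    rw [Finset.sum_comm]
    calc _ = ∑ t ∈ Finset.range S, 16 * c * n * √d *
          (10 * (4 ^ t * b t / (16 * n)) + Real.exp (-t)) * ∑ s ∈ Finset.range S, Y t s := by
          simp only [Finset.mul_sum]
      _ ≤ ∑ t ∈ Finset.range S, 16 * c * n * √d *
          (10 * (4 ^ t * b t / (16 * n)) + Real.exp (-t)) * 4 :=
          Finset.sum_le_sum fun t _ => mul_le_mul_of_nonneg_left (hY t)
            (by have := hb t; positivity)
      _ = 64 * c * n * √d * (10 / (16 * n) * ∑ t ∈ Finset.range S, 4 ^ t * b t +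
            ∑ t ∈ Finset.range S, Real.exp (-t)) := by
          rw [Finset.mul_sum, ← Finset.sum_add_distrib, Finset.mul_sum]
          exact Finset.sum_congr rfl fun t _ => by ring
      _ ≤ 64 * c * n * √d * (10 / (16 * n) * (16 * n) + 2) := by
          gcongr
          refine (Finset.sum_le_sum fun t _ => ?_).trans (sum_geometric_two_le S)
          rw [Real.exp_neg, ← Real.exp_one_pow t, one_div, inv_pow]
          have := Real.exp_one_gt_d9
          gcongr; linarith
      _ = _ := by field_simp; ring
  linarith

/-! ### Spectral norm from integer test vectors -/

/-- Rounding goes towards zero rather than to the nearest integer, so that vectors do not become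
longer. -/
lemma exists_int_trunc (z : ℝ) : ∃ k : ℤ, |z - k| ≤ 1 ∧ |(k : ℝ)| ≤ |z| := by
  rcases le_total 0 z with h | h
  · refine ⟨⌊z⌋, ?_, ?_⟩
    · rw [abs_le]; constructor <;> linarith [Int.floor_le z, Int.lt_floor_add_one z]
    · have : (0 : ℝ) ≤ ⌊z⌋ := by exact_mod_cast Int.floor_nonneg.2 h
      rw [abs_of_nonneg this, abs_of_nonneg h]; exact Int.floor_le z
  · refine ⟨⌈z⌉, ?_, ?_⟩
    · rw [abs_le]; constructor <;> linarith [Int.le_ceil z, Int.ceil_lt_add_one z]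
    · have : (⌈z⌉ : ℝ) ≤ 0 := by exact_mod_cast Int.ceil_nonpos.2 h
      rw [abs_of_nonpos this, abs_of_nonpos h]; linarith [Int.le_ceil z]

/-- The integer vectors of squared length at most `16 n`. -/
def IsNetVector {n : ℕ} (k : Fin n → ℤ) : Prop := ∑ i, k i ^ 2 ≤ 16 * (n : ℤ)

/-- The coordinates of `4 * √n * x` are rounded towards zero. After rescaling, each coordinate moves
by at most `1 / (4 * √n)`, which amounts to `1 / 4` in norm, and the norm does not grow. -/
lemma exists_netVector {n : ℕ} (hn : 0 < n) {x : Fin n → ℝ} (hx : l2 x ≤ 1) :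
    ∃ k : Fin n → ℤ, IsNetVector k ∧
      l2 (x - (4 * √n)⁻¹ • fun i => (k i : ℝ)) ≤ 1 / 4 ∧
      l2 ((4 * √n)⁻¹ • fun i => (k i : ℝ)) ≤ 1 := by
  have hn0 : (0 : ℝ) < n := by exact_mod_cast hn
  have hs : 0 < √(n : ℝ) := Real.sqrt_pos.2 hn0
  have hss : √(n : ℝ) ^ 2 = n := Real.sq_sqrt hn0.le
  choose k h1 h2 using fun i => exists_int_trunc (4 * √n * x i)
  have hk2 : ∑ i, (k i : ℝ) ^ 2 ≤ 16 * n := by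
    calc ∑ i, (k i : ℝ) ^ 2 ≤ ∑ i, (4 * √n * x i) ^ 2 :=
          Finset.sum_le_sum fun i _ => sq_le_sq.2 (h2 i)
      _ = 16 * n * l2 x ^ 2 := by
          rw [l2_sq_sum, Finset.mul_sum]
          exact Finset.sum_congr rfl fun i _ => by rw [mul_pow, mul_pow, hss]; norm_num
      _ ≤ 16 * n := mul_le_of_le_one_right (by positivity) (pow_le_one₀ (l2_nonneg x) hx)
  refine ⟨k, ?_, ?_, ?_⟩
  · unfold IsNetVector; exact_mod_cast hk2
  · refine le_of_sq_le_sq ?_ (by norm_num)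
    rw [l2_sq_sum]
    calc _ ≤ ∑ _i : Fin n, (4 * √(n : ℝ))⁻¹ ^ 2 := by
          refine Finset.sum_le_sum fun i _ => ?_
          have : (x - (4 * √n)⁻¹ • fun i => (k i : ℝ)) i
              = (4 * √n)⁻¹ * (4 * √n * x i - k i) := by
            simp only [Pi.sub_apply, Pi.smul_apply, smul_eq_mul]; field_simp
          rw [this, mul_pow]
          refine mul_le_of_le_one_right (sq_nonneg _) ?_
          rw [← sq_abs]; exact pow_le_one₀ (abs_nonneg _) (h1 i)
      _ = (1 / 4) ^ 2 := by
          rw [Finset.sum_const, Finset.card_univ, Fintype.card_fin, nsmul_eq_mul, inv_pow, mul_pow,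
            hss]
          field_simp
  · refine le_of_sq_le_sq ?_ (by norm_num)
    rw [l2_smul, mul_pow, sq_abs, l2_sq_sum, inv_pow, mul_pow, hss, one_pow,
      inv_mul_le_iff₀ (by positivity)]
    linarith

lemma specNorm_le_of_unit {n : ℕ} {Q : Matrix (Fin n) (Fin n) ℝ} {c : ℝ} (hc : 0 ≤ c)
    (h : ∀ x y, l2 x ≤ 1 → l2 y ≤ 1 → x ⬝ᵥ Q *ᵥ y ≤ c) : specNorm Q ≤ c := by
  refine specNorm_le_of_dot hc fun x y => ?_
  by_cases hx : x = 0
  · rw [hx, l2_zero]; simp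
  by_cases hy : y = 0
  · rw [hy, l2_zero]; simp
  have hx0 := l2_pos hx
  have hy0 := l2_pos hy
  have hunit : ∀ z : Fin n → ℝ, 0 < l2 z → l2 ((l2 z)⁻¹ • z) ≤ 1 := fun z hz => by
    rw [l2_smul, abs_of_pos (inv_pos.2 hz), inv_mul_cancel₀ hz.ne']
  have := h _ _ (hunit x hx0) (hunit y hy0)
  rw [mulVec_smul, smul_dotProduct, dotProduct_smul, smul_eq_mul, smul_eq_mul, ← mul_assoc,
    ← mul_inv, inv_mul_le_iff₀ (by positivity)] at this
  linarith

lemma dot_mulVec_eq_sum {n : ℕ} (Q : Matrix (Fin n) (Fin n) ℝ) (x y : Fin n → ℝ) :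
    x ⬝ᵥ Q *ᵥ y = ∑ i, ∑ j, x i * y j * Q i j := by
  simp only [dotProduct, mulVec, Finset.mul_sum]
  exact Finset.sum_congr rfl fun i _ => Finset.sum_congr rfl fun j _ => by ring

/-- Passing to the net costs a quarter of the spectral norm in each argument. The resulting
`specNorm Q ≤ B / (16 * n) + specNorm Q / 2` is solved for the norm. -/
lemma specNorm_le_of_net {n : ℕ} (hn : 0 < n) {Q : Matrix (Fin n) (Fin n) ℝ} {B : ℝ}
    (h : ∀ k l : Fin n → ℤ, IsNetVector k → IsNetVector l →
      ∑ i, ∑ j, (k i : ℝ) * l j * Q i j ≤ B) : specNorm Q ≤ B / (8 * n) := by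
  have hn0 : (0 : ℝ) < n := by exact_mod_cast hn
  have hss : √(n : ℝ) ^ 2 = n := Real.sq_sqrt hn0.le
  have hs : 0 < √(n : ℝ) := Real.sqrt_pos.2 hn0
  have hB0 : 0 ≤ B := by
    have := h 0 0 (by simp [IsNetVector]) (by simp [IsNetVector])
    simpa using this
  have hQ0 := specNorm_nonneg Q
  have : specNorm Q ≤ B / (16 * n) + specNorm Q / 2 := by
    refine specNorm_le_of_unit (by positivity) fun x y hx hy => ?_
    obtain ⟨k, hk, hk1, hk2⟩ := exists_netVector hn hx
    obtain ⟨l, hl, hl1, hl2⟩ := exists_netVector hn hy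
    set x' : Fin n → ℝ := (4 * √n)⁻¹ • fun i => (k i : ℝ) with hx'
    set y' : Fin n → ℝ := (4 * √n)⁻¹ • fun i => (l i : ℝ) with hy'
    have e1 : x ⬝ᵥ Q *ᵥ y = x' ⬝ᵥ Q *ᵥ y' + (x - x') ⬝ᵥ Q *ᵥ y + x' ⬝ᵥ Q *ᵥ (y - y') := by
      simp only [mulVec_sub, dotProduct_sub, sub_dotProduct]; ring
    have e2 : x' ⬝ᵥ Q *ᵥ y' ≤ B / (16 * n) := by
      have : x' ⬝ᵥ Q *ᵥ y' = (16 * n : ℝ)⁻¹ * ∑ i, ∑ j, (k i : ℝ) * l j * Q i j := by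
        rw [hx', hy', mulVec_smul, smul_dotProduct, dotProduct_smul, smul_eq_mul, smul_eq_mul,
          ← mul_assoc, ← mul_inv, dot_mulVec_eq_sum]
        congr 2
        calc 4 * √(n : ℝ) * (4 * √n) = 16 * √n ^ 2 := by ring
          _ = _ := by rw [hss]
      rw [this, div_eq_inv_mul]
      exact mul_le_mul_of_nonneg_left (h k l hk hl) (by positivity)
    have e3 := (le_abs_self _).trans (abs_dot_mulVec_le Q (x - x') y)
    have e4 := (le_abs_self _).trans (abs_dot_mulVec_le Q x' (y - y'))
    have e5 : l2 (x - x') * l2 y ≤ 1 / 4 * 1 :=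
      mul_le_mul hk1 hy (l2_nonneg _) (by norm_num)
    have e6 : l2 x' * l2 (y - y') ≤ 1 * (1 / 4) :=
      mul_le_mul hk2 hl1 (l2_nonneg _) (by norm_num)
    have e7 := mul_le_mul_of_nonneg_left e5 hQ0
    have e8 := mul_le_mul_of_nonneg_left e6 hQ0
    linarith
  have h2 : B / (8 * n) = 2 * (B / (16 * n)) := by field_simp; ring
  linarith

/-! ### Level sets -/

/-- The indices at which the modulus of an integer vector is in `[2 ^ s, 2 ^ (s + 1))`. -/
def levelSet {n : ℕ} (k : Fin n → ℤ) (s : ℕ) : Finset (Fin n) :=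
  Finset.univ.filter fun i => k i ≠ 0 ∧ Nat.log 2 (k i).natAbs = s

section levels
variable {n : ℕ} {k : Fin n → ℤ}

lemma two_pow_log_le {z : ℤ} (hz : z ≠ 0) : (2 : ℝ) ^ Nat.log 2 z.natAbs ≤ |(z : ℝ)| := by
  have := Nat.pow_log_le_self 2 (Int.natAbs_ne_zero.2 hz)
  rw [← Int.cast_abs, Int.abs_eq_natAbs]
  exact_mod_cast this

lemma abs_lt_two_pow_log (z : ℤ) : |(z : ℝ)| < 2 * 2 ^ Nat.log 2 z.natAbs := by
  have := Nat.lt_pow_succ_log_self (b := 2) (by norm_num) z.natAbs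
  rw [pow_succ, mul_comm] at this
  rw [← Int.cast_abs, Int.abs_eq_natAbs]
  exact_mod_cast this

lemma IsNetVector.sum_le (hk : IsNetVector k) : ∑ i, (k i : ℝ) ^ 2 ≤ 16 * n := by
  unfold IsNetVector at hk; exact_mod_cast hk

lemma IsNetVector.abs_le (hk : IsNetVector k) (i : Fin n) : (k i).natAbs ≤ 4 * n := by
  have h1 : k i ^ 2 ≤ 16 * (n : ℤ) :=
    (Finset.single_le_sum (f := fun i => k i ^ 2) (fun i _ => sq_nonneg (k i))
      (Finset.mem_univ i)).trans hk
  have hn : (1 : ℤ) ≤ n := by have := i.pos; omega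
  zify
  refine abs_le_of_sq_le_sq (h1.trans ?_) (by positivity)
  nlinarith

/-- The logarithm is bounded crudely by the number itself: a union over levels then costs a power of
`n`, which is affordable. -/
lemma IsNetVector.log_lt (hk : IsNetVector k) (i : Fin n) :
    Nat.log 2 (k i).natAbs ∈ Finset.range (4 * n + 1) := by
  rw [Finset.mem_range]
  exact lt_of_le_of_lt ((Nat.log_le_self _ _).trans (hk.abs_le i)) (Nat.lt_succ_self _)

lemma IsNetVector.sum_levels_le (hk : IsNetVector k) (S : ℕ) :
    ∑ s ∈ Finset.range S, (4 : ℝ) ^ s * (levelSet k s).card ≤ 16 * n := by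
  calc _ ≤ ∑ s ∈ Finset.range S, ∑ i ∈ Finset.univ.filter
        (fun i => Nat.log 2 (k i).natAbs = s), (k i : ℝ) ^ 2 := by
        refine Finset.sum_le_sum fun s _ => ?_
        rw [mul_comm, ← nsmul_eq_mul, ← Finset.sum_const]
        have hsub : levelSet k s ⊆ Finset.univ.filter (fun i => Nat.log 2 (k i).natAbs = s) :=
          fun i hi => Finset.mem_filter.2 ⟨Finset.mem_univ _, (Finset.mem_filter.1 hi).2.2⟩
        refine (Finset.sum_le_sum fun i hi => ?_).trans
          (Finset.sum_le_sum_of_subset_of_nonneg hsub fun i _ _ => sq_nonneg _)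
        obtain ⟨h0, h1⟩ := (Finset.mem_filter.1 hi).2
        have := two_pow_log_le h0
        rw [h1] at this
        rw [← sq_abs, show (4 : ℝ) ^ s = (2 ^ s) ^ 2 by rw [← pow_mul, mul_comm, pow_mul]; norm_num]
        gcongr
    _ ≤ ∑ i, (k i : ℝ) ^ 2 := by
        rw [← Finset.sum_biUnion]
        · exact Finset.sum_le_sum_of_subset_of_nonneg (Finset.subset_univ _)
            fun i _ _ => sq_nonneg _
        · intro s _ t _ hst
          rw [Function.onFun, Finset.disjoint_left]
          intro i hi hj
          exact hst ((Finset.mem_filter.1 hi).2.symm.trans (Finset.mem_filter.1 hj).2)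
    _ ≤ _ := hk.sum_le

end levels

/-- The number of edges between two sets is not much larger than its bound in the mean, uniformly
over all pairs of sets of which the first one is the smaller. -/
def Discrepancy {n : ℕ} (M : Fin n → Fin n → ℝ) (d c : ℝ) : Prop :=
  ∀ I J : Finset (Fin n), I.card ≤ J.card → J.Nonempty → ∀ s < 4 * n + 1, ∀ t < 4 * n + 1,
    1 ≤ 4 * 2 ^ (s + t) / √d →
      (1 + Real.log (4 * 2 ^ (s + t) / √d)) * ∑ i ∈ I, ∑ j ∈ J, M i j ≤
        I.card * J.card * (d / n) * Real.exp (1 + Real.log (4 * 2 ^ (s + t) / √d)) +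
        c * (J.card * (1 + Real.log (n / J.card)))

section heavy
variable {n : ℕ} {M : Fin n → Fin n → ℝ} {d c c₁ : ℝ} {k l : Fin n → ℤ}

/-- The discrepancy property requires the first set to be the smaller one, so only such pairs of
levels are treated; the others follow by exchanging the two vectors. -/
lemma heavy_half_le (hn : 0 < n) (hM : ∀ i j, 0 ≤ M i j) (hd : 0 < d) (hc : 0 ≤ c) (hc₁ : 0 ≤ c₁)
    (hdeg : ∀ i, ∑ j, M i j ≤ c₁ * d) (hdisc : Discrepancy M d c)
    (hk : IsNetVector k) (hl : IsNetVector l) :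
    ∑ s ∈ Finset.range (4 * n + 1), ∑ t ∈ Finset.range (4 * n + 1),
      (if 1 ≤ 4 * 2 ^ (s + t) / √d ∧ ((levelSet k s).card : ℝ) ≤ (levelSet l t).card then
        2 ^ (s + t) * ∑ i ∈ levelSet k s, ∑ j ∈ levelSet l t, M i j else 0)
      ≤ (64 * c₁ + 3072 + 768 * c) * (n * √d) := by
  refine heavy_levels_le (a := fun s => ((levelSet k s).card : ℝ))
    (b := fun t => ((levelSet l t).card : ℝ))
    (E := fun s t => ∑ i ∈ levelSet k s, ∑ j ∈ levelSet l t, M i j)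
    (by exact_mod_cast hn) hd hc hc₁ (fun _ => Nat.cast_nonneg _)
    (fun _ => Nat.cast_nonneg _) (hk.sum_levels_le _) (hl.sum_levels_le _) (fun s t => ?_)
    fun s hs t ht hb hab hσ => ?_
  · calc _ ≤ ∑ i ∈ levelSet k s, c₁ * d := Finset.sum_le_sum fun i _ =>
          (Finset.sum_le_sum_of_subset_of_nonneg (Finset.subset_univ _)
            fun j _ _ => hM i j).trans (hdeg i)
      _ = _ := by rw [Finset.sum_const, nsmul_eq_mul, mul_comm]
  · exact hdisc _ _ (by exact_mod_cast hab) (Finset.card_pos.1 (by exact_mod_cast hb)) s hs t ht hσ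

/-- The contribution of the heavy pairs. -/
theorem heavy_le (hn : 0 < n) (hM : ∀ i j, 0 ≤ M i j) (hd : 0 < d) (hc : 0 ≤ c) (hc₁ : 0 ≤ c₁)
    (hdeg : ∀ i, ∑ j, M i j ≤ c₁ * d) (hdeg' : ∀ j, ∑ i, M i j ≤ c₁ * d)
    (hdisc : Discrepancy M d c) (hdisc' : Discrepancy (fun i j => M j i) d c)
    (hk : IsNetVector k) (hl : IsNetVector l) :
    ∑ i, ∑ j, (if √d < |(k i : ℝ) * l j| then |(k i : ℝ) * l j| * M i j else 0)
      ≤ 8 * (64 * c₁ + 3072 + 768 * c) * (n * √d) := by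
  have hsd : 0 < √d := Real.sqrt_pos.2 hd
  set S := 4 * n + 1 with hS
  have h1 := heavy_half_le hn hM hd hc hc₁ hdeg hdisc hk hl
  have h2 := heavy_half_le (M := fun i j => M j i) hn (fun i j => hM j i) hd hc hc₁ hdeg' hdisc'
    hl hk
  rw [← hS] at h1 h2
  -- An upper bound for `|k i * l j|` on a pair of levels, set to zero when the levels are too small
  -- to contain a heavy pair.
  let G : ℕ → ℕ → ℝ := fun s t => if 1 ≤ 4 * 2 ^ (s + t) / √d then 4 * 2 ^ (s + t) else 0
  have hG0 : ∀ s t, 0 ≤ G s t := fun s t => by simp only [G]; split_ifs <;> positivity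
  let s' : Fin n → ℕ := fun i => Nat.log 2 (k i).natAbs
  let t' : Fin n → ℕ := fun j => Nat.log 2 (l j).natAbs
  have hpt : ∀ i j, (if √d < |(k i : ℝ) * l j| then |(k i : ℝ) * l j| * M i j else 0)
      ≤ if k i ≠ 0 ∧ l j ≠ 0 then G (s' i) (t' j) * M i j else 0 := by
    intro i j
    split_ifs with ha hb hb
    · refine mul_le_mul_of_nonneg_right ?_ (hM i j)
      have hlt : |(k i : ℝ) * l j| ≤ 4 * 2 ^ (s' i + t' j) := by
        rw [abs_mul, pow_add]
        calc _ ≤ (2 * 2 ^ s' i) * (2 * 2 ^ t' j) :=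
              mul_le_mul (abs_lt_two_pow_log _).le (abs_lt_two_pow_log _).le (abs_nonneg _)
                (by positivity)
          _ = _ := by ring
      have hσ : 1 ≤ 4 * 2 ^ (s' i + t' j) / √d := by
        rw [one_le_div hsd]; linarith
      simp only [G, if_pos hσ]; exact hlt
    · exfalso
      refine hb ⟨fun h => ?_, fun h => ?_⟩
      · rw [h] at ha; simp at ha; linarith
      · rw [h] at ha; simp at ha; linarith
    · exact mul_nonneg (hG0 _ _) (hM i j)
    · exact le_rfl
  have hfib : ∑ i, ∑ j, (if k i ≠ 0 ∧ l j ≠ 0 then G (s' i) (t' j) * M i j else 0)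
      = ∑ s ∈ Finset.range S, ∑ t ∈ Finset.range S,
        G s t * ∑ i ∈ levelSet k s, ∑ j ∈ levelSet l t, M i j := by
    have e1 : ∀ i, ∑ j, (if k i ≠ 0 ∧ l j ≠ 0 then G (s' i) (t' j) * M i j else 0)
        = ∑ t ∈ Finset.range S, if k i ≠ 0 then ∑ j ∈ levelSet l t, G (s' i) t * M i j else 0 := by
      intro i
      rw [← Finset.sum_fiberwise_of_maps_to (g := t') (fun j _ => hl.log_lt j)]
      refine Finset.sum_congr rfl fun t _ => ?_
      by_cases hki : k i ≠ 0
      · rw [if_pos hki, levelSet, Finset.sum_filter, Finset.sum_filter]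
        refine Finset.sum_congr rfl fun j _ => ?_
        by_cases hlj : l j ≠ 0 <;> by_cases ht : t' j = t
        · have ht2 : Nat.log 2 (l j).natAbs = t := ht
          simp [hki, hlj, ht, ht2]
        · have ht2 : ¬ Nat.log 2 (l j).natAbs = t := ht
          simp [ht, ht2]
        · simp [hlj]
        · simp [hlj]
      · simp [hki]
    simp only [e1]
    rw [← Finset.sum_fiberwise_of_maps_to (g := s') (fun i _ => hk.log_lt i)]
    refine Finset.sum_congr rfl fun s _ => ?_
    rw [Finset.sum_comm]
    refine Finset.sum_congr rfl fun t _ => ?_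
    have hks : levelSet k s = Finset.univ.filter
        fun i => k i ≠ 0 ∧ Nat.log 2 (k i).natAbs = s := rfl
    rw [Finset.mul_sum, hks, Finset.sum_filter, Finset.sum_filter]
    refine Finset.sum_congr rfl fun i _ => ?_
    by_cases hki : k i ≠ 0 <;> by_cases hs : s' i = s
    · have hs2 : Nat.log 2 (k i).natAbs = s := hs
      simp [hki, hs, hs2, Finset.mul_sum]
    · have hs2 : ¬ Nat.log 2 (k i).natAbs = s := hs
      simp [hs, hs2]
    · simp [hki]
    · simp [hki]
  have hsplit : ∀ s t, G s t * ∑ i ∈ levelSet k s, ∑ j ∈ levelSet l t, M i j ≤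
      4 * (if 1 ≤ 4 * 2 ^ (s + t) / √d ∧ ((levelSet k s).card : ℝ) ≤ (levelSet l t).card then
        2 ^ (s + t) * ∑ i ∈ levelSet k s, ∑ j ∈ levelSet l t, M i j else 0) +
      4 * (if 1 ≤ 4 * 2 ^ (t + s) / √d ∧ ((levelSet l t).card : ℝ) ≤ (levelSet k s).card then
        2 ^ (t + s) * ∑ j ∈ levelSet l t, ∑ i ∈ levelSet k s, M i j else 0) := by
    intro s t
    rw [Finset.sum_comm (s := levelSet l t), add_comm t s]
    have hE : 0 ≤ ∑ i ∈ levelSet k s, ∑ j ∈ levelSet l t, M i j :=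
      Finset.sum_nonneg fun i _ => Finset.sum_nonneg fun j _ => hM i j
    set E := ∑ i ∈ levelSet k s, ∑ j ∈ levelSet l t, M i j
    have hE2 : 0 ≤ 2 ^ (s + t) * E := by positivity
    simp only [G]
    by_cases hσ : 1 ≤ 4 * 2 ^ (s + t) / √d
    · rcases le_total ((levelSet k s).card : ℝ) (levelSet l t).card with h | h
      · rw [if_pos hσ, if_pos ⟨hσ, h⟩]; split_ifs <;> linarith
      · rw [if_pos hσ, if_pos (⟨hσ, h⟩ : _ ∧ ((levelSet l t).card : ℝ) ≤ (levelSet k s).card)]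
        split_ifs <;> linarith
    · rw [if_neg hσ, if_neg (fun h => hσ h.1), if_neg (fun h => hσ h.1)]; simp
  calc _ ≤ _ := Finset.sum_le_sum fun i _ => Finset.sum_le_sum fun j _ => hpt i j
    _ = _ := hfib
    _ ≤ _ := Finset.sum_le_sum fun s _ => Finset.sum_le_sum fun t _ => hsplit s t
    _ ≤ 4 * ((64 * c₁ + 3072 + 768 * c) * (n * √d)) + 4 * ((64 * c₁ + 3072 + 768 * c) * (n * √d)) := by
      simp only [Finset.sum_add_distrib, ← Finset.mul_sum]
      refine add_le_add (mul_le_mul_of_nonneg_left h1 (by norm_num))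
        (mul_le_mul_of_nonneg_left ?_ (by norm_num))
      rw [Finset.sum_comm]
      exact h2
    _ = _ := by ring

/-- Spectral norm from the light pairs, bounded degrees and the discrepancy property. -/
theorem specNorm_le_of_light_of_discrepancy {Q : Matrix (Fin n) (Fin n) ℝ} {C : ℝ} (hn : 0 < n)
    (hd : 0 < d) (hc : 0 ≤ c) (hc₁ : 0 ≤ c₁) (hM : ∀ i j, 0 ≤ M i j)
    (hQM : ∀ i j, |Q i j| ≤ M i j + d / n)
    (hdeg : ∀ i, ∑ j, M i j ≤ c₁ * d) (hdeg' : ∀ j, ∑ i, M i j ≤ c₁ * d)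
    (hdisc : Discrepancy M d c) (hdisc' : Discrepancy (fun i j => M j i) d c)
    (hlight : ∀ k l : Fin n → ℤ, IsNetVector k → IsNetVector l →
      ∑ i, ∑ j, (if |(k i : ℝ) * l j| ≤ √d then (k i : ℝ) * l j * Q i j else 0)
        ≤ C * (n * √d)) :
    specNorm Q ≤ (C + 256 + 8 * (64 * c₁ + 3072 + 768 * c)) * √d := by
  have hn0 : (0 : ℝ) < n := by exact_mod_cast hn
  have hsd : 0 < √d := Real.sqrt_pos.2 hd
  have hdd : √d * √d = d := Real.mul_self_sqrt hd.le
  have hC : 0 ≤ C := by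
    have h := hlight 0 0 (by simp [IsNetVector]) (by simp [IsNetVector])
    simp only [Pi.zero_apply, Int.cast_zero, mul_zero, zero_mul, ite_self,
      Finset.sum_const_zero] at h
    by_contra hneg
    push Not at hneg
    have : C * (n * √d) < 0 := mul_neg_of_neg_of_pos hneg (by positivity)
    linarith
  refine (specNorm_le_of_net hn (B := (C + 256 + 8 * (64 * c₁ + 3072 + 768 * c)) * (n * √d))
    fun k l hk hl => ?_).trans ?_
  · have h1 := hlight k l hk hl
    have h2 := heavy_le hn hM hd hc hc₁ hdeg hdeg' hdisc hdisc' hk hl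
    -- On a heavy pair `|k i * l j| * √d ≤ (k i * l j) ^ 2`, so the contribution of the means is
    -- bounded deterministically.
    have h3 : ∑ i, ∑ j, (if √d < |(k i : ℝ) * l j| then |(k i : ℝ) * l j| * (d / n) else 0)
        ≤ 256 * (n * √d) := by
      calc _ ≤ ∑ i, ∑ j, (k i : ℝ) ^ 2 * (l j : ℝ) ^ 2 * (√d / n) := by
            refine Finset.sum_le_sum fun i _ => Finset.sum_le_sum fun j _ => ?_
            split_ifs with h
            · have : |(k i : ℝ) * l j| * √d ≤ (k i : ℝ) ^ 2 * (l j : ℝ) ^ 2 := by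
                rw [← mul_pow, ← sq_abs, sq]
                exact mul_le_mul_of_nonneg_left h.le (abs_nonneg _)
              calc |(k i : ℝ) * l j| * (d / n) = |(k i : ℝ) * l j| * √d * (√d / n) := by
                    rw [← hdd]; simp only [Real.sqrt_mul_self hsd.le]; ring
                _ ≤ _ := mul_le_mul_of_nonneg_right this (by positivity)
            · positivity
        _ = (∑ i, (k i : ℝ) ^ 2) * (∑ j, (l j : ℝ) ^ 2) * (√d / n) := by
            rw [Finset.sum_mul_sum, Finset.sum_mul]
            exact Finset.sum_congr rfl fun i _ => by rw [Finset.sum_mul]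
        _ ≤ (16 * n) * (16 * n) * (√d / n) := by
            refine mul_le_mul_of_nonneg_right ?_ (by positivity)
            exact mul_le_mul hk.sum_le hl.sum_le (Finset.sum_nonneg fun j _ => sq_nonneg _)
              (by positivity)
        _ = _ := by field_simp; norm_num
    calc ∑ i, ∑ j, (k i : ℝ) * l j * Q i j
        ≤ ∑ i, ∑ j, ((if |(k i : ℝ) * l j| ≤ √d then (k i : ℝ) * l j * Q i j else 0) +
          (if √d < |(k i : ℝ) * l j| then |(k i : ℝ) * l j| * M i j else 0) +
          (if √d < |(k i : ℝ) * l j| then |(k i : ℝ) * l j| * (d / n) else 0)) := by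
          refine Finset.sum_le_sum fun i _ => Finset.sum_le_sum fun j _ => ?_
          by_cases h : |(k i : ℝ) * l j| ≤ √d
          · rw [if_pos h, if_neg (not_lt.2 h), if_neg (not_lt.2 h)]; linarith
          · rw [if_neg h, if_pos (not_le.1 h), if_pos (not_le.1 h), zero_add, ← mul_add]
            refine (le_abs_self _).trans ?_
            rw [abs_mul]
            exact mul_le_mul_of_nonneg_left (hQM i j) (abs_nonneg _)
      _ ≤ _ := by
          simp only [Finset.sum_add_distrib]
          linarith
  · rw [div_le_iff₀ (by positivity)]
    have : 0 ≤ (C + 256 + 8 * (64 * c₁ + 3072 + 768 * c)) * (n * √d) := by positivity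
    nlinarith

end heavy

/-- Spectral norm from the bilinear forms alone, when there are no heavy pairs. -/
theorem specNorm_le_of_light {n : ℕ} {Q : Matrix (Fin n) (Fin n) ℝ} {C d : ℝ} (hn : 0 < n)
    (hC : 0 ≤ C) (hd : (16 * n) ^ 2 ≤ d)
    (hlight : ∀ k l : Fin n → ℤ, IsNetVector k → IsNetVector l →
      ∑ i, ∑ j, (if |(k i : ℝ) * l j| ≤ √d then (k i : ℝ) * l j * Q i j else 0)
        ≤ C * (n * √d)) :
    specNorm Q ≤ C * √d := by
  have hn0 : (0 : ℝ) < n := by exact_mod_cast hn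
  have hs : (16 * n : ℝ) ≤ √d := Real.le_sqrt_of_sq_le hd
  refine (specNorm_le_of_net hn (B := C * (n * √d)) fun k l hk hl => ?_).trans ?_
  · refine le_trans (le_of_eq ?_) (hlight k l hk hl)
    refine Finset.sum_congr rfl fun i _ => Finset.sum_congr rfl fun j _ => ?_
    rw [if_pos]
    refine le_trans ?_ hs
    have hki : (k i : ℝ) ^ 2 ≤ 16 * n :=
      (Finset.single_le_sum (f := fun i => (k i : ℝ) ^ 2) (fun i _ => sq_nonneg _)
        (Finset.mem_univ i)).trans hk.sum_le
    have hlj : (l j : ℝ) ^ 2 ≤ 16 * n :=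
      (Finset.single_le_sum (f := fun i => (l i : ℝ) ^ 2) (fun i _ => sq_nonneg _)
        (Finset.mem_univ j)).trans hl.sum_le
    rw [abs_mul]
    nlinarith [sq_abs (k i : ℝ), sq_abs (l j : ℝ), sq_nonneg (|(k i : ℝ)| - |(l j : ℝ)|)]
  · rw [div_le_iff₀ (by positivity)]
    have : 0 ≤ C * (n * √d) := by positivity
    nlinarith

/-! ### Exponential inequalities for independent Bernoulli variables -/

/-- Independent Bernoulli variables `X e` with success probabilities `p e`, for `e` with `P e`. -/
structure IsBernoulliFamily {Ω κ : Type*} [MeasurableSpace Ω] (μ : Measure Ω) (P : κ → Prop)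
    (X : κ → Ω → ℝ) (p : κ → ℝ) : Prop where
  zero_one : ∀ e, P e → ∀ ω, X e ω = 0 ∨ X e ω = 1
  meas : ∀ e, P e → Measurable (X e)
  prob : ∀ e, P e → μ.real {ω | X e ω = 1} = p e
  indep : iIndepFun (fun (e : {e // P e}) => X e) μ

section chernoff
variable {Ω κ : Type*} [MeasurableSpace Ω] {μ : Measure Ω} [IsProbabilityMeasure μ] {P : κ → Prop}
  {X : κ → Ω → ℝ} {p : κ → ℝ}

lemma mgf_bernoulli {Y : Ω → ℝ} (hY : Measurable Y) (h01 : ∀ ω, Y ω = 0 ∨ Y ω = 1) (z : ℝ) :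
    mgf (fun ω => z * Y ω) μ 1 = 1 + μ.real {ω | Y ω = 1} * (Real.exp z - 1) := by
  have hset : MeasurableSet {ω | Y ω = 1} := hY (measurableSet_singleton 1)
  have h1 : (fun ω => Real.exp (1 * (z * Y ω)))
      = fun ω => 1 + {ω | Y ω = 1}.indicator (fun _ => Real.exp z - 1) ω := by
    ext ω
    rcases h01 ω with h | h
    · simp [h]
    · simp [h]
  rw [mgf, h1, integral_add (integrable_const _) ((integrable_const _).indicator hset),
    integral_indicator_const _ hset]
  simp

/-- From `1 + p * (exp z - 1) ≤ exp (p * (exp z - 1))`. The Poisson form is kept because the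
discrepancy bound needs large exponents. -/
lemma IsBernoulliFamily.chernoff (hX : IsBernoulliFamily μ P X p) (s : Finset κ)
    (hs : ∀ e ∈ s, P e) (z : κ → ℝ) (u : ℝ) :
    μ.real {ω | u ≤ ∑ e ∈ s, z e * X e ω}
      ≤ Real.exp (-u + ∑ e ∈ s, p e * (Real.exp (z e) - 1)) := by
  classical
  have hp0 : ∀ e ∈ s, 0 ≤ p e := fun e he => by
    rw [← hX.prob e (hs e he)]; exact measureReal_nonneg
  let Y : {e // P e} → Ω → ℝ := fun e ω => z e * X e ω
  have hYm : ∀ e, Measurable (Y e) := fun e => (hX.meas e e.2).const_mul _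
  have hYi : iIndepFun Y μ := hX.indep.comp (fun e x => z e * x) fun e => measurable_const_mul _
  have hsum : ∀ ω, (∑ e ∈ s.subtype P, Y e) ω = ∑ e ∈ s, z e * X e ω := fun ω => by
    rw [Finset.sum_apply]
    exact Finset.sum_subtype_of_mem (fun e => z e * X e ω) hs
  have hint : Integrable (fun ω => Real.exp (1 * (∑ e ∈ s.subtype P, Y e) ω)) μ := by
    refine Integrable.of_bound (C := Real.exp (∑ e ∈ s, |z e|)) ?_ ?_
    · simp only [hsum]
      exact ((Finset.measurable_sum s fun e he =>
        (hX.meas e (hs e he)).const_mul (z e)).const_mul 1).exp.aestronglyMeasurable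
    · refine Filter.Eventually.of_forall fun ω => ?_
      rw [Real.norm_eq_abs, Real.abs_exp, one_mul, hsum]
      refine Real.exp_le_exp.2 (Finset.sum_le_sum fun e he => ?_)
      rcases hX.zero_one e (hs e he) ω with h | h <;> rw [h]
      · simp
      · rw [mul_one]; exact le_abs_self _
  have h1 := measure_ge_le_exp_mul_mgf (μ := μ) (X := ∑ e ∈ s.subtype P, Y e) (t := 1) u
    zero_le_one hint
  have h2 : mgf (∑ e ∈ s.subtype P, Y e) μ 1
      ≤ Real.exp (∑ e ∈ s, p e * (Real.exp (z e) - 1)) := by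
    rw [hYi.mgf_sum hYm, Real.exp_sum, ← Finset.prod_subtype_of_mem _ hs]
    refine Finset.prod_le_prod (fun e _ => mgf_nonneg) fun e he => ?_
    rw [mgf_bernoulli (hX.meas e e.2) (hX.zero_one e e.2), hX.prob e e.2, add_comm]
    exact Real.add_one_le_exp _
  have h3 : {ω | u ≤ ∑ e ∈ s, z e * X e ω} = {ω | u ≤ (∑ e ∈ s.subtype P, Y e) ω} := by
    ext ω; simp only [Set.mem_ofPred_eq, hsum]
  rw [h3, Real.exp_add]
  refine h1.trans ?_
  rw [neg_mul, one_mul]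
  exact mul_le_mul_of_nonneg_left h2 (Real.exp_pos _).le

/-- For `|z| ≤ 1` one has `exp z - 1 - z ≤ z ^ 2`, so only a variance term remains. Light pairs are
those whose rescaled weights meet this restriction. -/
lemma IsBernoulliFamily.chernoff_centered (hX : IsBernoulliFamily μ P X p) (s : Finset κ)
    (hs : ∀ e ∈ s, P e) (z : κ → ℝ) (hz : ∀ e ∈ s, |z e| ≤ 1) (u : ℝ) :
    μ.real {ω | u ≤ ∑ e ∈ s, z e * (X e ω - p e)}
      ≤ Real.exp (-u + ∑ e ∈ s, p e * z e ^ 2) := by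
  have hp0 : ∀ e ∈ s, 0 ≤ p e := fun e he => by
    rw [← hX.prob e (hs e he)]; exact measureReal_nonneg
  have h1 := hX.chernoff s hs z (u + ∑ e ∈ s, p e * z e)
  have h2 : {ω | u ≤ ∑ e ∈ s, z e * (X e ω - p e)}
      = {ω | u + ∑ e ∈ s, p e * z e ≤ ∑ e ∈ s, z e * X e ω} := by
    ext ω
    simp only [Set.mem_ofPred_eq, mul_sub, Finset.sum_sub_distrib]
    rw [le_sub_iff_add_le]
    simp only [mul_comm (z _) (p _)]
  rw [h2]
  refine h1.trans (Real.exp_le_exp.2 ?_)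
  have h3 : ∑ e ∈ s, p e * (Real.exp (z e) - 1)
      ≤ ∑ e ∈ s, p e * z e ^ 2 + ∑ e ∈ s, p e * z e := by
    rw [← Finset.sum_add_distrib]
    refine Finset.sum_le_sum fun e he => ?_
    rw [← mul_add]
    refine mul_le_mul_of_nonneg_left ?_ (hp0 e he)
    have := (abs_le.1 (Real.abs_exp_sub_one_sub_id_le (hz e he))).2
    linarith
  linarith

end chernoff

/-! ### Cardinalities -/

lemma sum_half_pow_natAbs_le (m : ℕ) :
    ∑ z ∈ Finset.Icc (-(m : ℤ)) m, (1 / 2 : ℝ) ^ z.natAbs = 3 - 2 * (1 / 2) ^ m := by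
  induction m with
  | zero => norm_num
  | succ m ih =>
    have h1 : Finset.Icc (-((m + 1 : ℕ) : ℤ)) ((m + 1 : ℕ) : ℤ)
        = insert (-((m + 1 : ℕ) : ℤ)) (insert ((m + 1 : ℕ) : ℤ) (Finset.Icc (-(m : ℤ)) m)) := by
      ext z; simp only [Finset.mem_insert, Finset.mem_Icc]; omega
    rw [h1, Finset.sum_insert, Finset.sum_insert, ih]
    · rw [Int.natAbs_neg, Int.natAbs_natCast, pow_succ]; ring
    · simp
    · simp only [Finset.mem_insert, Finset.mem_Icc]; omega

open Classical in
/-- The finite set of net vectors. -/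
noncomputable def netVectors (n : ℕ) : Finset (Fin n → ℤ) :=
  (Fintype.piFinset fun _ => Finset.Icc (-((4 * n : ℕ) : ℤ)) ((4 * n : ℕ) : ℤ)).filter IsNetVector

lemma mem_netVectors {n : ℕ} {k : Fin n → ℤ} : k ∈ netVectors n ↔ IsNetVector k := by
  classical
  rw [netVectors, Finset.mem_filter, and_iff_right_iff_imp]
  intro hk
  rw [Fintype.mem_piFinset]
  intro i
  have := hk.abs_le i
  rw [Finset.mem_Icc]; omega

/-- A net vector has `exp (16 * n - ∑ i, k i ^ 2) ≥ 1`, and `exp (-z ^ 2) ≤ (1 / 2) ^ |z|` for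
integers. The sum of these weights factors over the coordinates, each factor being at most `3 ≤ exp
2`. -/
lemma card_netVectors_le (n : ℕ) : ((netVectors n).card : ℝ) ≤ Real.exp (18 * n) := by
  classical
  have h1 : ∀ k ∈ netVectors n, (1 : ℝ) ≤ Real.exp (16 * n) * ∏ i, (1 / 2 : ℝ) ^ (k i).natAbs := by
    intro k hk
    have hk2 := (mem_netVectors.1 hk).sum_le
    have h2 : Real.exp (-∑ i, (k i : ℝ) ^ 2) ≤ ∏ i, (1 / 2 : ℝ) ^ (k i).natAbs := by
      rw [← Finset.sum_neg_distrib, Real.exp_sum]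
      refine Finset.prod_le_prod (fun i _ => (Real.exp_pos _).le) fun i _ => ?_
      have h3 : ((k i).natAbs : ℝ) ≤ (k i : ℝ) ^ 2 := by
        have : (((k i).natAbs : ℤ) : ℝ) ≤ ((k i ^ 2 : ℤ) : ℝ) :=
          Int.cast_le.2 (Int.natAbs_le_self_sq (k i))
        simpa using this
      calc Real.exp (-(k i : ℝ) ^ 2) ≤ Real.exp (-((k i).natAbs : ℝ)) :=
            Real.exp_le_exp.2 (by linarith)
        _ = (Real.exp (-1)) ^ (k i).natAbs := by rw [← Real.exp_nat_mul]; ring_nf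
        _ ≤ _ := by
          refine pow_le_pow_left₀ (Real.exp_pos _).le ?_ _
          rw [Real.exp_neg, one_div]
          have := Real.exp_one_gt_d9
          gcongr; linarith
    calc (1 : ℝ) = Real.exp 0 := Real.exp_zero.symm
      _ ≤ Real.exp (16 * n + -∑ i, (k i : ℝ) ^ 2) := Real.exp_le_exp.2 (by linarith)
      _ ≤ _ := by rw [Real.exp_add]; exact mul_le_mul_of_nonneg_left h2 (Real.exp_pos _).le
  calc ((netVectors n).card : ℝ) = ∑ k ∈ netVectors n, 1 := by simp
    _ ≤ ∑ k ∈ netVectors n, Real.exp (16 * n) * ∏ i, (1 / 2 : ℝ) ^ (k i).natAbs :=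
        Finset.sum_le_sum h1
    _ ≤ ∑ k ∈ Fintype.piFinset fun _ => Finset.Icc (-((4 * n : ℕ) : ℤ)) ((4 * n : ℕ) : ℤ),
          Real.exp (16 * n) * ∏ i : Fin n, (1 / 2 : ℝ) ^ (k i).natAbs :=
        Finset.sum_le_sum_of_subset_of_nonneg (Finset.filter_subset _ _)
          fun k _ _ => by positivity
    _ = Real.exp (16 * n) * ∏ _i : Fin n,
          ∑ z ∈ Finset.Icc (-((4 * n : ℕ) : ℤ)) ((4 * n : ℕ) : ℤ), (1 / 2 : ℝ) ^ z.natAbs := by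
        rw [← Finset.mul_sum, Finset.prod_univ_sum]
    _ ≤ Real.exp (16 * n) * Real.exp (2 * n) := by
        gcongr
        rw [Finset.prod_const, sum_half_pow_natAbs_le, Finset.card_univ, Fintype.card_fin]
        have h4 : Real.exp (2 * n) = (Real.exp 2) ^ n := by rw [← Real.exp_nat_mul]; ring_nf
        rw [h4]
        have h5 : (0 : ℝ) < (1 / 2) ^ (4 * n) := by positivity
        have h6 : ((1 / 2 : ℝ)) ^ (4 * n) ≤ 1 := pow_le_one₀ (by norm_num) (by norm_num)
        refine pow_le_pow_left₀ (by linarith) ?_ _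
        have : (2 : ℝ) + 1 ≤ Real.exp 2 := Real.add_one_le_exp 2
        linarith
    _ = _ := by rw [← Real.exp_add]; ring_nf

/-- The number of subsets with at most `b` elements. -/
lemma card_subsets_le {n b : ℕ} (hb : 0 < b) (hbn : b ≤ n) :
    ((Finset.univ.filter fun I : Finset (Fin n) => I.card ≤ b).card : ℝ)
      ≤ Real.exp (b * (1 + Real.log (n / b))) := by
  have hb0 : (0 : ℝ) < b := by exact_mod_cast hb
  have hn0 : (0 : ℝ) < n := by exact_mod_cast hb.trans_le hbn
  set z : ℝ := b / n with hz
  have hz0 : 0 < z := by positivity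
  have hz1 : z ≤ 1 := by rw [hz, div_le_one hn0]; exact_mod_cast hbn
  -- Weighting a subset by `z ^ I.card` with `z = b / n` compares the count with `(1 + z) ^ n ≤ exp
  -- b`.
  have h1 : ((Finset.univ.filter fun I : Finset (Fin n) => I.card ≤ b).card : ℝ) * z ^ b
      ≤ Real.exp b := by
    calc _ = ∑ I ∈ Finset.univ.filter (fun I : Finset (Fin n) => I.card ≤ b), z ^ b := by simp
      _ ≤ ∑ I ∈ Finset.univ.filter (fun I : Finset (Fin n) => I.card ≤ b), z ^ I.card :=
          Finset.sum_le_sum fun I hI =>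
            pow_le_pow_of_le_one hz0.le hz1 (Finset.mem_filter.1 hI).2
      _ ≤ ∑ I : Finset (Fin n), z ^ I.card :=
          Finset.sum_le_sum_of_subset_of_nonneg (Finset.subset_univ _) fun _ _ _ => by positivity
      _ = (z + 1) ^ n := by
          have := Fintype.sum_pow_mul_eq_add_pow (Fin n) z 1
          simpa using this
      _ ≤ (Real.exp z) ^ n := by
          gcongr; exact Real.add_one_le_exp z
      _ = Real.exp b := by
          rw [← Real.exp_nat_mul, hz]; congr 1; field_simp
  have h2 : Real.exp (b * (1 + Real.log (n / b))) = Real.exp b * (z ^ b)⁻¹ := by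
    rw [mul_add, mul_one, Real.exp_add]
    congr 1
    rw [mul_comm, Real.exp_mul, Real.exp_log (by positivity), Real.rpow_natCast, ← inv_pow, hz,
      inv_div]
  rw [h2, ← div_eq_mul_inv, le_div_iff₀ (by positivity)]
  exact h1

/-- Since `log b ≤ b - 1`. Any multiple of the entropy left in the exponent after counting sets
therefore yields a power of `n`. -/
lemma log_le_entropy {n b : ℕ} (hb : 0 < b) (hbn : b ≤ n) :
    Real.log n ≤ b * (1 + Real.log (n / b)) := by
  have hb1 : (1 : ℝ) ≤ b := by exact_mod_cast hb
  have hb0 : (0 : ℝ) < b := by linarith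
  have hbn' : (b : ℝ) ≤ n := by exact_mod_cast hbn
  have h1 : 0 ≤ Real.log (n / b) := Real.log_nonneg ((one_le_div hb0).2 hbn')
  have h2 : Real.log n = Real.log b + Real.log (n / b) := by
    rw [Real.log_div (by linarith) hb0.ne']; ring
  have h3 := Real.log_le_sub_one_of_pos hb0
  nlinarith

/-- Union bound over pairs of sets. -/
lemma sum_subset_pairs_le {n : ℕ} {c : ℝ} (hc : 3 ≤ c) (hn : 0 < n) :
    ∑ J ∈ Finset.univ.filter (fun J : Finset (Fin n) => J.Nonempty),
      ∑ _I ∈ Finset.univ.filter (fun I : Finset (Fin n) => I.card ≤ J.card),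
        Real.exp (-(c * (J.card * (1 + Real.log (n / J.card)))))
      ≤ n * (n : ℝ) ^ (-(c - 3)) := by
  have hn0 : (0 : ℝ) < n := by exact_mod_cast hn
  have hcard : ∀ J : Finset (Fin n), J.card ≤ n := fun J => by
    simpa using Finset.card_le_univ J
  let φ : ℕ → ℝ := fun b => b * (1 + Real.log (n / b))
  -- The size of `J` is relaxed to all `b ≥ J.card`, so that `card_subsets_le` also counts the sets
  -- `J`. Of three units of `c`, one pays for `I`, one for `J`, and one is left over.
  have h1 : ∀ J ∈ Finset.univ.filter (fun J : Finset (Fin n) => J.Nonempty),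
      ∑ _I ∈ Finset.univ.filter (fun I : Finset (Fin n) => I.card ≤ J.card),
        Real.exp (-(c * (J.card * (1 + Real.log (n / J.card)))))
      ≤ ∑ b ∈ Finset.Icc 1 n, if J.card ≤ b then
          (n : ℝ) ^ (-(c - 3)) * Real.exp (-(2 * φ b)) else 0 := by
    intro J hJ
    have hJ0 : 0 < J.card := (Finset.mem_filter.1 hJ).2.card_pos
    have hmem : J.card ∈ Finset.Icc 1 n := Finset.mem_Icc.2 ⟨hJ0, hcard J⟩
    refine le_trans ?_ (Finset.single_le_sum (f := fun b => if J.card ≤ b then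
          (n : ℝ) ^ (-(c - 3)) * Real.exp (-(2 * φ b)) else 0) (fun b _ => by
            positivity) hmem)
    rw [Finset.sum_const, nsmul_eq_mul, if_pos le_rfl]
    have h2 := log_le_entropy hJ0 (hcard J)
    calc _ ≤ Real.exp (φ J.card) * Real.exp (-(c * φ J.card)) :=
          mul_le_mul_of_nonneg_right (card_subsets_le hJ0 (hcard J)) (Real.exp_pos _).le
      _ = Real.exp (-(c - 3) * φ J.card) * Real.exp (-(2 * φ J.card)) := by
          rw [← Real.exp_add, ← Real.exp_add]; ring_nf
      _ ≤ _ := by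
          refine mul_le_mul_of_nonneg_right ?_ (Real.exp_pos _).le
          rw [Real.rpow_def_of_pos hn0]
          refine Real.exp_le_exp.2 ?_
          simp only [φ]
          nlinarith
  calc _ ≤ _ := Finset.sum_le_sum h1
    _ ≤ ∑ J : Finset (Fin n), ∑ b ∈ Finset.Icc 1 n, (if J.card ≤ b then
          (n : ℝ) ^ (-(c - 3)) * Real.exp (-(2 * φ b)) else 0) :=
        Finset.sum_le_sum_of_subset_of_nonneg (Finset.subset_univ _) fun J _ _ =>
          Finset.sum_nonneg fun b _ => by positivity
    _ = ∑ b ∈ Finset.Icc 1 n, ((Finset.univ.filter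
          fun J : Finset (Fin n) => J.card ≤ b).card : ℝ) *
            ((n : ℝ) ^ (-(c - 3)) * Real.exp (-(2 * φ b))) := by
        rw [Finset.sum_comm]
        refine Finset.sum_congr rfl fun b _ => ?_
        rw [← Finset.sum_filter, Finset.sum_const, nsmul_eq_mul]
    _ ≤ ∑ b ∈ Finset.Icc 1 n, (n : ℝ) ^ (-(c - 3)) := by
        refine Finset.sum_le_sum fun b hb => ?_
        rw [Finset.mem_Icc] at hb
        have h2 := log_le_entropy hb.1 hb.2
        have h3 : 0 ≤ φ b := le_trans (Real.log_nonneg (by exact_mod_cast hn)) h2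
        calc _ ≤ Real.exp (φ b) * ((n : ℝ) ^ (-(c - 3)) * Real.exp (-(2 * φ b))) :=
              mul_le_mul_of_nonneg_right (card_subsets_le hb.1 hb.2) (by positivity)
          _ = (n : ℝ) ^ (-(c - 3)) * Real.exp (-φ b) := by
              rw [mul_left_comm, ← Real.exp_add]; ring_nf
          _ ≤ (n : ℝ) ^ (-(c - 3)) * 1 := by
              refine mul_le_mul_of_nonneg_left ?_ (by positivity)
              exact Real.exp_le_one_iff.2 (by linarith)
          _ = _ := mul_one _
    _ = _ := by simp

/-! ### Concentration of weighted sums of adjacency matrices -/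

/-- The pairs `i < j` at the times in `F`. -/
def windowEdges (n : ℕ) (F : Finset ℤ) : Finset (ℤ × Fin n × Fin n) :=
  (F ×ˢ Finset.univ).filter fun e => e.2.1 < e.2.2

lemma sum_windowEdges {n : ℕ} (F : Finset ℤ) (f : ℤ × Fin n × Fin n → ℝ) :
    ∑ e ∈ windowEdges n F, f e = ∑ i, ∑ j, if i < j then ∑ m ∈ F, f (m, i, j) else 0 := by
  rw [windowEdges, Finset.sum_filter, Finset.sum_product_right, Fintype.sum_prod_type]
  refine Finset.sum_congr rfl fun i _ => Finset.sum_congr rfl fun j _ => ?_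
  split_ifs <;> simp

section window
variable {Ω : Type*} {n : ℕ}

/-- The weighted sum of the centred variables above the diagonal. -/
def upperDeviation (F : Finset ℤ) (w : ℤ → ℝ) (X : ℤ × Fin n × Fin n → Ω → ℝ)
    (p : ℤ × Fin n × Fin n → ℝ) (ω : Ω) : Matrix (Fin n) (Fin n) ℝ :=
  Matrix.of fun i j => if i < j then ∑ m ∈ F, w m * (X (m, i, j) ω - p (m, i, j)) else 0

/-- The number of edges between two nodes over the times in `F`. -/
def upperCount (F : Finset ℤ) (X : ℤ × Fin n × Fin n → Ω → ℝ) (ω : Ω) (i j : Fin n) : ℝ :=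
  if i < j then ∑ m ∈ F, X (m, i, j) ω else 0

variable [MeasurableSpace Ω] {μ : Measure Ω} [IsProbabilityMeasure μ]
  {P : ℤ × Fin n × Fin n → Prop} {X : ℤ × Fin n × Fin n → Ω → ℝ} {p : ℤ × Fin n × Fin n → ℝ}
  {F : Finset ℤ} {q : ℝ}

/-- Dividing the weights by `√d` makes the exponents at most one. The variance term is at most
`F.card * q / d * (16 * n) ^ 2 = 256 * n`. -/
lemma IsBernoulliFamily.light (hX : IsBernoulliFamily μ P X p) (hn : 0 < n)
    (hP : ∀ e ∈ windowEdges n F, P e) (hq : 0 < q) (hF : F.Nonempty)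
    (hp : ∀ e ∈ windowEdges n F, p e ≤ q) {w : ℤ → ℝ} (hw : ∀ m ∈ F, |w m| ≤ 1) {d C : ℝ}
    (hd : d = n * F.card * q) {k l : Fin n → ℤ} (hk : IsNetVector k) (hl : IsNetVector l) :
    μ.real {ω | C * (n * √d) ≤ ∑ i, ∑ j, (if |(k i : ℝ) * l j| ≤ √d then
      (k i : ℝ) * l j * upperDeviation F w X p ω i j else 0)} ≤ Real.exp (-((C - 256) * n)) := by
  have hn0 : (0 : ℝ) < n := by exact_mod_cast hn
  have hF0 : (0 : ℝ) < F.card := by exact_mod_cast hF.card_pos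
  have hd0 : 0 < d := by rw [hd]; positivity
  have hsd : 0 < √d := Real.sqrt_pos.2 hd0
  let z : ℤ × Fin n × Fin n → ℝ := fun e =>
    if |(k e.2.1 : ℝ) * l e.2.2| ≤ √d then (k e.2.1 : ℝ) * l e.2.2 / √d * w e.1 else 0
  have hz : ∀ e ∈ windowEdges n F, |z e| ≤ 1 := by
    intro e he
    have hm : e.1 ∈ F := (Finset.mem_product.1 (Finset.mem_filter.1 he).1).1
    simp only [z]
    split_ifs with h
    · rw [abs_mul, abs_div, abs_of_pos hsd]
      exact mul_le_one₀ ((div_le_one hsd).2 h) (abs_nonneg _) (hw _ hm)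
    · simp
  have h1 := hX.chernoff_centered _ hP z hz (C * n)
  have h2 : ∀ ω, ∑ e ∈ windowEdges n F, z e * (X e ω - p e)
      = (√d)⁻¹ * ∑ i, ∑ j, (if |(k i : ℝ) * l j| ≤ √d then
        (k i : ℝ) * l j * upperDeviation F w X p ω i j else 0) := by
    intro ω
    rw [sum_windowEdges, Finset.mul_sum]
    refine Finset.sum_congr rfl fun i _ => ?_
    rw [Finset.mul_sum]
    refine Finset.sum_congr rfl fun j _ => ?_
    simp only [z, upperDeviation, Matrix.of_apply]
    split_ifs with h1 h2 <;> simp [Finset.mul_sum]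
    refine Finset.sum_congr rfl fun m _ => by field_simp
  have h3 : {ω | C * n ≤ ∑ e ∈ windowEdges n F, z e * (X e ω - p e)}
      = {ω | C * (n * √d) ≤ ∑ i, ∑ j, (if |(k i : ℝ) * l j| ≤ √d then
      (k i : ℝ) * l j * upperDeviation F w X p ω i j else 0)} := by
    ext ω
    simp only [Set.mem_ofPred_eq, h2]
    rw [← div_eq_inv_mul, le_div_iff₀ hsd, mul_assoc]
  rw [h3] at h1
  refine h1.trans (Real.exp_le_exp.2 ?_)
  have h4 : ∑ e ∈ windowEdges n F, p e * z e ^ 2 ≤ 256 * n := by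
    calc _ ≤ ∑ e ∈ windowEdges n F, q * ((k e.2.1 : ℝ) ^ 2 * (l e.2.2 : ℝ) ^ 2 / d) := by
          refine Finset.sum_le_sum fun e he => ?_
          have hm : e.1 ∈ F := (Finset.mem_product.1 (Finset.mem_filter.1 he).1).1
          refine mul_le_mul (hp e he) ?_ (sq_nonneg _) hq.le
          simp only [z]
          split_ifs with h
          · rw [mul_pow, div_pow, Real.sq_sqrt hd0.le, mul_pow]
            refine mul_le_of_le_one_right (by positivity) ?_
            rw [← sq_abs]; exact pow_le_one₀ (abs_nonneg _) (hw _ hm)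
          · rw [zero_pow (by norm_num)]; positivity
      _ ≤ ∑ i, ∑ j, F.card * (q * ((k i : ℝ) ^ 2 * (l j : ℝ) ^ 2 / d)) := by
          rw [sum_windowEdges]
          refine Finset.sum_le_sum fun i _ => Finset.sum_le_sum fun j _ => ?_
          split_ifs
          · exact le_of_eq (by simp)
          · positivity
      _ = F.card * q / d * ((∑ i, (k i : ℝ) ^ 2) * ∑ j, (l j : ℝ) ^ 2) := by
          rw [Finset.sum_mul_sum, Finset.mul_sum]
          refine Finset.sum_congr rfl fun i _ => ?_
          rw [Finset.mul_sum]
          exact Finset.sum_congr rfl fun j _ => by ring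
      _ ≤ F.card * q / d * ((16 * n) * (16 * n)) := by
          refine mul_le_mul_of_nonneg_left ?_ (by positivity)
          exact mul_le_mul hk.sum_le hl.sum_le (Finset.sum_nonneg fun j _ => sq_nonneg _)
            (by positivity)
      _ = _ := by rw [hd]; field_simp; norm_num
  linarith

/-- The net has at most `exp (36 * n)` pairs, and `292 = 256 + 36`. -/
lemma IsBernoulliFamily.light_union (hX : IsBernoulliFamily μ P X p) (hn : 0 < n)
    (hP : ∀ e ∈ windowEdges n F, P e) (hq : 0 < q) (hF : F.Nonempty)
    (hp : ∀ e ∈ windowEdges n F, p e ≤ q) {w : ℤ → ℝ} (hw : ∀ m ∈ F, |w m| ≤ 1) {d C : ℝ}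
    (hd : d = n * F.card * q) :
    μ.real {ω | ¬ ∀ k l : Fin n → ℤ, IsNetVector k → IsNetVector l →
      ∑ i, ∑ j, (if |(k i : ℝ) * l j| ≤ √d then
        (k i : ℝ) * l j * upperDeviation F w X p ω i j else 0) ≤ C * (n * √d)}
      ≤ Real.exp (-((C - 292) * n)) := by
  let bad : (Fin n → ℤ) × (Fin n → ℤ) → Set Ω := fun x =>
    {ω | C * (n * √d) ≤ ∑ i, ∑ j, (if |(x.1 i : ℝ) * x.2 j| ≤ √d then
      (x.1 i : ℝ) * x.2 j * upperDeviation F w X p ω i j else 0)}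
  have hsub : {ω | ¬ ∀ k l : Fin n → ℤ, IsNetVector k → IsNetVector l →
      ∑ i, ∑ j, (if |(k i : ℝ) * l j| ≤ √d then
        (k i : ℝ) * l j * upperDeviation F w X p ω i j else 0) ≤ C * (n * √d)}
      ⊆ ⋃ x ∈ netVectors n ×ˢ netVectors n, bad x := by
    intro ω hω
    simp only [Set.mem_ofPred_eq] at hω
    push Not at hω
    obtain ⟨k, l, hk, hl, h⟩ := hω
    refine Set.mem_biUnion (x := (k, l)) ?_ h.le
    exact Finset.mem_coe.2 (Finset.mem_product.2 ⟨mem_netVectors.2 hk, mem_netVectors.2 hl⟩)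
  calc _ ≤ μ.real (⋃ x ∈ netVectors n ×ˢ netVectors n, bad x) :=
        measureReal_mono hsub (measure_ne_top _ _)
    _ ≤ ∑ x ∈ netVectors n ×ˢ netVectors n, μ.real (bad x) :=
        measureReal_biUnion_finset_le _ _
    _ ≤ ∑ x ∈ netVectors n ×ˢ netVectors n, Real.exp (-((C - 256) * n)) := by
        refine Finset.sum_le_sum fun x hx => ?_
        rw [Finset.mem_product] at hx
        exact hX.light hn hP hq hF hp hw hd (mem_netVectors.1 hx.1) (mem_netVectors.1 hx.2)
    _ = (netVectors n).card * (netVectors n).card * Real.exp (-((C - 256) * n)) := by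
        rw [Finset.sum_const, Finset.card_product, nsmul_eq_mul]; push_cast; ring
    _ ≤ Real.exp (18 * n) * Real.exp (18 * n) * Real.exp (-((C - 256) * n)) := by
        gcongr <;> exact card_netVectors_le n
    _ = _ := by rw [← Real.exp_add, ← Real.exp_add]; ring_nf

/-- Upper tail of the number of edges in a rectangle. -/
lemma IsBernoulliFamily.rectangle (hX : IsBernoulliFamily μ P X p)
    (hP : ∀ e ∈ windowEdges n F, P e) (hq : 0 < q)
    (hp : ∀ e ∈ windowEdges n F, p e ≤ q) (I J : Finset (Fin n)) {lam : ℝ} (hlam : 0 ≤ lam)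
    (u : ℝ) :
    μ.real {ω | I.card * J.card * (F.card * q) * (Real.exp lam - 1) + u
      ≤ lam * ∑ i ∈ I, ∑ j ∈ J, upperCount F X ω i j} ≤ Real.exp (-u) := by
  classical
  let z : ℤ × Fin n × Fin n → ℝ := fun e => if e.2.1 ∈ I ∧ e.2.2 ∈ J then lam else 0
  have hrect : ∀ f : Fin n → Fin n → ℝ, ∑ i ∈ I, ∑ j ∈ J, f i j
      = ∑ i, ∑ j, if i ∈ I ∧ j ∈ J then f i j else 0 := fun f => by
    simp only [ite_and]
    rw [← Finset.sum_filter_add_sum_filter_not Finset.univ (· ∈ I)]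
    have h0 : ∑ i ∈ Finset.univ.filter (fun i => ¬ i ∈ I), ∑ j,
        (if i ∈ I then if j ∈ J then f i j else 0 else 0) = 0 :=
      Finset.sum_eq_zero fun i hi => by simp [(Finset.mem_filter.1 hi).2]
    rw [h0, add_zero, Finset.filter_univ_mem]
    refine Finset.sum_congr rfl fun i hi => ?_
    simp [hi]
  have h1 := hX.chernoff _ hP z
    (I.card * J.card * (F.card * q) * (Real.exp lam - 1) + u)
  have h2 : ∀ ω, ∑ e ∈ windowEdges n F, z e * X e ω
      = lam * ∑ i ∈ I, ∑ j ∈ J, upperCount F X ω i j := by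
    intro ω
    rw [sum_windowEdges, hrect, Finset.mul_sum]
    refine Finset.sum_congr rfl fun i _ => ?_
    rw [Finset.mul_sum]
    refine Finset.sum_congr rfl fun j _ => ?_
    simp only [z, upperCount]
    split_ifs <;> simp [Finset.mul_sum]
  simp only [h2] at h1
  refine h1.trans (Real.exp_le_exp.2 ?_)
  have he : 0 ≤ Real.exp lam - 1 := by linarith [Real.add_one_le_exp lam]
  have h3 : ∑ e ∈ windowEdges n F, p e * (Real.exp (z e) - 1)
      ≤ I.card * J.card * (F.card * q) * (Real.exp lam - 1) := by
    calc _ ≤ ∑ e ∈ windowEdges n F,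
          (if e.2.1 ∈ I ∧ e.2.2 ∈ J then q * (Real.exp lam - 1) else 0) := by
          refine Finset.sum_le_sum fun e he' => ?_
          simp only [z]
          split_ifs
          · exact mul_le_mul_of_nonneg_right (hp e he') he
          · simp
      _ ≤ ∑ i, ∑ j, (if i ∈ I ∧ j ∈ J then F.card * (q * (Real.exp lam - 1)) else 0) := by
          rw [sum_windowEdges]
          refine Finset.sum_le_sum fun i _ => Finset.sum_le_sum fun j _ => ?_
          have : 0 ≤ F.card * (q * (Real.exp lam - 1)) :=
            mul_nonneg (Nat.cast_nonneg _) (mul_nonneg hq.le he)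
          split_ifs <;> first | exact this | exact le_of_eq (by simp)
      _ = ∑ i ∈ I, ∑ j ∈ J, F.card * (q * (Real.exp lam - 1)) := (hrect _).symm
      _ = _ := by simp; ring
  linarith

end window

section window
variable {Ω : Type*} {n : ℕ} [MeasurableSpace Ω] {μ : Measure Ω} [IsProbabilityMeasure μ]
  {P : ℤ × Fin n × Fin n → Prop} {X : ℤ × Fin n × Fin n → Ω → ℝ} {p : ℤ × Fin n × Fin n → ℝ}
  {F : Finset ℤ} {q : ℝ}

lemma exp_neg_mul_le_rpow {c c₂ d : ℝ} (hn : 0 < n) (hc : 0 ≤ c) (hd : c₂ * Real.log n ≤ d) :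
    Real.exp (-(c * d)) ≤ (n : ℝ) ^ (-(c * c₂)) := by
  rw [Real.rpow_def_of_pos (by exact_mod_cast hn)]
  refine Real.exp_le_exp.2 ?_
  have := mul_le_mul_of_nonneg_left hd hc
  linarith

/-- Numbers of the form `2 * n`, absorbed in powers of `n`. -/
lemma two_mul_rpow_le (hn : 2 ≤ n) (x : ℝ) : (2 * n) * (n : ℝ) ^ x ≤ (n : ℝ) ^ (x + 2) := by
  have hn2 : (2 : ℝ) ≤ n := by exact_mod_cast hn
  have hn0 : (0 : ℝ) < n := by linarith
  rw [Real.rpow_add hn0, Real.rpow_two, mul_comm]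
  refine mul_le_mul_of_nonneg_left ?_ (Real.rpow_nonneg hn0.le _)
  nlinarith

/-- Rows and columns are rectangles with one side a singleton. At exponent `1` the mean part is at
most `(exp 1 - 1) * d ≤ 2 * d`, which leaves `(c₁ - 2) * d` for the probability. -/
lemma IsBernoulliFamily.degree_union (hX : IsBernoulliFamily μ P X p) (hn : 2 ≤ n)
    (hP : ∀ e ∈ windowEdges n F, P e) (hq : 0 < q)
    (hp : ∀ e ∈ windowEdges n F, p e ≤ q) {d c₁ c₂ : ℝ} (hd : d = n * F.card * q) (hc₁ : 2 ≤ c₁)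
    (hd2 : c₂ * Real.log n ≤ d) :
    μ.real {ω | ¬ ((∀ i, ∑ j, upperCount F X ω i j ≤ c₁ * d) ∧
      ∀ j, ∑ i, upperCount F X ω i j ≤ c₁ * d)} ≤ (n : ℝ) ^ (-((c₁ - 2) * c₂ - 2)) := by
  have hn0 : 0 < n := by omega
  have hd0 : 0 ≤ d := by rw [hd]; positivity
  have he := Real.exp_one_lt_d9
  let bad : Fin n → Set Ω := fun i => {ω | c₁ * d < ∑ j, upperCount F X ω i j}
  let bad' : Fin n → Set Ω := fun j => {ω | c₁ * d < ∑ i, upperCount F X ω i j}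
  have key : d * (Real.exp 1 - 1) + (c₁ - 2) * d ≤ c₁ * d := by nlinarith
  have hbad : ∀ i, μ.real (bad i) ≤ (n : ℝ) ^ (-((c₁ - 2) * c₂)) := fun i => by
    refine le_trans (measureReal_mono ?_ (measure_ne_top _ _)) ((hX.rectangle hP hq hp {i}
      Finset.univ zero_le_one ((c₁ - 2) * d)).trans
        (exp_neg_mul_le_rpow hn0 (by linarith) hd2))
    intro ω hω
    simp only [bad, Set.mem_ofPred_eq] at hω
    simp only [Set.mem_ofPred_eq, Finset.card_singleton, Finset.card_univ, Fintype.card_fin,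
      Finset.sum_singleton, one_mul, Nat.cast_one]
    have := key
    rw [hd] at this hω ⊢
    nlinarith
  have hbad' : ∀ i, μ.real (bad' i) ≤ (n : ℝ) ^ (-((c₁ - 2) * c₂)) := fun i => by
    refine le_trans (measureReal_mono ?_ (measure_ne_top _ _)) ((hX.rectangle hP hq hp
      Finset.univ {i} zero_le_one ((c₁ - 2) * d)).trans
        (exp_neg_mul_le_rpow hn0 (by linarith) hd2))
    intro ω hω
    simp only [bad', Set.mem_ofPred_eq] at hω
    simp only [Set.mem_ofPred_eq, Finset.card_singleton, Finset.card_univ, Fintype.card_fin,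
      Finset.sum_singleton, one_mul, Nat.cast_one, mul_one]
    have := key
    rw [hd] at this hω ⊢
    nlinarith
  have hsub : {ω | ¬ ((∀ i, ∑ j, upperCount F X ω i j ≤ c₁ * d) ∧
      ∀ j, ∑ i, upperCount F X ω i j ≤ c₁ * d)}
      ⊆ (⋃ i ∈ (Finset.univ : Finset (Fin n)), bad i) ∪
        ⋃ j ∈ (Finset.univ : Finset (Fin n)), bad' j := by
    intro ω hω
    simp only [Set.mem_ofPred_eq] at hω
    by_cases h : ∀ i, ∑ j, upperCount F X ω i j ≤ c₁ * d
    · right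
      have h' : ¬ ∀ j, ∑ i, upperCount F X ω i j ≤ c₁ * d := fun h' => hω ⟨h, h'⟩
      push Not at h'
      obtain ⟨j, hj⟩ := h'
      exact Set.mem_biUnion (Finset.mem_coe.2 (Finset.mem_univ j)) hj
    · left
      push Not at h
      obtain ⟨j, hj⟩ := h
      exact Set.mem_biUnion (Finset.mem_coe.2 (Finset.mem_univ j)) hj
  calc _ ≤ _ := measureReal_mono hsub (measure_ne_top _ _)
    _ ≤ _ := measureReal_union_le _ _
    _ ≤ ∑ i, μ.real (bad i) + ∑ i, μ.real (bad' i) :=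
        add_le_add (measureReal_biUnion_finset_le _ _) (measureReal_biUnion_finset_le _ _)
    _ ≤ ∑ _i : Fin n, (n : ℝ) ^ (-((c₁ - 2) * c₂)) + ∑ _i : Fin n, (n : ℝ) ^ (-((c₁ - 2) * c₂)) :=
        add_le_add (Finset.sum_le_sum fun i _ => hbad i) (Finset.sum_le_sum fun i _ => hbad' i)
    _ = (2 * n) * (n : ℝ) ^ (-((c₁ - 2) * c₂)) := by simp; ring
    _ ≤ _ := two_mul_rpow_le hn _
    _ = _ := by ring_nf

/-- Each inequality in `Discrepancy` is a Chernoff bound whose exponent depends on the levels only,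
so `(4 * n + 1) ^ 2` exponents suffice. Both orientations are needed because `upperCount` lives
above the diagonal. The prefactors cost `n ^ 9`, since `50 * n ^ 3 ≤ n ^ 9` for `n ≥ 2`. -/
lemma IsBernoulliFamily.discrepancy_union (hX : IsBernoulliFamily μ P X p) (hn : 2 ≤ n)
    (hP : ∀ e ∈ windowEdges n F, P e) (hq : 0 < q)
    (hp : ∀ e ∈ windowEdges n F, p e ≤ q) {d c : ℝ} (hd : d = n * F.card * q) (hc : 3 ≤ c) :
    μ.real {ω | ¬ (Discrepancy (upperCount F X ω) d c ∧
      Discrepancy (fun i j => upperCount F X ω j i) d c)} ≤ (n : ℝ) ^ (-(c - 12)) := by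
  classical
  have hn0 : 0 < n := by omega
  have hn2 : (2 : ℝ) ≤ n := by exact_mod_cast hn
  have hn00 : (0 : ℝ) < n := by linarith
  have hdn : d / n = F.card * q := by rw [hd]; field_simp
  have hNq : 0 ≤ F.card * q := by positivity
  let lam : ℕ × ℕ → ℝ := fun x => 1 + Real.log (4 * 2 ^ (x.1 + x.2) / √d)
  let u : Finset (Fin n) → ℝ := fun J => c * (J.card * (1 + Real.log (n / J.card)))
  let bad : ℕ × ℕ → Finset (Fin n) → Finset (Fin n) → Set Ω := fun x J I =>
    {ω | 0 ≤ lam x ∧ I.card * J.card * (F.card * q) * (Real.exp (lam x) - 1) + u J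
      ≤ lam x * ∑ i ∈ I, ∑ j ∈ J, upperCount F X ω i j}
  let bad' : ℕ × ℕ → Finset (Fin n) → Finset (Fin n) → Set Ω := fun x J I =>
    {ω | 0 ≤ lam x ∧ J.card * I.card * (F.card * q) * (Real.exp (lam x) - 1) + u J
      ≤ lam x * ∑ i ∈ J, ∑ j ∈ I, upperCount F X ω i j}
  have hbad : ∀ x J I, μ.real (bad x J I) ≤ Real.exp (-u J) := fun x J I => by
    by_cases hl : 0 ≤ lam x
    · refine le_trans (measureReal_mono ?_ (measure_ne_top _ _))
        (hX.rectangle hP hq hp I J hl (u J))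
      exact fun ω hω => hω.2
    · have : bad x J I = ∅ := Set.eq_empty_of_forall_notMem fun ω hω => hl hω.1
      rw [this, measureReal_empty]; exact (Real.exp_pos _).le
  have hbad' : ∀ x J I, μ.real (bad' x J I) ≤ Real.exp (-u J) := fun x J I => by
    by_cases hl : 0 ≤ lam x
    · refine le_trans (measureReal_mono ?_ (measure_ne_top _ _))
        (hX.rectangle hP hq hp J I hl (u J))
      exact fun ω hω => hω.2
    · have : bad' x J I = ∅ := Set.eq_empty_of_forall_notMem fun ω hω => hl hω.1
      rw [this, measureReal_empty]; exact (Real.exp_pos _).le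
  set R := Finset.range (4 * n + 1) ×ˢ Finset.range (4 * n + 1) with hR
  set SJ := Finset.univ.filter (fun J : Finset (Fin n) => J.Nonempty) with hSJ
  let SI : Finset (Fin n) → Finset (Finset (Fin n)) := fun J =>
    Finset.univ.filter (fun I : Finset (Fin n) => I.card ≤ J.card)
  have hsub : {ω | ¬ (Discrepancy (upperCount F X ω) d c ∧
      Discrepancy (fun i j => upperCount F X ω j i) d c)}
      ⊆ (⋃ x ∈ R, ⋃ J ∈ SJ, ⋃ I ∈ SI J, bad x J I) ∪
        ⋃ x ∈ R, ⋃ J ∈ SJ, ⋃ I ∈ SI J, bad' x J I := by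
    intro ω hω
    by_cases h : Discrepancy (upperCount F X ω) d c
    · right
      have h' : ¬ Discrepancy (fun i j => upperCount F X ω j i) d c := fun h' => hω ⟨h, h'⟩
      unfold Discrepancy at h'
      push Not at h'
      obtain ⟨I, J, hIJ, hJ, s, hs, t, ht, hσ, hlt⟩ := h'
      refine Set.mem_biUnion (x := (s, t)) (Finset.mem_coe.2 (Finset.mem_product.2
        ⟨Finset.mem_range.2 hs, Finset.mem_range.2 ht⟩)) ?_
      refine Set.mem_biUnion (x := J) (Finset.mem_coe.2
        (Finset.mem_filter.2 ⟨Finset.mem_univ _, hJ⟩)) ?_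
      refine Set.mem_biUnion (x := I) (Finset.mem_coe.2
        (Finset.mem_filter.2 ⟨Finset.mem_univ _, hIJ⟩)) ?_
      refine ⟨by have := Real.log_nonneg hσ; simp only [lam]; linarith, ?_⟩
      rw [Finset.sum_comm]
      refine le_trans ?_ hlt.le
      rw [hdn, mul_comm (J.card : ℝ)]
      simp only [lam, u]
      have : 0 ≤ (I.card : ℝ) * J.card * (F.card * q) := by positivity
      linarith
    · left
      unfold Discrepancy at h
      push Not at h
      obtain ⟨I, J, hIJ, hJ, s, hs, t, ht, hσ, hlt⟩ := h
      refine Set.mem_biUnion (x := (s, t)) (Finset.mem_coe.2 (Finset.mem_product.2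
        ⟨Finset.mem_range.2 hs, Finset.mem_range.2 ht⟩)) ?_
      refine Set.mem_biUnion (x := J) (Finset.mem_coe.2
        (Finset.mem_filter.2 ⟨Finset.mem_univ _, hJ⟩)) ?_
      refine Set.mem_biUnion (x := I) (Finset.mem_coe.2
        (Finset.mem_filter.2 ⟨Finset.mem_univ _, hIJ⟩)) ?_
      refine ⟨by have := Real.log_nonneg hσ; simp only [lam]; linarith, ?_⟩
      refine le_trans ?_ hlt.le
      rw [hdn]
      simp only [lam, u]
      have : 0 ≤ (I.card : ℝ) * J.card * (F.card * q) := by positivity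
      linarith
  have hsum : ∀ B : ℕ × ℕ → Finset (Fin n) → Finset (Fin n) → Set Ω,
      (∀ x J I, μ.real (B x J I) ≤ Real.exp (-u J)) →
      μ.real (⋃ x ∈ R, ⋃ J ∈ SJ, ⋃ I ∈ SI J, B x J I)
        ≤ (4 * n + 1) ^ 2 * (n * (n : ℝ) ^ (-(c - 3))) := by
    intro B hB
    calc _ ≤ ∑ x ∈ R, μ.real (⋃ J ∈ SJ, ⋃ I ∈ SI J, B x J I) :=
          measureReal_biUnion_finset_le _ _
      _ ≤ ∑ x ∈ R, n * (n : ℝ) ^ (-(c - 3)) := by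
          refine Finset.sum_le_sum fun x _ => ?_
          refine (measureReal_biUnion_finset_le _ _).trans ?_
          refine le_trans (Finset.sum_le_sum fun J _ => ?_) (sum_subset_pairs_le hc hn0)
          refine (measureReal_biUnion_finset_le _ _).trans ?_
          exact Finset.sum_le_sum fun I _ => hB x J I
      _ = _ := by
          rw [Finset.sum_const, hR, Finset.card_product, Finset.card_range, nsmul_eq_mul]
          push_cast; ring
  calc _ ≤ _ := measureReal_mono hsub (measure_ne_top _ _)
    _ ≤ _ := measureReal_union_le _ _
    _ ≤ _ := add_le_add (hsum bad hbad) (hsum bad' hbad')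
    _ = (2 * (4 * n + 1) ^ 2 * n) * (n : ℝ) ^ (-(c - 3)) := by ring
    _ ≤ (n : ℝ) ^ 9 * (n : ℝ) ^ (-(c - 3)) := by
        refine mul_le_mul_of_nonneg_right ?_ (Real.rpow_nonneg hn00.le _)
        have h1 : (4 * n + 1 : ℝ) ^ 2 ≤ (5 * n) ^ 2 := by gcongr; linarith
        have h6 : (2 : ℝ) ^ 6 ≤ (n : ℝ) ^ 6 := by gcongr
        calc (2 * (4 * n + 1) ^ 2 * n : ℝ) ≤ 2 * (5 * n) ^ 2 * n := by gcongr
          _ = 50 * n ^ 3 := by ring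
          _ ≤ n ^ 6 * n ^ 3 := by gcongr; linarith
          _ = _ := by ring
    _ = _ := by
        rw [← Real.rpow_natCast (n : ℝ) 9, ← Real.rpow_add hn00]
        congr 1; push_cast; ring

/-- Concentration in the spectral norm without logarithmic factors, in the sparse regime. -/
theorem IsBernoulliFamily.concentration (hX : IsBernoulliFamily μ P X p) (hn : 2 ≤ n)
    (hP : ∀ e ∈ windowEdges n F, P e) (hq : 0 < q) (hF : F.Nonempty)
    (hp : ∀ e ∈ windowEdges n F, p e ≤ q) {w : ℤ → ℝ} (hw : ∀ m ∈ F, |w m| ≤ 1)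
    {d C c c₁ c₂ : ℝ} (hd : d = n * F.card * q) (hc : 3 ≤ c) (hc₁ : 2 ≤ c₁)
    (hd2 : c₂ * Real.log n ≤ d) :
    μ.real {ω | ¬ specNorm (upperDeviation F w X p ω)
        ≤ (C + 256 + 8 * (64 * c₁ + 3072 + 768 * c)) * √d}
      ≤ Real.exp (-((C - 292) * n)) + (n : ℝ) ^ (-((c₁ - 2) * c₂ - 2)) +
        (n : ℝ) ^ (-(c - 12)) := by
  have hn0 : 0 < n := by omega
  have hn00 : (0 : ℝ) < n := by exact_mod_cast hn0
  have hF0 : (0 : ℝ) < F.card := by exact_mod_cast hF.card_pos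
  have hd0 : 0 < d := by rw [hd]; positivity
  have hdn : d / n = F.card * q := by rw [hd]; field_simp
  have h1 := hX.light_union hn0 hP hq hF hp hw (C := C) hd
  have h2 := hX.degree_union hn hP hq hp hd hc₁ hd2
  have h3 := hX.discrepancy_union hn hP hq hp hd hc
  refine le_trans ?_ (add_le_add (add_le_add h1 h2) h3)
  refine le_trans (measureReal_mono ?_ (measure_ne_top _ _)) ((measureReal_union_le _ _).trans
    (add_le_add (measureReal_union_le _ _) le_rfl))
  intro ω hω
  by_contra hcon
  simp only [Set.mem_union, not_or, Set.mem_ofPred_eq, not_not] at hcon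
  obtain ⟨⟨hl, hdeg⟩, hdisc⟩ := hcon
  have hedge : ∀ i j, i < j → ∀ m ∈ F, ((m, i, j) : ℤ × Fin n × Fin n) ∈ windowEdges n F :=
    fun i j hij m hm => Finset.mem_filter.2
      ⟨Finset.mem_product.2 ⟨hm, Finset.mem_univ _⟩, hij⟩
  have hX0 : ∀ i j, i < j → ∀ m ∈ F, 0 ≤ X (m, i, j) ω := fun i j hij m hm => by
    rcases hX.zero_one _ (hP _ (hedge i j hij m hm)) ω with h | h <;> rw [h]
    exact zero_le_one
  refine hω (specNorm_le_of_light_of_discrepancy (M := upperCount F X ω) hn0 hd0 (by linarith)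
    (by linarith) (fun i j => ?_) (fun i j => ?_) hdeg.1 hdeg.2 hdisc.1 hdisc.2 hl)
  · unfold upperCount
    split_ifs with h
    · exact Finset.sum_nonneg fun m hm => hX0 i j h m hm
    · exact le_rfl
  · unfold upperCount upperDeviation
    rw [Matrix.of_apply]
    split_ifs with h
    · calc |∑ m ∈ F, w m * (X (m, i, j) ω - p (m, i, j))|
          ≤ ∑ m ∈ F, |w m * (X (m, i, j) ω - p (m, i, j))| := Finset.abs_sum_le_sum_abs _ _
        _ ≤ ∑ m ∈ F, (X (m, i, j) ω + q) := by
            refine Finset.sum_le_sum fun m hm => ?_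
            have he := hedge i j h m hm
            have hp0 : 0 ≤ p (m, i, j) := by
              rw [← hX.prob _ (hP _ he)]; exact measureReal_nonneg
            have hpq := hp _ he
            have hx := hX0 i j h m hm
            rw [abs_mul]
            calc _ ≤ 1 * |X (m, i, j) ω - p (m, i, j)| :=
                  mul_le_mul_of_nonneg_right (hw m hm) (abs_nonneg _)
              _ ≤ _ := by rw [one_mul, abs_le]; constructor <;> linarith
        _ = _ := by rw [Finset.sum_add_distrib, Finset.sum_const, nsmul_eq_mul, hdn]
    · rw [abs_zero, zero_add]; positivity

/-- Concentration in the spectral norm in the dense regime. -/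
theorem IsBernoulliFamily.concentration_dense (hX : IsBernoulliFamily μ P X p) (hn : 0 < n)
    (hP : ∀ e ∈ windowEdges n F, P e) (hq : 0 < q) (hF : F.Nonempty)
    (hp : ∀ e ∈ windowEdges n F, p e ≤ q) {w : ℤ → ℝ} (hw : ∀ m ∈ F, |w m| ≤ 1)
    {d C : ℝ} (hC : 0 ≤ C) (hd : d = n * F.card * q) (hd2 : (16 * n) ^ 2 ≤ d) :
    μ.real {ω | ¬ specNorm (upperDeviation F w X p ω) ≤ C * √d}
      ≤ Real.exp (-((C - 292) * n)) := by
  refine le_trans (measureReal_mono ?_ (measure_ne_top _ _))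
    (hX.light_union hn hP hq hF hp hw (C := C) hd)
  intro ω hω hl
  exact hω (specNorm_le_of_light hn hC hd2 hl)

end window

/-! ### Deviation of the kernel estimator -/

/-- The model assumptions other than the law of the adjacency matrices. -/
structure Model {n K : ℕ} (T s : ℕ) (α Cα c₀ β L Cl Wmax : ℝ) (W : Fin 3 → ℕ → ℤ → ℝ)
    (H : ℤ → Matrix (Fin K) (Fin K) ℝ) (Θ : ℤ → Matrix (Fin n) (Fin K) ℝ) : Prop where
  c₀_pos : 0 < c₀
  one_le_Cα : 1 ≤ Cα
  Wmax_pos : 0 < Wmax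
  β_pos : 0 < β
  L_pos : 0 < L
  one_le_Cl : 1 ≤ Cl
  K_pos : 0 < K
  T_pos : 0 < T
  α_pos : 0 < α
  mem : ∀ t ∈ Finset.Icc (1 : ℤ) T, Θ t ∈ clusteringMatrices n K
  nonempty : ∀ t ∈ Finset.Icc (1 : ℤ) T, ∀ k, (community (Θ t) k).Nonempty
  connectivity : IsConnectivity T α Cα H
  smooth : SmoothConnectivity T β L H
  switches : FewSwitches T s Θ
  eigenvalues : EigenvalueBounds T Cl H
  kernel : IsKernel (holderOrder β) Wmax W
  dense : Cα⁻¹ * c₀ * Real.log n / n ≤ α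

/-- Bound on the bias of the kernel average with width `r`. -/
noncomputable def bias (n T s nmax : ℕ) (α β L Cl Wmax : ℝ) (r : ℕ) : ℝ :=
  n * (α * (Wmax * (L * ((r : ℝ) / T) ^ β))) + Wmax * (2 * √(2 * (r * s)) * (α * Cl) * √nmax)

section
variable {n K T s : ℕ} {α Cα c₀ β L Cl Wmax : ℝ} {W : Fin 3 → ℕ → ℤ → ℝ}
  {H : ℤ → Matrix (Fin K) (Fin K) ℝ} {Θ : ℤ → Matrix (Fin n) (Fin K) ℝ}

lemma abs_le_maxAbsEntry {m k : ℕ} (Q : Matrix (Fin m) (Fin k) ℝ) (i : Fin m) (j : Fin k) :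
    |Q i j| ≤ maxAbsEntry Q :=
  le_ciSup (f := fun p : Fin m × Fin k => |Q p.1 p.2|) (Set.finite_range _).bddAbove (i, j)

lemma Model.edgeProb_le (h : Model T s α Cα c₀ β L Cl Wmax W H Θ) {t : ℤ}
    (ht : t ∈ Finset.Icc (1 : ℤ) T) (i j : Fin n) : edgeProb α (H t) (Θ t) i j ≤ Cα * α := by
  obtain ⟨g, hg⟩ := exists_eq_ofLabels (h.mem t ht)
  rw [hg, edgeProb_ofLabels_apply]
  exact (le_abs_self _).trans ((abs_le_maxAbsEntry _ _ _).trans (h.connectivity t ht).2.2.2)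

lemma Model.edgeProb_nonneg (h : Model T s α Cα c₀ β L Cl Wmax W H Θ) {t : ℤ}
    (ht : t ∈ Finset.Icc (1 : ℤ) T) (i j : Fin n) : 0 ≤ edgeProb α (H t) (Θ t) i j := by
  obtain ⟨g, hg⟩ := exists_eq_ofLabels (h.mem t ht)
  rw [hg, edgeProb_ofLabels_apply]
  exact ((h.connectivity t ht).2.1 _ _).1

lemma Model.edgeProb_comm (h : Model T s α Cα c₀ β L Cl Wmax W H Θ) {t : ℤ}
    (ht : t ∈ Finset.Icc (1 : ℤ) T) (i j : Fin n) :
    edgeProb α (H t) (Θ t) i j = edgeProb α (H t) (Θ t) j i := by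
  obtain ⟨g, hg⟩ := exists_eq_ofLabels (h.mem t ht)
  rw [hg, edgeProb_ofLabels_apply, edgeProb_ofLabels_apply, Matrix.smul_apply, Matrix.smul_apply,
    (h.connectivity t ht).1.apply]

lemma Model.α_le (h : Model T s α Cα c₀ β L Cl Wmax W H Θ) : α ≤ Cα := by
  have h1 : (1 : ℤ) ∈ Finset.Icc (1 : ℤ) T := by
    have := h.T_pos
    simp; omega
  have hC := h.one_le_Cα
  obtain ⟨-, h2, h3, -⟩ := h.connectivity 1 h1
  have : Nonempty (Fin K × Fin K) := ⟨(⟨0, h.K_pos⟩, ⟨0, h.K_pos⟩)⟩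
  have h4 : maxAbsEntry (α • H 1) ≤ 1 := ciSup_le fun p => by
    rw [abs_of_nonneg (h2 _ _).1]; exact (h2 _ _).2
  have h5 : Cα⁻¹ * α ≤ 1 := h3.trans h4
  rwa [inv_mul_le_iff₀ (by linarith), mul_one] at h5

variable {Ω : Type*} [MeasurableSpace Ω] {μ : Measure Ω} {a : ℝ}
  {A : ℤ → Ω → Matrix (Fin n) (Fin n) ℝ} {P : ℤ → Matrix (Fin n) (Fin n) ℝ}

lemma IsAdjacencySample.isBernoulliFamily (hA : IsAdjacencySample μ T a P A) :
    IsBernoulliFamily μ (fun e : ℤ × Fin n × Fin n => e.1 ∈ Finset.Icc (1 : ℤ) T ∧ e.2.1 < e.2.2)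
      (fun e ω => A e.1 ω e.2.1 e.2.2) (fun e => P e.1 e.2.1 e.2.2) where
  zero_one e he ω := hA.zero_one e.1 he.1 ω _ _ he.2
  meas e he := hA.meas e.1 he.1 _ _ he.2
  prob e he := hA.prob e.1 he.1 _ _ he.2
  indep := hA.indep

/-- The weights average to one, so the target passes under the average and the error splits into
bias and noise. The noise weights are divided by `Wmax` to be at most one in modulus, as the
concentration bounds require. -/
lemma kernel_decomposition {F : Finset ℤ} {w : ℤ → ℝ} {N : ℝ} (hN : 0 < N) (hW : 0 < Wmax)
    (hsum : N⁻¹ * ∑ i ∈ F, w i = 1) (x p : ℤ → ℝ) (q : ℝ) :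
    N⁻¹ * ∑ i ∈ F, w i * x i - q = N⁻¹ * ∑ i ∈ F, w i * (p i - q) +
      Wmax / N * ∑ i ∈ F, w i / Wmax * (x i - p i) := by
  have h1 : Wmax / N * ∑ i ∈ F, w i / Wmax * (x i - p i)
      = N⁻¹ * ∑ i ∈ F, w i * (x i - p i) := by
    rw [Finset.mul_sum, Finset.mul_sum]
    exact Finset.sum_congr rfl fun i _ => by field_simp
  rw [h1, ← mul_add, ← Finset.sum_add_distrib]
  have h2 : ∑ i ∈ F, (w i * (p i - q) + w i * (x i - p i))
      = ∑ i ∈ F, w i * x i - (∑ i ∈ F, w i) * q := by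
    rw [Finset.sum_mul, ← Finset.sum_sub_distrib]
    exact Finset.sum_congr rfl fun i _ => by ring
  rw [h2, mul_sub, ← mul_assoc, hsum, one_mul]

/-- The diagonal cancels exactly because the kernel averages the constant `a` to itself. Removing
the diagonal from the bias costs a factor two, and so does assembling the symmetric noise from its
upper triangle and the transpose. -/
theorem specNorm_kernelEstimator_sub_le (h : Model T s α Cα c₀ β L Cl Wmax W H Θ)
    (hA : IsAdjacencySample μ T a (fun t => edgeProb α (H t) (Θ t)) A) {t : ℤ}
    (ht : t ∈ Finset.Icc (1 : ℤ) T) {r : ℕ} (hr : 2 * r ≤ T) :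
    ∃ (F : Finset ℤ) (w : ℤ → ℝ), (∀ u ∈ F, u ∈ Finset.Icc (1 : ℤ) T) ∧ (∀ u ∈ F, |w u| ≤ 1) ∧
      r + 1 ≤ F.card ∧ F.card ≤ 2 * r + 1 ∧
      ∀ ω, specNorm (kernelEstimator T W (fun u => A u ω) t r - a • (1 : Matrix (Fin n) (Fin n) ℝ)
          - offDiag (edgeProb α (H t) (Θ t)))
        ≤ 2 * bias n T s (nMax T Θ) α β L Cl Wmax r + 2 * Wmax / F.card *
          specNorm (upperDeviation F w (fun e ω => A e.1 ω e.2.1 e.2.2)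
            (fun e => edgeProb α (H e.1) (Θ e.1) e.2.1 e.2.2) ω) := by
  obtain ⟨j, hj, hti, hj'⟩ := exists_window hr ht
  have hWp := h.Wmax_pos
  have hN := offsets_card_pos r j
  obtain ⟨hWb, hWm⟩ := h.kernel j r
  have hsum := hWm 0 (Nat.zero_le _)
  simp only [pow_zero, one_mul, if_true] at hsum
  refine ⟨(offsets r j).map (addLeftEmbedding t), fun u => W j r (u - t) / Wmax, ?_, ?_, ?_, ?_,
    fun ω => ?_⟩
  · intro u hu
    obtain ⟨i, hi, rfl⟩ := Finset.mem_map.1 hu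
    exact hti i hi
  · intro u hu
    obtain ⟨i, hi, rfl⟩ := Finset.mem_map.1 hu
    simp only [addLeftEmbedding_apply, add_sub_cancel_left]
    rw [abs_div, abs_of_pos hWp, div_le_one hWp]
    exact hWb i hi
  · rw [Finset.card_map]; exact offsets_card_ge r j
  · rw [Finset.card_map]; exact offsets_card_le r j
  rw [Finset.card_map]
  set U := upperDeviation ((offsets r j).map (addLeftEmbedding t)) (fun u => W j r (u - t) / Wmax)
    (fun e ω => A e.1 ω e.2.1 e.2.2) (fun e => edgeProb α (H e.1) (Θ e.1) e.2.1 e.2.2) ω with hU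
  set N := ((offsets r j).card : ℝ) with hNdef
  have hUlt : ∀ i k, i < k → U i k = ∑ m ∈ offsets r j, W j r m / Wmax *
      (A (t + m) ω i k - edgeProb α (H (t + m)) (Θ (t + m)) i k) := by
    intro i k hik
    simp only [hU, upperDeviation, of_apply, if_pos hik, Finset.sum_map, addLeftEmbedding_apply,
      add_sub_cancel_left]
  have hUge : ∀ i k, ¬ i < k → U i k = 0 := by
    intro i k hik
    simp only [hU, upperDeviation, of_apply, if_neg hik]
  have hdec : kernelEstimator T W (fun u => A u ω) t r - a • (1 : Matrix (Fin n) (Fin n) ℝ)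
      - offDiag (edgeProb α (H t) (Θ t))
      = offDiag (N⁻¹ • ∑ m ∈ offsets r j,
        W j r m • (edgeProb α (H (t + m)) (Θ (t + m)) - edgeProb α (H t) (Θ t)))
        + (Wmax / N) • (U + Uᵀ) := by
    rw [kernelEstimator_eq W _ hj hj']
    ext i k
    simp only [offDiag, Matrix.sub_apply, Matrix.add_apply, Matrix.smul_apply, Matrix.sum_apply, smul_eq_mul,
      transpose_apply, diagonal_apply, one_apply]
    rcases lt_trichotomy i k with hik | rfl | hik
    · rw [hUlt i k hik, hUge k i (by omega), if_neg hik.ne, if_neg hik.ne, if_neg hik.ne]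
      simp only [mul_zero, sub_zero, add_zero]
      exact kernel_decomposition hN hWp hsum _ _ _
    · rw [hUge i i (lt_irrefl _)]
      simp only [if_true, mul_one, sub_self, add_zero, mul_zero, sub_zero]
      have : ∑ m ∈ offsets r j, W j r m * A (t + m) ω i i = (∑ m ∈ offsets r j, W j r m) * a := by
        rw [Finset.sum_mul]
        exact Finset.sum_congr rfl fun m hm => by rw [hA.diag _ (hti m hm)]
      rw [this, ← mul_assoc, hsum, one_mul, sub_self]
    · rw [hUlt k i hik, hUge i k (by omega), if_neg hik.ne', if_neg hik.ne', if_neg hik.ne']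
      simp only [mul_zero, sub_zero, zero_add]
      rw [kernel_decomposition hN hWp hsum _
        (fun m => edgeProb α (H (t + m)) (Θ (t + m)) i k) _]
      congr 2
      refine Finset.sum_congr rfl fun m hm => ?_
      rw [(hA.symm _ (hti m hm) ω).apply, h.edgeProb_comm (hti m hm)]
  have hb := specNorm_bias_le h.β_pos h.L_pos.le h.α_pos.le h.one_le_Cl h.T_pos h.kernel h.mem
    h.connectivity h.smooth h.switches h.eigenvalues ht hti
  rw [hdec]
  refine (specNorm_add_le _ _).trans (add_le_add ((specNorm_offDiag_le _).trans ?_) ?_)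
  · exact mul_le_mul_of_nonneg_left hb zero_le_two
  · rw [specNorm_smul, abs_of_pos (by positivity)]
    have h1 := (specNorm_add_le U Uᵀ).trans (add_le_add le_rfl (specNorm_transpose_le U))
    calc _ ≤ Wmax / N * (specNorm U + specNorm U) := by gcongr
      _ = _ := by ring

end

section
variable {n K T s : ℕ} {α Cα c₀ β L Cl Wmax : ℝ} {W : Fin 3 → ℕ → ℤ → ℝ}
  {H : ℤ → Matrix (Fin K) (Fin K) ℝ} {Θ : ℤ → Matrix (Fin n) (Fin K) ℝ}
  {Ω : Type*} [MeasurableSpace Ω] {μ : Measure Ω} [IsProbabilityMeasure μ] {a : ℝ}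
  {A : ℤ → Ω → Matrix (Fin n) (Fin n) ℝ}

lemma Model.log_le (h : Model T s α Cα c₀ β L Cl Wmax W H Θ) (hn : 0 < n) :
    c₀ * Real.log n ≤ Cα * (n * α) := by
  have hC : 0 < Cα := by linarith [h.one_le_Cα]
  have hn0 : (0 : ℝ) < n := by exact_mod_cast hn
  have := h.dense
  rw [div_le_iff₀ hn0, mul_assoc, inv_mul_le_iff₀ hC] at this
  linarith

/-- Two regimes: if `d ≥ (16 * n) ^ 2` there are no heavy pairs and only the exponential term is
paid. Otherwise the width is at most of order `n ^ 2`, and the powers of `n` from degrees and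
discrepancy are added. -/
lemma Model.window_prob (h : Model T s α Cα c₀ β L Cl Wmax W H Θ)
    (hA : IsAdjacencySample μ T a (fun t => edgeProb α (H t) (Θ t)) A) (hn : 2 ≤ n) {t : ℤ}
    (ht : t ∈ Finset.Icc (1 : ℤ) T) {r : ℕ} (hr : 2 * r ≤ T) {C c c₁ C0 : ℝ} (hC : 0 ≤ C)
    (hc : 3 ≤ c) (hc₁ : 2 ≤ c₁)
    (hC0 : 2 * Wmax * (C + 256 + 8 * (64 * c₁ + 3072 + 768 * c)) * √Cα ≤ C0) :
    μ.real {ω | ¬ specNorm (kernelEstimator T W (fun u => A u ω) t r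
          - a • (1 : Matrix (Fin n) (Fin n) ℝ) - offDiag (edgeProb α (H t) (Θ t)))
        ≤ C0 * √(n * α / (max r 1 : ℕ)) + 2 * bias n T s (nMax T Θ) α β L Cl Wmax r}
      ≤ Real.exp (-((C - 292) * n)) + if (r : ℝ) ≤ 256 / (c₀ * Real.log 2) * n ^ 2 then
        (n : ℝ) ^ (-((c₁ - 2) * c₀ - 2)) + (n : ℝ) ^ (-(c - 12)) else 0 := by
  have hn0 : (0 : ℝ) < n := by positivity
  have hα := h.α_pos
  have hCα := h.one_le_Cα
  have hCα0 : 0 < Cα := by linarith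
  have hW := h.Wmax_pos
  obtain ⟨F, w, hF, hw, hcard, -, hdev⟩ := specNorm_kernelEstimator_sub_le h hA ht hr
  have hX := hA.isBernoulliFamily
  have hFne : F.Nonempty := Finset.card_pos.1 (by omega)
  have hN : (r : ℝ) + 1 ≤ F.card := by exact_mod_cast hcard
  have hN0 : (0 : ℝ) < F.card := by positivity
  have hmem : ∀ e ∈ windowEdges n F, e.1 ∈ F ∧ e.2.1 < e.2.2 := fun e he =>
    ⟨(Finset.mem_product.1 (Finset.mem_filter.1 he).1).1, (Finset.mem_filter.1 he).2⟩
  have hP : ∀ e ∈ windowEdges n F, e.1 ∈ Finset.Icc (1 : ℤ) T ∧ e.2.1 < e.2.2 := fun e he =>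
    ⟨hF _ (hmem e he).1, (hmem e he).2⟩
  have hp : ∀ e ∈ windowEdges n F, edgeProb α (H e.1) (Θ e.1) e.2.1 e.2.2 ≤ Cα * α := fun e he =>
    h.edgeProb_le (hP e he).1 _ _
  have hq : 0 < Cα * α := by positivity
  set d : ℝ := n * F.card * (Cα * α) with hd
  have hlog := h.log_le (by omega)
  have hd2 : c₀ * Real.log n ≤ d := by
    refine hlog.trans ?_
    have : (1 : ℝ) ≤ F.card := by exact_mod_cast hFne.card_pos
    calc Cα * (n * α) = n * 1 * (Cα * α) := by ring
      _ ≤ d := by rw [hd]; gcongr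
  -- a bound on the weighted sum gives the bound on the estimator
  have key : ∀ κ : ℝ, 0 ≤ κ → 2 * Wmax * κ * √Cα ≤ C0 → ∀ ω,
      specNorm (upperDeviation F w (fun e ω => A e.1 ω e.2.1 e.2.2)
        (fun e => edgeProb α (H e.1) (Θ e.1) e.2.1 e.2.2) ω) ≤ κ * √d →
      specNorm (kernelEstimator T W (fun u => A u ω) t r
          - a • (1 : Matrix (Fin n) (Fin n) ℝ) - offDiag (edgeProb α (H t) (Θ t)))
        ≤ C0 * √(n * α / (max r 1 : ℕ)) + 2 * bias n T s (nMax T Θ) α β L Cl Wmax r := by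
    intro κ hκ hκ0 ω hω
    refine (hdev ω).trans ?_
    rw [add_comm]
    refine add_le_add ?_ le_rfl
    calc _ ≤ 2 * Wmax / F.card * (κ * √d) := by gcongr
      _ = (2 * Wmax * κ * √Cα) * √(n * α / F.card) := by
          have : d = Cα * (n * α / F.card) * F.card ^ 2 := by rw [hd]; field_simp
          rw [this, Real.sqrt_mul (by positivity), Real.sqrt_mul (by positivity),
            Real.sqrt_sq hN0.le]
          field_simp
      _ ≤ C0 * √(n * α / (max r 1 : ℕ)) := by
          have h1 : ((max r 1 : ℕ) : ℝ) ≤ F.card := by exact_mod_cast (by omega)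
          have h2 : (0 : ℝ) < (max r 1 : ℕ) := by positivity
          gcongr
          exact le_trans (by positivity) hκ0
  by_cases hd3 : (16 * (n : ℝ)) ^ 2 ≤ d
  · have h1 := hX.concentration_dense (by omega) hP hq hFne hp hw hC hd hd3 (C := C)
    have h2 : (0 : ℝ) ≤ if (r : ℝ) ≤ 256 / (c₀ * Real.log 2) * n ^ 2 then
        (n : ℝ) ^ (-((c₁ - 2) * c₀ - 2)) + (n : ℝ) ^ (-(c - 12)) else 0 := by
      split_ifs <;> positivity
    refine le_trans (measureReal_mono ?_ (measure_ne_top _ _)) (h1.trans (by linarith))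
    intro ω hω h3
    refine hω (key C hC (le_trans ?_ hC0) ω h3)
    gcongr
    linarith
  · have h1 := hX.concentration hn hP hq hFne hp hw hd hc hc₁ hd2 (C := C)
    -- Since `n * α` is bounded below, `d` grows at least like `r * c₀ * log 2`; below the dense
    -- threshold this bounds `r`.
    have h2 : (r : ℝ) ≤ 256 / (c₀ * Real.log 2) * n ^ 2 := by
      have hl2 : 0 < Real.log 2 := Real.log_pos (by norm_num)
      have hc0 := h.c₀_pos
      have h3 : c₀ * Real.log 2 ≤ Cα * (n * α) := by
        refine le_trans ?_ hlog
        gcongr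
        exact_mod_cast hn
      rw [div_mul_eq_mul_div, le_div_iff₀ (by positivity)]
      calc (r : ℝ) * (c₀ * Real.log 2) ≤ F.card * (Cα * (n * α)) := by gcongr; linarith
        _ = d := by rw [hd]; ring
        _ ≤ (16 * (n : ℝ)) ^ 2 := (not_le.1 hd3).le
        _ = _ := by ring
    rw [if_pos h2, ← add_assoc]
    refine le_trans (measureReal_mono ?_ (measure_ne_top _ _)) h1
    intro ω hω h3
    exact hω (key _ (by linarith) hC0 ω h3)

/-- All kernel estimators with moderate widths are close to their targets. -/
theorem Model.deviation_prob (h : Model T s α Cα c₀ β L Cl Wmax W H Θ)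
    (hA : IsAdjacencySample μ T a (fun t => edgeProb α (H t) (Θ t)) A) (hn : 2 ≤ n) {t : ℤ}
    (ht : t ∈ Finset.Icc (1 : ℤ) T) {τ C D C0 m : ℝ} (hτ : 0 < τ) (hC : 0 ≤ C)
    (hD1 : 1 ≤ D) (hD : 2 * D ≤ Real.exp (C - 294 - 2 * τ))
    (hm : m = 256 / (c₀ * Real.log 2) + 1)
    (hC0 : 2 * Wmax * (C + 256 + 8 * (64 * (2 + (4 + τ + m) / c₀) + 3072 + 768 * (14 + τ + m)))
      * √Cα ≤ C0) :
    μ.real {ω | ¬ ∀ r : ℕ, 2 * r ≤ T → (r : ℝ) ≤ D * Real.exp ((2 + τ) * n) →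
      specNorm (kernelEstimator T W (fun u => A u ω) t r
          - a • (1 : Matrix (Fin n) (Fin n) ℝ) - offDiag (edgeProb α (H t) (Θ t)))
        ≤ C0 * √(n * α / (max r 1 : ℕ)) + 2 * bias n T s (nMax T Θ) α β L Cl Wmax r}
      ≤ 4 * (n : ℝ) ^ (-τ) := by
  have hn2 : (2 : ℝ) ≤ n := by exact_mod_cast hn
  have hn0 : (0 : ℝ) < n := by linarith
  have hc0 := h.c₀_pos
  have hl2 : 0 < Real.log 2 := Real.log_pos (by norm_num)
  set M := 256 / (c₀ * Real.log 2) with hM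
  have hM0 : 0 < M := by positivity
  set R := D * Real.exp ((2 + τ) * n) with hR
  have hR1 : 1 ≤ R := by
    have : 1 ≤ Real.exp ((2 + τ) * n) := Real.one_le_exp (by positivity)
    nlinarith
  set bad : ℕ → Set Ω := fun r => {ω | ¬ specNorm (kernelEstimator T W (fun u => A u ω) t r
          - a • (1 : Matrix (Fin n) (Fin n) ℝ) - offDiag (edgeProb α (H t) (Θ t)))
        ≤ C0 * √(n * α / (max r 1 : ℕ)) + 2 * bias n T s (nMax T Θ) α β L Cl Wmax r} with hbad
  set E := Real.exp (-((C - 292) * n)) with hE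
  set S := (n : ℝ) ^ (-(2 + (4 + τ + m) / c₀ - 2) * c₀ + 2) + (n : ℝ) ^ (-(2 + τ + m)) with hS
  have hS0 : 0 ≤ S := by positivity
  -- The choices of `c₁` and `c` make the two exponents equal.
  have hS2 : S = 2 * (n : ℝ) ^ (-(2 + τ + m)) := by
    have : -(2 + (4 + τ + m) / c₀ - 2) * c₀ + 2 = -(2 + τ + m) := by field_simp; ring
    rw [hS, this]; ring
  have hr : ∀ r, 2 * r ≤ T → μ.real (bad r) ≤ E + if (r : ℝ) ≤ M * n ^ 2 then S else 0 := by
    intro r hr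
    have := h.window_prob hA hn ht hr hC (c := 14 + τ + m) (c₁ := 2 + (4 + τ + m) / c₀)
      (by linarith) (by
        have : 0 ≤ (4 + τ + m) / c₀ := by
          have : 0 < m := by rw [hm]; positivity
          positivity
        linarith) hC0
    refine this.trans (le_of_eq ?_)
    congr 2
    rw [hS]
    congr 2 <;> ring
  let I := (Finset.range (⌊R⌋₊ + 1)).filter fun r => 2 * r ≤ T
  have hsub : {ω | ¬ ∀ r : ℕ, 2 * r ≤ T → (r : ℝ) ≤ R →
      specNorm (kernelEstimator T W (fun u => A u ω) t r
          - a • (1 : Matrix (Fin n) (Fin n) ℝ) - offDiag (edgeProb α (H t) (Θ t)))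
        ≤ C0 * √(n * α / (max r 1 : ℕ)) + 2 * bias n T s (nMax T Θ) α β L Cl Wmax r}
      ⊆ ⋃ r ∈ I, bad r := by
    intro ω hω
    simp only [Set.mem_ofPred_eq, not_forall] at hω
    obtain ⟨r, h1, h2, h3⟩ := hω
    refine Set.mem_biUnion (x := r) ?_ h3
    simp only [I, Finset.coe_filter, Set.mem_ofPred_eq, Finset.mem_range]
    exact ⟨Nat.lt_succ_of_le (Nat.le_floor h2), h1⟩
  refine (measureReal_mono hsub (measure_ne_top _ _)).trans
    ((measureReal_biUnion_finset_le _ _).trans ?_)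
  -- Every width up to the cap pays the exponential term, but only order `n ^ 2` of them pay the
  -- polynomial one.
  have hsum : ∑ r ∈ I, μ.real (bad r) ≤ 2 * R * E + (M * n ^ 2 + 1) * S := by
    calc _ ≤ ∑ r ∈ I, (E + if (r : ℝ) ≤ M * n ^ 2 then S else 0) :=
          Finset.sum_le_sum fun r hrI => hr r (Finset.mem_filter.1 hrI).2
      _ = I.card * E + (I.filter fun r : ℕ => (r : ℝ) ≤ M * n ^ 2).card * S := by
          rw [Finset.sum_add_distrib, Finset.sum_const, nsmul_eq_mul, ← Finset.sum_filter,
            Finset.sum_const, nsmul_eq_mul]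
      _ ≤ _ := by
          have h1 : (I.card : ℝ) ≤ 2 * R := by
            have h2 : I.card ≤ ⌊R⌋₊ + 1 := (Finset.card_filter_le _ _).trans (by simp)
            have h3 : (⌊R⌋₊ : ℝ) ≤ R := Nat.floor_le (by linarith)
            have h4 : (I.card : ℝ) ≤ ⌊R⌋₊ + 1 := by exact_mod_cast h2
            linarith
          have h2 : ((I.filter fun r : ℕ => (r : ℝ) ≤ M * n ^ 2).card : ℝ) ≤ M * n ^ 2 + 1 := by
            have h3 : (I.filter fun r : ℕ => (r : ℝ) ≤ M * n ^ 2)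
                ⊆ Finset.range (⌊M * (n : ℝ) ^ 2⌋₊ + 1) := by
              intro r hr
              rw [Finset.mem_range]
              exact Nat.lt_succ_of_le (Nat.le_floor (Finset.mem_filter.1 hr).2)
            have h4 := Finset.card_le_card h3
            rw [Finset.card_range] at h4
            have h5 : (⌊M * (n : ℝ) ^ 2⌋₊ : ℝ) ≤ M * n ^ 2 := Nat.floor_le (by positivity)
            have h6 : ((I.filter fun r : ℕ => (r : ℝ) ≤ M * n ^ 2).card : ℝ)
              ≤ ⌊M * (n : ℝ) ^ 2⌋₊ + 1 := by exact_mod_cast h4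
            linarith
          have hE0 : 0 ≤ E := (Real.exp_pos _).le
          gcongr
  refine hsum.trans ?_
  -- Bernoulli's inequality gives `m ≤ 2 ^ m ≤ n ^ m`, which absorbs the constant `M` into a power
  -- of `n`.
  have hsparse : (M * n ^ 2 + 1) * S ≤ 2 * (n : ℝ) ^ (-τ) := by
    have h1 : M * (n : ℝ) ^ 2 + 1 ≤ (n : ℝ) ^ (2 + m) := by
      have h2 : m ≤ (n : ℝ) ^ m := by
        have h3 : (2 : ℝ) ^ m ≤ (n : ℝ) ^ m :=
          Real.rpow_le_rpow (by norm_num) hn2 (by rw [hm]; positivity)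
        have h4 : 1 + m * 1 ≤ (1 + 1 : ℝ) ^ m :=
          one_add_mul_self_le_rpow_one_add (by norm_num) (by rw [hm]; linarith)
        norm_num at h4
        linarith
      calc M * (n : ℝ) ^ 2 + 1 ≤ m * n ^ 2 := by rw [hm]; nlinarith
        _ ≤ (n : ℝ) ^ m * n ^ 2 := by gcongr
        _ = _ := by rw [add_comm, Real.rpow_add hn0]; norm_num
    calc _ ≤ (n : ℝ) ^ (2 + m) * (2 * (n : ℝ) ^ (-(2 + τ + m))) := by rw [hS2]; gcongr
      _ = 2 * ((n : ℝ) ^ (2 + m) * (n : ℝ) ^ (-(2 + τ + m))) := by ring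
      _ = _ := by rw [← Real.rpow_add hn0]; congr 2; ring
  have hdense : 2 * R * E ≤ (n : ℝ) ^ (-τ) := by
    have h0 : 0 ≤ C - 294 - 2 * τ := by
      have : 1 ≤ Real.exp (C - 294 - 2 * τ) := by linarith
      exact Real.one_le_exp_iff.1 this
    calc 2 * R * E = 2 * D * (Real.exp ((2 + τ) * n) * E) := by rw [hR]; ring
      _ ≤ Real.exp ((C - 294 - 2 * τ) * n) * (Real.exp ((2 + τ) * n) * E) := by
          refine mul_le_mul_of_nonneg_right (hD.trans (Real.exp_le_exp.2 ?_)) (by positivity)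
          nlinarith
      _ = Real.exp (-τ * n) := by rw [hE, ← Real.exp_add, ← Real.exp_add]; congr 1; ring
      _ ≤ Real.exp (-τ * Real.log n) := by
          refine Real.exp_le_exp.2 ?_
          have := Real.log_le_self hn0.le
          nlinarith
      _ = _ := by rw [Real.rpow_def_of_pos hn0, mul_comm]
  have : 0 ≤ (n : ℝ) ^ (-τ) := by positivity
  linarith

end

/-- The constants for which the deviation bounds hold. -/
lemma exists_tuning_constant {c B D₀ : ℝ} (hc : 0 < c) (hD₀ : 0 < D₀) (b : ℝ) :
    ∃ Cstar : ℝ, 1 ≤ Cstar ∧ ∀ C0, Cstar ≤ C0 →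
      ∃ C, 0 ≤ C ∧ 2 * (D₀ * C0 ^ 2) ≤ Real.exp (C - b) ∧ c * (C + B) ≤ C0 := by
  have h1 := (Real.tendsto_exp_div_pow_atTop 2).eventually_ge_atTop
    (2 * D₀ * c ^ 2 * Real.exp (B + b))
  obtain ⟨x, hx⟩ := Filter.eventually_atTop.1 h1
  -- The requirements are circular: `C0` must dominate a multiple of `C`, whereas `C` must beat the
  -- factor `C0 ^ 2` of the cap. Taking `C` affine in `C0` makes the first an equality, and the
  -- exponential wins in the second once `C0` is large.
  refine ⟨max 1 (c * max x (B + 1)), le_max_left _ _, fun C0 hC0 => ⟨C0 / c - B, ?_, ?_, ?_⟩⟩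
  · have : c * (B + 1) ≤ C0 :=
      le_trans (by gcongr; exact le_max_right _ _) ((le_max_right _ _).trans hC0)
    have : B + 1 ≤ C0 / c := by rw [le_div_iff₀ hc]; linarith
    linarith
  · have h2 : c * x ≤ C0 :=
      le_trans (by gcongr; exact le_max_left _ _) ((le_max_right _ _).trans hC0)
    have h3 : 0 < C0 := lt_of_lt_of_le one_pos ((le_max_left _ _).trans hC0)
    have h4 := hx (C0 / c) (by rw [le_div_iff₀ hc]; linarith)
    rw [le_div_iff₀ (by positivity)] at h4
    have h5 : 2 * D₀ * c ^ 2 * Real.exp (B + b) * (C0 / c) ^ 2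
        = 2 * (D₀ * C0 ^ 2) * Real.exp (B + b) := by field_simp
    rw [h5, ← le_div_iff₀ (Real.exp_pos _), ← Real.exp_sub] at h4
    rwa [sub_sub]
  · rw [sub_add_cancel, mul_div_cancel₀ _ hc.ne']

/-! ### The adaptive width -/

lemma bias_mono {n T s nmax : ℕ} {α β L Cl Wmax : ℝ} (hα : 0 ≤ α) (hβ : 0 ≤ β) (hL : 0 ≤ L)
    (hCl : 0 ≤ Cl) (hW : 0 ≤ Wmax) : Monotone (bias n T s nmax α β L Cl Wmax) := by
  intro r r' hr
  unfold bias
  have : (r : ℝ) ≤ r' := by exact_mod_cast hr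
  gcongr

lemma bias_zero {n T s nmax : ℕ} {α β L Cl Wmax : ℝ} (hβ : 0 < β) :
    bias n T s nmax α β L Cl Wmax 0 = 0 := by
  simp [bias, Real.zero_rpow hβ.ne']

/-- Lepski's method is as good as every width whose bias does not exceed its deviation. -/
theorem adaptiveWidth_error_le {n T : ℕ} {W : Fin 3 → ℕ → ℤ → ℝ} {C0 α R : ℝ} {t : ℤ}
    {A : ℤ → Matrix (Fin n) (Fin n) ℝ} {Q : Matrix (Fin n) (Fin n) ℝ} {b : ℕ → ℝ}
    (hα : 0 ≤ α) (hC0 : 0 ≤ C0) (hb : Monotone b)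
    (hdev : ∀ r : ℕ, 2 * r ≤ T → (r : ℝ) ≤ R → specNorm (kernelEstimator T W A t r - Q)
      ≤ C0 * √(n * α / (max r 1 : ℕ)) + 2 * b r)
    {ρ : ℕ} (hρ : 2 * ρ ≤ T) (hρR : (ρ : ℝ) ≤ R)
    (hbρ : 2 * b ρ ≤ C0 * √(n * α / (max ρ 1 : ℕ))) :
    specNorm (kernelEstimator T W A t (adaptiveWidth T W C0 α A t) - Q)
      ≤ 6 * C0 * √(n * α / (max ρ 1 : ℕ)) := by
  set v : ℕ → ℝ := fun r => √(n * α / (max r 1 : ℕ)) with hv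
  have hv0 : ∀ r, 0 ≤ v r := fun r => Real.sqrt_nonneg _
  have hvanti : ∀ r r', r ≤ r' → v r' ≤ v r := by
    intro r r' hr
    simp only [hv]
    have h1 : ((max r 1 : ℕ) : ℝ) ≤ (max r' 1 : ℕ) := by exact_mod_cast (by omega)
    have h2 : (0 : ℝ) < (max r 1 : ℕ) := by positivity
    gcongr
  set S := {r : ℕ | 2 * r ≤ T ∧ ∀ ρ < r,
    specNorm (kernelEstimator T W A t r - kernelEstimator T W A t ρ)
      ≤ 4 * C0 * Real.sqrt (n * α / (max ρ 1 : ℕ))} with hS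
  have hρ1 := hdev ρ hρ hρR
  -- For `r < ρ` both biases are at most half the bias allowance at `ρ`, and `v ρ ≤ v r`, so the
  -- difference of the estimators is at most `4 * C0 * v r`: the width `ρ` passes the test.
  have hρS : ρ ∈ S := by
    refine ⟨hρ, fun r hr => ?_⟩
    have hr1 := hdev r (by omega) (le_trans (by exact_mod_cast hr.le) hρR)
    have h1 := specNorm_sub_le (kernelEstimator T W A t ρ - Q) (kernelEstimator T W A t r - Q)
    rw [sub_sub_sub_cancel_right] at h1
    have h2 := mul_le_mul_of_nonneg_left (hvanti r ρ hr.le) hC0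
    have h3 := hb hr.le
    simp only [hv] at *
    linarith
  have hbdd : BddAbove S := ⟨T, fun r hr => by have := hr.1; omega⟩
  have hmem : adaptiveWidth T W C0 α A t ∈ S := Nat.sSup_mem ⟨ρ, hρS⟩ hbdd
  have hle : ρ ≤ adaptiveWidth T W C0 α A t := le_csSup hbdd hρS
  -- The selected width may exceed `R`, where no deviation bound is available. Only its comparison
  -- with `ρ`, which is part of its definition, is used.
  have h2 : specNorm (kernelEstimator T W A t (adaptiveWidth T W C0 α A t)
      - kernelEstimator T W A t ρ) ≤ 4 * C0 * v ρ := by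
    rcases hle.eq_or_lt with h | h
    · rw [← h, sub_self, specNorm_zero]
      exact mul_nonneg (by positivity) (hv0 ρ)
    · exact hmem.2 ρ h
  have h3 := specNorm_add_le (kernelEstimator T W A t (adaptiveWidth T W C0 α A t)
      - kernelEstimator T W A t ρ) (kernelEstimator T W A t ρ - Q)
  rw [sub_add_sub_cancel] at h3
  simp only [hv] at *
  linarith

/-- The largest width whose bias does not exceed its deviation. -/
lemma exists_balanced_width (T : ℕ) {b v : ℕ → ℝ} (h0 : b 0 ≤ v 0) :
    ∃ r, 2 * r ≤ T ∧ b r ≤ v r ∧ (2 * (r + 1) ≤ T → v (r + 1) < b (r + 1)) := by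
  classical
  have h : ∃ r, 2 * r ≤ T ∧ b r ≤ v r := ⟨0, by omega, h0⟩
  refine ⟨Nat.findGreatest (fun r => 2 * r ≤ T ∧ b r ≤ v r) T, ?_⟩
  have h1 := Nat.findGreatest_spec (P := fun r => 2 * r ≤ T ∧ b r ≤ v r) (m := 0) (n := T)
    (by omega) ⟨by omega, h0⟩
  refine ⟨h1.1, h1.2, fun h2 => ?_⟩
  by_contra h3
  have := Nat.findGreatest_is_greatest (P := fun r => 2 * r ≤ T ∧ b r ≤ v r) (n := T)
    (k := Nat.findGreatest (fun r => 2 * r ≤ T ∧ b r ≤ v r) T + 1) (by omega) (by omega)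
  exact this ⟨h2, not_lt.1 h3⟩

/-- The smooth part of `δ₂` balances the squared bias of order `β` and the variance. -/
lemma holder_rate {y ρ q T β c : ℝ} (hy : 0 < y) (hρ : 0 < ρ) (hq : q = y / ρ ^ 2) (hT : 0 < T)
    (hβ : 0 < β) (hc : 0 < c) (h : ρ ≤ c * (y * (q / T) ^ β)) :
    ρ ≤ max c 1 * (y ^ (β + 1) / T ^ β) ^ (1 / (2 * β + 1)) := by
  have h1 : ρ ^ (2 * β + 1) ≤ c * (y ^ (β + 1) / T ^ β) := by
    have h2 : (ρ ^ 2) ^ β = ρ ^ (2 * β) := by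
      rw [← Real.rpow_natCast, ← Real.rpow_mul hρ.le]; norm_num
    rw [hq, div_div, Real.div_rpow hy.le (by positivity), Real.mul_rpow (by positivity) hT.le,
      h2] at h
    have h3 : 0 < ρ ^ (2 * β) := Real.rpow_pos_of_pos hρ _
    have h4 : 0 < T ^ β := Real.rpow_pos_of_pos hT _
    rw [Real.rpow_add hρ, Real.rpow_one, Real.rpow_add hy, Real.rpow_one]
    calc ρ ^ (2 * β) * ρ ≤ ρ ^ (2 * β) * (c * (y * (y ^ β / (ρ ^ (2 * β) * T ^ β)))) := by gcongr
      _ = _ := by field_simp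
  have h0 : 0 < 2 * β + 1 := by linarith
  have hD : 0 < y ^ (β + 1) / T ^ β := by positivity
  calc ρ = (ρ ^ (2 * β + 1)) ^ (1 / (2 * β + 1)) := by
        rw [← Real.rpow_mul hρ.le, mul_one_div, div_self h0.ne', Real.rpow_one]
    _ ≤ (max c 1 * (y ^ (β + 1) / T ^ β)) ^ (1 / (2 * β + 1)) := by
        refine Real.rpow_le_rpow (by positivity) (h1.trans ?_) (by positivity)
        gcongr
        exact le_max_left _ _
    _ = (max c 1) ^ (1 / (2 * β + 1)) * (y ^ (β + 1) / T ^ β) ^ (1 / (2 * β + 1)) :=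
        Real.mul_rpow (by positivity) hD.le
    _ ≤ _ := by
        gcongr
        refine Real.rpow_le_self_of_one_le (le_max_right _ _) ?_
        rw [div_le_one h0]; linarith

/-- The smooth part of `δ₂` is at least the rate of the average over all times. -/
lemma average_rate {y T β c : ℝ} (hy : 0 < y) (hT : 0 < T) (hβ : 0 < β) (hc : 0 < c)
    (h : c ≤ y * T) :
    y / T ≤ max 1 c⁻¹ * ((y ^ (β + 1) / T ^ β) ^ (1 / (2 * β + 1))) ^ 2 := by
  have h0 : 0 < 2 * β + 1 := by linarith
  have hx : 0 < y * T := by positivity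
  set D := (y ^ (β + 1) / T ^ β) ^ (1 / (2 * β + 1)) with hD
  have h1 : (y * T) ^ (-(1 / (2 * β + 1))) * D ^ 2 = y / T := by
    rw [hD, ← Real.rpow_natCast, ← Real.rpow_mul (by positivity), Real.mul_rpow hy.le hT.le,
      Real.div_rpow (by positivity) (by positivity), ← Real.rpow_mul hy.le, ← Real.rpow_mul hT.le,
      div_eq_mul_inv (y ^ _), ← Real.rpow_neg hT.le]
    calc _ = (y ^ (-(1 / (2 * β + 1))) * y ^ ((β + 1) * (1 / (2 * β + 1) * (2 : ℕ)))) *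
          (T ^ (-(1 / (2 * β + 1))) * T ^ (-(β * (1 / (2 * β + 1) * (2 : ℕ))))) := by ring
      _ = y ^ (1 : ℝ) * T ^ (-1 : ℝ) := by
          rw [← Real.rpow_add hy, ← Real.rpow_add hT]
          congr 2 <;> · push_cast; field_simp; ring
      _ = _ := by rw [Real.rpow_one, Real.rpow_neg_one, div_eq_mul_inv]
  rw [← h1]
  refine mul_le_mul_of_nonneg_right ?_ (sq_nonneg _)
  rcases le_or_gt 1 (y * T) with h2 | h2
  · exact (Real.rpow_le_one_of_one_le_of_nonpos h2 (by rw [neg_nonpos]; positivity)).trans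
      (le_max_left _ _)
  · rw [Real.rpow_neg hx.le]
    refine le_trans ?_ (le_max_right _ _)
    refine inv_anti₀ hc (h.trans ?_)
    refine Real.self_le_rpow_of_le_one hx.le h2.le ?_
    rw [div_le_one h0]; linarith

/-- The width that balances bias and deviation attains the rate. -/
theorem balanced_rate {n T s nmax r : ℕ} {α β L Cl Wmax C0 c : ℝ} (hn : 0 < n) (hT : 0 < T)
    (hα : 0 < α) (hβ : 0 < β) (hL : 0 < L) (hCl : 1 ≤ Cl) (hW : 0 < Wmax) (hC0 : 1 ≤ C0)
    (hc : 0 < c) (hcT : c ≤ n * α * T) (hr : 2 * r ≤ T)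
    (hr' : 2 * (r + 1) ≤ T → C0 * √(n * α / (max (r + 1) 1 : ℕ))
      < 2 * bias n T s nmax α β L Cl Wmax (r + 1)) :
    n * α / (max r 1 : ℕ) ≤ (3 * max 1 c⁻¹ + 2 * (max (4 * Wmax * L) 1 ^ 2 + 12 * Wmax * Cl)) *
      min (δ₁ n α ^ 2) (δ₂ n T s nmax α β ^ 2) := by
  have hn0 : (0 : ℝ) < n := by exact_mod_cast hn
  have hT0 : (0 : ℝ) < T := by exact_mod_cast hT
  have hy : 0 < (n : ℝ) * α := by positivity
  set y := (n : ℝ) * α with hydef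
  set M := 3 * max 1 c⁻¹ + 2 * (max (4 * Wmax * L) 1 ^ 2 + 12 * Wmax * Cl) with hM
  have hm1 : 1 ≤ max 1 c⁻¹ := le_max_left _ _
  have hM1 : 1 ≤ M := by
    have : 0 ≤ 2 * (max (4 * Wmax * L) 1 ^ 2 + 12 * Wmax * Cl) := by positivity
    linarith
  have hr1 : (1 : ℝ) ≤ (max r 1 : ℕ) := by exact_mod_cast le_max_right _ _
  set D := (y ^ (β + 1) / (T : ℝ) ^ β) ^ (1 / (2 * β + 1)) with hD
  set E := (α ^ 3 * n * nmax * s) ^ ((1 : ℝ) / 4) with hE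
  have hD0 : 0 ≤ D := by positivity
  have hE0 : 0 ≤ E := by positivity
  have hδ : δ₂ n T s nmax α β = D + E := by
    rw [δ₂, hD, hE, hydef, Real.mul_rpow hn0.le hα.le, mul_comm ((n : ℝ) ^ (β + 1))]
  have hDδ : D ^ 2 ≤ δ₂ n T s nmax α β ^ 2 := by rw [hδ]; gcongr; linarith
  have hEδ : E ^ 2 ≤ δ₂ n T s nmax α β ^ 2 := by rw [hδ]; gcongr; linarith
  rw [mul_min_of_nonneg _ _ (by linarith)]
  refine le_min ?_ ?_
  · rw [δ₁, Real.sq_sqrt hy.le]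
    calc y / (max r 1 : ℕ) ≤ y := div_le_self hy.le hr1
      _ ≤ M * y := le_mul_of_one_le_left hy.le hM1
  -- Either width `r + 1` is admissible, so its bias exceeds its deviation and one of the two parts
  -- of the bias dominates, or `r` is so close to `T / 2` that the average over all times is
  -- compared with `δ₂`.
  by_cases hcase : 2 * (r + 1) ≤ T
  · have h1 := hr' hcase
    have hmax : max (r + 1) 1 = r + 1 := by omega
    rw [hmax] at h1
    set q : ℝ := ((r + 1 : ℕ) : ℝ) with hq
    have hq0 : 0 < q := by rw [hq]; positivity
    set ρ := √(y / q) with hρ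
    have hρ2 : ρ ^ 2 = y / q := Real.sq_sqrt (by positivity)
    have hρ0 : 0 < ρ := Real.sqrt_pos.2 (by positivity)
    have hqρ : q = y / ρ ^ 2 := by rw [hρ2]; field_simp
    have h2 : y / (max r 1 : ℕ) ≤ 2 * ρ ^ 2 := by
      rw [hρ2, ← mul_div_assoc, div_le_div_iff₀ (by positivity) hq0]
      have : q ≤ 2 * (max r 1 : ℕ) := by
        rw [hq]; exact_mod_cast (by omega)
      nlinarith
    have h3 : ρ ≤ C0 * ρ := le_mul_of_one_le_left hρ0.le hC0
    have h4 : ρ < 2 * bias n T s nmax α β L Cl Wmax (r + 1) := lt_of_le_of_lt h3 h1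
    have hρb : ρ ^ 2 ≤ (max (4 * Wmax * L) 1 ^ 2 + 12 * Wmax * Cl) * δ₂ n T s nmax α β ^ 2 := by
      by_cases h5 : ρ ≤ 4 * (n * (α * (Wmax * (L * (q / T) ^ β))))
      · have h6 := holder_rate (c := 4 * Wmax * L) hy hρ0 hqρ hT0 hβ (by positivity)
          (by rw [hydef]; linarith)
        have h7 : ρ ^ 2 ≤ (max (4 * Wmax * L) 1 * D) ^ 2 := by gcongr
        rw [mul_pow] at h7
        have h8 : 0 ≤ 12 * Wmax * Cl := by positivity
        rw [add_mul]
        linarith [mul_le_mul_of_nonneg_left hDδ (sq_nonneg (max (4 * Wmax * L) 1)),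
          mul_nonneg h8 (sq_nonneg (δ₂ n T s nmax α β))]
      · have h6 : ρ ≤ 8 * Wmax * (α * Cl) * (√(2 * (q * s)) * √nmax) := by
          have h7 : bias n T s nmax α β L Cl Wmax (r + 1)
            = n * (α * (Wmax * (L * (q / T) ^ β))) +
              Wmax * (2 * √(2 * (q * s)) * (α * Cl) * √nmax) := rfl
          linarith
        rw [← Real.sqrt_mul (by positivity)] at h6
        have h7 : ρ ^ 2 ≤ (8 * Wmax * (α * Cl)) ^ 2 * (2 * (q * s) * nmax) := by
          calc ρ ^ 2 ≤ (8 * Wmax * (α * Cl) * √(2 * (q * s) * nmax)) ^ 2 := by gcongr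
            _ = _ := by rw [mul_pow, Real.sq_sqrt (by positivity)]
        have hE4 : E ^ 4 = α ^ 3 * n * nmax * s := by
          rw [hE, ← Real.rpow_natCast, ← Real.rpow_mul (by positivity)]; norm_num
        -- Multiplying by `ρ ^ 2` and using `q * ρ ^ 2 = y` removes the width and leaves `E ^ 4`.
        have h8 : (ρ ^ 2) ^ 2 ≤ (12 * Wmax * Cl * E ^ 2) ^ 2 := by
          calc (ρ ^ 2) ^ 2 = ρ ^ 2 * ρ ^ 2 := by ring
            _ ≤ ρ ^ 2 * ((8 * Wmax * (α * Cl)) ^ 2 * (2 * (q * s) * nmax)) := by gcongr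
            _ = 128 * (Wmax * Cl) ^ 2 * E ^ 4 := by
                rw [hE4, hqρ, hydef]; field_simp; ring
            _ ≤ 144 * (Wmax * Cl) ^ 2 * E ^ 4 := by gcongr; norm_num
            _ = _ := by ring
        have h9 := le_of_sq_le_sq h8 (by positivity)
        have h10 : 0 ≤ 12 * Wmax * Cl := by positivity
        rw [add_mul]
        linarith [mul_le_mul_of_nonneg_left hEδ h10, mul_nonneg (sq_nonneg (max (4 * Wmax * L) 1))
          (sq_nonneg (δ₂ n T s nmax α β))]
    refine h2.trans ?_
    have h11 : 0 ≤ 3 * max 1 c⁻¹ * δ₂ n T s nmax α β ^ 2 := by positivity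
    rw [hM]; linarith
  · have h1 : (T : ℝ) ≤ 3 * (max r 1 : ℕ) := by exact_mod_cast (by omega)
    have h2 := average_rate hy hT0 hβ hc hcT
    have h3 : y / (max r 1 : ℕ) ≤ 3 * (y / T) := by
      rw [← mul_div_assoc, div_le_div_iff₀ (by positivity) hT0]
      nlinarith
    have h4 : 0 ≤ 2 * (max (4 * Wmax * L) 1 ^ 2 + 12 * Wmax * Cl) * δ₂ n T s nmax α β ^ 2 := by
      positivity
    have h5 : max 1 c⁻¹ * D ^ 2 ≤ max 1 c⁻¹ * δ₂ n T s nmax α β ^ 2 := by gcongr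
    calc _ ≤ 3 * (max 1 c⁻¹ * δ₂ n T s nmax α β ^ 2) := by linarith
      _ ≤ _ := by rw [hM]; linarith

/-! ### Clustering errors on the event where all kernel estimators are accurate -/

section
variable {n K T s : ℕ} {α Cα c₀ β L Cl Wmax : ℝ} {W : Fin 3 → ℕ → ℤ → ℝ}
  {H : ℤ → Matrix (Fin K) (Fin K) ℝ} {Θ : ℤ → Matrix (Fin n) (Fin K) ℝ}

lemma Model.exists_labels (h : Model T s α Cα c₀ β L Cl Wmax W H Θ) {t : ℤ}
    (ht : t ∈ Finset.Icc (1 : ℤ) T) :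
    ∃ g : Fin n → Fin K, Θ t = ofLabels g ∧ (∀ k, ∃ i, g i = k) ∧
      (∀ k, (nMin T Θ : ℝ) ≤ labelCount g k) ∧ ∀ k, (labelCount g k : ℝ) ≤ nMax T Θ := by
  obtain ⟨g, hg⟩ := exists_eq_ofLabels (h.mem t ht)
  refine ⟨g, hg, fun k => ?_, fun k => ?_, fun k => ?_⟩
  · obtain ⟨i, hi⟩ := h.nonempty t ht k
    rw [hg, community_ofLabels, Finset.mem_filter] at hi
    exact ⟨i, hi.2⟩
  · rw [← card_community_ofLabels, ← hg]
    exact_mod_cast nMin_le_community_card ht k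
  · rw [← card_community_ofLabels, ← hg]
    exact_mod_cast community_card_le_nMax ht k

lemma Model.n_pos (h : Model T s α Cα c₀ β L Cl Wmax W H Θ) : 0 < n := by
  have ht : (1 : ℤ) ∈ Finset.Icc (1 : ℤ) T := Finset.mem_Icc.2 ⟨le_rfl, by exact_mod_cast h.T_pos⟩
  obtain ⟨i, -⟩ := h.nonempty 1 ht ⟨0, h.K_pos⟩
  exact i.pos

lemma Model.nMin_le (h : Model T s α Cα c₀ β L Cl Wmax W H Θ) : nMin T Θ ≤ n := by
  have ht : (1 : ℤ) ∈ Finset.Icc (1 : ℤ) T := Finset.mem_Icc.2 ⟨le_rfl, by exact_mod_cast h.T_pos⟩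
  refine (nMin_le_community_card ht ⟨0, h.K_pos⟩).trans ?_
  simpa using Finset.card_le_univ (community (Θ 1) ⟨0, h.K_pos⟩)

/-- The cap on the widths for which the kernel estimators are controlled. -/
noncomputable def widthCap (n : ℕ) (Cα c₀ τ C0 : ℝ) : ℝ :=
  (2 * 10 ^ 7 * Cα / c₀ + 1) * C0 ^ 2 * Real.exp ((2 + τ) * n)

/-- The constant in the rate attained by the balanced width. -/
noncomputable def rateConstant (Cα c₀ L Cl Wmax : ℝ) : ℝ :=
  3 * max 1 (c₀ * Real.log 2 / Cα)⁻¹ + 2 * (max (4 * Wmax * L) 1 ^ 2 + 12 * Wmax * Cl)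

/-- The constant in the bound on the clustering errors. -/
noncomputable def errorConstant (C0 Cα c₀ L Cl Wmax : ℝ) : ℝ :=
  128 * (144 * C0 ^ 2 * Cl ^ 6 * rateConstant Cα c₀ L Cl Wmax +
    2 * Cl ^ 2 * (36 * C0 ^ 2 * (rateConstant Cα c₀ L Cl Wmax + Cα) + Cα ^ 3))

lemma rateConstant_nonneg (hCl : 0 ≤ Cl) (hW : 0 ≤ Wmax) :
    0 ≤ rateConstant Cα c₀ L Cl Wmax := by
  have : 0 ≤ max 1 (c₀ * Real.log 2 / Cα)⁻¹ := le_trans zero_le_one (le_max_left _ _)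
  unfold rateConstant
  positivity

lemma errorConstant_pos {C0 : ℝ} (hCl : 0 < Cl) (hW : 0 ≤ Wmax) (hCα : 0 < Cα) :
    0 < errorConstant C0 Cα c₀ L Cl Wmax := by
  have := rateConstant_nonneg (Cα := Cα) (c₀ := c₀) (L := L) hCl.le hW
  unfold errorConstant
  positivity

lemma Model.log_two_le (h : Model T s α Cα c₀ β L Cl Wmax W H Θ) (hn : 2 ≤ n) :
    c₀ * Real.log 2 / Cα ≤ n * α := by
  have hC : 0 < Cα := by linarith [h.one_le_Cα]
  have hc := h.c₀_pos
  rw [div_le_iff₀ hC, mul_comm _ Cα]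
  refine le_trans ?_ (h.log_le (by omega))
  gcongr
  exact_mod_cast hn

lemma two_exp_le_widthCap {τ C0 : ℝ} (hCα : 0 < Cα) (hc₀ : 0 < c₀) (hτ : 0 < τ) (hC0 : 1 ≤ C0) :
    (2 * 10 ^ 7 * Cα / c₀ + 1) * C0 ^ 2 * Real.exp (2 * n) ≤ widthCap n Cα c₀ τ C0 := by
  unfold widthCap
  have : (0 : ℝ) ≤ n := Nat.cast_nonneg n
  gcongr
  linarith

lemma exp_le_widthCap {τ C0 : ℝ} (hCα : 0 < Cα) (hc₀ : 0 < c₀) (hC0 : 1 ≤ C0) :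
    Real.exp ((2 + τ) * n) ≤ widthCap n Cα c₀ τ C0 := by
  unfold widthCap
  refine le_mul_of_one_le_left (Real.exp_pos _).le ?_
  have : 0 ≤ 2 * 10 ^ 7 * Cα / c₀ := by positivity
  nlinarith [one_le_pow₀ hC0 (n := 2)]

/-- Lets the diagonal of `P`, of norm at most `Cα * α`, be absorbed in the rate. -/
lemma Model.α_le_min (h : Model T s α Cα c₀ β L Cl Wmax W H Θ) {nmax : ℕ}
    (hα : α ≤ δ₂ n T s nmax α β) : α ^ 2 ≤ Cα * min (δ₁ n α ^ 2) (δ₂ n T s nmax α β ^ 2) := by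
  have hα0 := h.α_pos
  have hC := h.one_le_Cα
  have hn : (1 : ℝ) ≤ n := by exact_mod_cast h.n_pos
  rw [mul_min_of_nonneg _ _ (by linarith)]
  refine le_min ?_ ?_
  · rw [δ₁, Real.sq_sqrt (by positivity)]
    calc α ^ 2 = α * (1 * α) := by ring
      _ ≤ Cα * (n * α) := by gcongr; exact h.α_le
  · calc α ^ 2 ≤ δ₂ n T s nmax α β ^ 2 := by gcongr
      _ ≤ _ := le_mul_of_one_le_left (sq_nonneg _) hC

/-- The adaptive estimator attains the rate, or a width of the order of the cap is accurate. -/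
lemma Model.exists_width (h : Model T s α Cα c₀ β L Cl Wmax W H Θ) (hn : 2 ≤ n) {C0 R : ℝ}
    (hC0 : 1 ≤ C0) (hR : 1 ≤ R) :
    ∃ ρ : ℕ, 2 * ρ ≤ T ∧ (ρ : ℝ) ≤ R ∧
      2 * bias n T s (nMax T Θ) α β L Cl Wmax ρ ≤ C0 * √(n * α / (max ρ 1 : ℕ)) ∧
      (n * α / (max ρ 1 : ℕ) ≤ rateConstant Cα c₀ L Cl Wmax *
          min (δ₁ n α ^ 2) (δ₂ n T s (nMax T Θ) α β ^ 2) ∨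
        (R < T ∧ n * α / (max ρ 1 : ℕ) ≤ 2 * (n * α) / R)) := by
  have hα := h.α_pos
  have hn0 : (0 : ℝ) < n := by positivity
  have hCl : 0 ≤ Cl := by linarith [h.one_le_Cl]
  have hCα : 0 < Cα := by linarith [h.one_le_Cα]
  have hc0 := h.c₀_pos
  obtain ⟨r, hr, hb, hr'⟩ := exists_balanced_width T
    (b := fun r => 2 * bias n T s (nMax T Θ) α β L Cl Wmax r)
    (v := fun r => C0 * √(n * α / (max r 1 : ℕ))) (by
      simp only [bias_zero h.β_pos, mul_zero]; positivity)
  by_cases hrR : (r : ℝ) ≤ R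
  · refine ⟨r, hr, hrR, hb, Or.inl ?_⟩
    have hl2 : 0 < Real.log 2 := Real.log_pos (by norm_num)
    have hT : (1 : ℝ) ≤ T := by exact_mod_cast h.T_pos
    refine balanced_rate h.n_pos h.T_pos hα h.β_pos h.L_pos h.one_le_Cl h.Wmax_pos hC0
      (c := c₀ * Real.log 2 / Cα) (by positivity) ((h.log_two_le hn).trans ?_) hr hr'
    exact le_mul_of_one_le_right (by positivity) hT
  · have hRr := not_le.1 hrR
    have hfl : (⌊R⌋₊ : ℝ) ≤ R := Nat.floor_le (by linarith)
    have hfr : ⌊R⌋₊ ≤ r := by exact_mod_cast hfl.trans hRr.le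
    have hf1 : 1 ≤ ⌊R⌋₊ := Nat.le_floor (by exact_mod_cast hR)
    have hmono := bias_mono (n := n) (T := T) (s := s) (nmax := nMax T Θ) hα.le h.β_pos.le
      h.L_pos.le hCl h.Wmax_pos.le hfr
    -- A smaller width inherits the balance: the bias decreases and the deviation increases.
    refine ⟨⌊R⌋₊, by omega, hfl, ?_, Or.inr ⟨?_, ?_⟩⟩
    · refine (mul_le_mul_of_nonneg_left hmono zero_le_two).trans (hb.trans ?_)
      have h1 : ((max ⌊R⌋₊ 1 : ℕ) : ℝ) ≤ (max r 1 : ℕ) := by exact_mod_cast (by omega)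
      have h2 : (0 : ℝ) < (max ⌊R⌋₊ 1 : ℕ) := by positivity
      gcongr
    · have : (r : ℝ) ≤ T := by exact_mod_cast (by omega)
      linarith
    · have h1 : max ⌊R⌋₊ 1 = ⌊R⌋₊ := max_eq_left hf1
      have h2 := Nat.lt_floor_add_one R
      have h3 : (1 : ℝ) ≤ ⌊R⌋₊ := by exact_mod_cast hf1
      rw [h1, div_le_div_iff₀ (by linarith) (by linarith)]
      have : 0 < (n : ℝ) * α := by positivity
      nlinarith

lemma errors_le_errorBound {ε CR x m : ℝ} {N nmin nmax : ℕ} {Θhat Θ₀ : Matrix (Fin n) (Fin K) ℝ}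
    (hε : 0 < ε) (hm : m = 128 * (2 + ε) * K * x)
    (h1 : communityError Θhat Θ₀ ≤ m) (h2 : overallError Θhat Θ₀ ≤ m * ((N : ℝ) / n))
    (hx : 128 * x ≤ CR * (min (δ₁ n α ^ 2) (δ₂ n T s nmax α β ^ 2) / (α ^ 2 * (nmin : ℝ) ^ 2))) :
    communityError Θhat Θ₀ ≤ errorBound CR ε n K T s nmin nmax α β ∧
      overallError Θhat Θ₀ ≤ errorBound CR ε n K T s nmin nmax α β * ((N : ℝ) / n) := by
  have h3 : m ≤ errorBound CR ε n K T s nmin nmax α β := by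
    calc m = (2 + ε) * K * (128 * x) := by rw [hm]; ring
      _ ≤ (2 + ε) * K * (CR * (min (δ₁ n α ^ 2) (δ₂ n T s nmax α β ^ 2) /
          (α ^ 2 * (nmin : ℝ) ^ 2))) := by gcongr
      _ = _ := by rw [errorBound]; ring
  exact ⟨h1.trans h3, h2.trans (by gcongr)⟩

/-- Of `exp (2 * n)` in the cap, one factor pays for `ε` and the other for `n ^ 5 ≤ 120 * exp n`;
the constant is `128 * 3 * 288 * 120`. The powers of `Cl` from the gap are absorbed by `Cl ^ 2 ≤ m`,
so the threshold does not involve `Cl`, on which the tuning constant must not depend. -/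
lemma recovery_arith {C0 m v R gap e ε c : ℝ} (hn : 2 ≤ n) (hKn : K ≤ n) (hα : 0 < α) (hC0 : 1 ≤ C0)
    (hCl : 1 ≤ Cl) (hε' : ε ≤ Real.exp n) (hm : Cl ^ 2 ≤ m) (hmn : m ≤ n)
    (hc : 0 < c) (hcα : c ≤ n * α) (hR : 13271040 * C0 ^ 2 / c * Real.exp (2 * n) < R)
    (hv : v ≤ 2 * (n * α) / R) (he : e ^ 2 = 36 * C0 ^ 2 * v)
    (hgap : α * m / (2 * Cl ^ 3) ≤ gap) :
    128 * (2 + ε) * K * (e / gap) ^ 2 * n < 1 := by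
  have hn0 : (0 : ℝ) < n := by positivity
  have hCl0 : 0 < Cl := by linarith
  have hm0 : 0 < m := lt_of_lt_of_le (by positivity) hm
  have hR0 : 0 < R := lt_of_le_of_lt (by positivity) hR
  have hKn' : (K : ℝ) ≤ n := by exact_mod_cast hKn
  have h1 : (e / gap) ^ 2 ≤ 288 * C0 ^ 2 * n ^ 3 / (c * R) := by
    calc (e / gap) ^ 2 = e ^ 2 / gap ^ 2 := div_pow _ _ _
      _ ≤ (36 * C0 ^ 2 * (2 * (n * α) / R)) / (α * m / (2 * Cl ^ 3)) ^ 2 := by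
          rw [he]; gcongr
      _ = 288 * C0 ^ 2 * n * (Cl ^ 2) ^ 3 / (α * m ^ 2 * R) := by field_simp; ring
      _ ≤ 288 * C0 ^ 2 * n * m ^ 3 / (α * m ^ 2 * R) := by gcongr
      _ = 288 * C0 ^ 2 * n * m / (α * R) := by field_simp
      _ ≤ 288 * C0 ^ 2 * n * n / (c / n * R) := by
          have : c / n ≤ α := by rw [div_le_iff₀ hn0]; linarith
          gcongr
      _ = _ := by field_simp
  have h2 : (n : ℝ) ^ 5 ≤ 120 * Real.exp n := by
    have := Real.pow_div_factorial_le_exp (n : ℝ) hn0.le 5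
    rw [div_le_iff₀ (by positivity)] at this
    norm_num [Nat.factorial] at this
    linarith
  have h3 : 2 + ε ≤ 3 * Real.exp n := by
    have := Real.one_le_exp hn0.le
    linarith
  calc 128 * (2 + ε) * K * (e / gap) ^ 2 * n
      ≤ 128 * (3 * Real.exp n) * n * (288 * C0 ^ 2 * n ^ 3 / (c * R)) * n := by gcongr
    _ = 110592 * C0 ^ 2 / c * Real.exp n * n ^ 5 / R := by field_simp; ring
    _ ≤ 110592 * C0 ^ 2 / c * Real.exp n * (120 * Real.exp n) / R := by gcongr
    _ = 13271040 * C0 ^ 2 / c * Real.exp (2 * n) / R := by rw [two_mul, Real.exp_add]; ring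
    _ < 1 := by rwa [div_lt_one hR0]

-- The deterministic core: adaptation gives the error of a good width, the spectral gap turns it
-- into clustering errors, and the constants are collected.
set_option maxHeartbeats 1000000 in
theorem Model.clustering_errors_le (h : Model T s α Cα c₀ β L Cl Wmax W H Θ) (hn : 2 ≤ n)
    {τ C0 a ε : ℝ} (hτ : 0 < τ) (hC0 : 1 ≤ C0) (hε : 0 < ε) {A : ℤ → Matrix (Fin n) (Fin n) ℝ}
    {t : ℤ} (ht : t ∈ Finset.Icc (1 : ℤ) T)
    (hdev : ∀ r : ℕ, 2 * r ≤ T → (r : ℝ) ≤ widthCap n Cα c₀ τ C0 →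
      specNorm (kernelEstimator T W A t r - a • (1 : Matrix (Fin n) (Fin n) ℝ)
          - offDiag (edgeProb α (H t) (Θ t)))
        ≤ C0 * √(n * α / (max r 1 : ℕ)) + 2 * bias n T s (nMax T Θ) α β L Cl Wmax r)
    (hcase : α ≤ δ₂ n T s (nMax T Θ) α β ∨
      Cl ^ 2 ≤ (nMin T Θ : ℝ) ∧ (ε ≤ Real.exp n ∨ (T : ℝ) ≤ Real.exp ((2 + τ) * n)))
    {Θhat : Matrix (Fin n) (Fin K) ℝ} (hΘ : IsClusteringOutput T W C0 α ε A t Θhat) :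
    communityError Θhat (Θ t) ≤ errorBound (errorConstant C0 Cα c₀ L Cl Wmax) ε n K T s
        (nMin T Θ) (nMax T Θ) α β ∧
      overallError Θhat (Θ t) ≤ errorBound (errorConstant C0 Cα c₀ L Cl Wmax) ε n K T s
        (nMin T Θ) (nMax T Θ) α β * ((nMax T Θ : ℝ) / n) := by
  obtain ⟨U, hU, hkm⟩ := hΘ
  have hKn : K ≤ n := by obtain ⟨_, _, h, _⟩ := hU; exact h
  obtain ⟨g, hg, hgne, hgmin, hgmax⟩ := h.exists_labels ht
  have hα := h.α_pos
  have hCl := h.one_le_Cl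
  have hCl0 : 0 < Cl := by linarith
  have hCα := h.one_le_Cα
  have hCα0 : 0 < Cα := by linarith
  have hc0 := h.c₀_pos
  have hn0 : (0 : ℝ) < n := by positivity
  have hm0 : (0 : ℝ) < nMin T Θ := by exact_mod_cast nMin_pos h.K_pos h.T_pos h.nonempty
  have hl2 : 0 < Real.log 2 := Real.log_pos (by norm_num)
  have hcα := h.log_two_le hn
  set c := c₀ * Real.log 2 / Cα with hc
  have hcpos : 0 < c := by positivity
  set R := widthCap n Cα c₀ τ C0 with hR
  have hRe : Real.exp ((2 + τ) * n) ≤ R := exp_le_widthCap hCα0 hc0 hC0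
  have hR1 : 1 ≤ R := le_trans (Real.one_le_exp (by positivity)) hRe
  have hR2 : 13271040 * C0 ^ 2 / c * Real.exp (2 * n) < R := by
    refine lt_of_lt_of_le ?_ (two_exp_le_widthCap hCα0 hc0 hτ hC0)
    refine mul_lt_mul_of_pos_right ?_ (Real.exp_pos _)
    have h1 : 13271040 * C0 ^ 2 / c ≤ 2 * 10 ^ 7 * Cα / c₀ * C0 ^ 2 := by
      rw [hc, div_div_eq_mul_div, div_mul_eq_mul_div, div_le_div_iff₀ (by positivity) hc0]
      have := Real.log_two_gt_d9
      have h2 : 13271040 ≤ 2 * 10 ^ 7 * Real.log 2 := by linarith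
      calc 13271040 * C0 ^ 2 * Cα * c₀ = 13271040 * (C0 ^ 2 * Cα * c₀) := by ring
        _ ≤ 2 * 10 ^ 7 * Real.log 2 * (C0 ^ 2 * Cα * c₀) := by gcongr
        _ = _ := by ring
    have h2 : 0 < C0 ^ 2 := by positivity
    linarith
  obtain ⟨ρ, hρ, hρR, hbρ, hrate⟩ := h.exists_width hn hC0 hR1
  have herr := adaptiveWidth_error_le (R := R) (T := T) (A := A) (t := t) (W := W)
    (Q := a • (1 : Matrix (Fin n) (Fin n) ℝ) + offDiag (edgeProb α (H t) (Θ t)))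
    hα.le (by linarith)
    (bias_mono (n := n) (T := T) (s := s) (nmax := nMax T Θ) hα.le h.β_pos.le h.L_pos.le hCl0.le
      h.Wmax_pos.le) (fun r h1 h2 => by rw [← sub_sub]; exact hdev r h1 h2) hρ hρR hbρ
  rw [← sub_sub] at herr
  set v : ℝ := n * α / (max ρ 1 : ℕ) with hv
  have hv0 : 0 ≤ v := by positivity
  set e := 6 * C0 * √v with he
  have he0 : 0 ≤ e := by positivity
  have he2 : e ^ 2 = 36 * C0 ^ 2 * v := by rw [he, mul_pow, Real.sq_sqrt hv0]; ring
  set MR := rateConstant Cα c₀ L Cl Wmax with hMR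
  have hMR0 : 0 ≤ MR := rateConstant_nonneg hCl0.le h.Wmax_pos.le
  set M := min (δ₁ n α ^ 2) (δ₂ n T s (nMax T Θ) α β ^ 2) with hM
  have hM0 : 0 ≤ M := le_min (sq_nonneg _) (sq_nonneg _)
  have hsymm := (h.connectivity t ht).1
  have hspec := h.eigenvalues t ht
  -- If `α ≤ δ₂`, the estimator is compared with `P` itself and the diagonal joins the error.
  -- Otherwise the communities are large enough for the gap of `P` without its diagonal.
  rcases hcase with hαδ | ⟨hmin, hcase⟩
  · have hαM := h.α_le_min hαδ
    have hvM : v ≤ (MR + Cα) * M := by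
      rcases hrate with h1 | ⟨-, h1⟩
      · nlinarith
      · have h2 : 2 * (n * α) / R ≤ α ^ 2 := by
          rw [div_le_iff₀ (by linarith)]
          have h3 : (n : ℝ) ^ 2 ≤ Real.exp (2 * n) := by
            rw [two_mul, Real.exp_add, ← sq]
            have := Real.add_one_le_exp (n : ℝ)
            gcongr
            linarith
          have h4 : 2 * (n : ℝ) ^ 2 / c ≤ R := by
            refine le_trans ?_ hR2.le
            rw [div_mul_eq_mul_div]
            gcongr
            nlinarith [one_le_pow₀ hC0 (n := 2)]
          rw [div_le_iff₀ hcpos] at h4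
          have h5 : R * c ≤ R * (n * α) := by gcongr
          have h6 : 2 * (n : ℝ) ≤ R * α := by
            have : n * (2 * (n : ℝ)) ≤ n * (R * α) := by linarith
            exact le_of_mul_le_mul_left this hn0
          nlinarith
        nlinarith
    have hgapP := spectralGap_edgeProb hα hCl0 hgmin hsymm hspec
    have hdiag : specNorm (offDiag (edgeProb α (H t) (Θ t)) - edgeProb α (H t) (Θ t))
        ≤ Cα * α := by
      have : offDiag (edgeProb α (H t) (Θ t)) - edgeProb α (H t) (Θ t)
          = diagonal fun i => -edgeProb α (H t) (Θ t) i i := by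
        rw [offDiag, sub_sub_cancel_left, ← diagonal_neg]
      rw [this]
      refine specNorm_diagonal_le (by positivity) fun i => ?_
      rw [abs_neg, abs_of_nonneg (h.edgeProb_nonneg ht i i)]
      exact h.edgeProb_le ht i i
    have herr' := (specNorm_add_le _ _).trans (add_le_add herr hdiag)
    rw [sub_add_sub_cancel] at herr'
    rw [hg] at herr'
    have hgap0 : 0 < α * ((nMin T Θ : ℝ) / Cl) - 0 := by rw [sub_zero]; positivity
    obtain ⟨h1, h2, -⟩ := clustering_error_le h.K_pos hgne hgapP herr' hgap0 hε hgmax hU hkm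
    rw [hg]
    refine errors_le_errorBound hε rfl h1 h2 ?_
    have h3 : (e + Cα * α) ^ 2 ≤ 2 * (36 * C0 ^ 2 * (MR + Cα) + Cα ^ 3) * M := by
      have h4 : (e + Cα * α) ^ 2 ≤ 2 * (e ^ 2 + Cα ^ 2 * α ^ 2) := by
        nlinarith [sq_nonneg (e - Cα * α)]
      have h5 : e ^ 2 ≤ 36 * C0 ^ 2 * ((MR + Cα) * M) := by rw [he2]; gcongr
      have h6 : Cα ^ 2 * α ^ 2 ≤ Cα ^ 2 * (Cα * M) := by gcongr
      calc _ ≤ 2 * (36 * C0 ^ 2 * ((MR + Cα) * M) + Cα ^ 2 * (Cα * M)) := by linarith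
        _ = _ := by ring
    calc 128 * ((e + Cα * α) / (α * ((nMin T Θ : ℝ) / Cl) - 0)) ^ 2
        = 128 * Cl ^ 2 * (e + Cα * α) ^ 2 / (α ^ 2 * (nMin T Θ : ℝ) ^ 2) := by
          rw [sub_zero]; field_simp
      _ ≤ 128 * Cl ^ 2 * (2 * (36 * C0 ^ 2 * (MR + Cα) + Cα ^ 3) * M) /
          (α ^ 2 * (nMin T Θ : ℝ) ^ 2) := by gcongr
      _ = 128 * (2 * Cl ^ 2 * (36 * C0 ^ 2 * (MR + Cα) + Cα ^ 3)) *
          (M / (α ^ 2 * (nMin T Θ : ℝ) ^ 2)) := by ring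
      _ ≤ _ := by
          rw [errorConstant]
          gcongr
          exact le_add_of_nonneg_left (by positivity)
  · have hgapP := spectralGap_offDiag hα hCl0 hgmin hsymm hspec
    have hlow := gap_offDiag_lower hα hCl hmin
    have hgap0 := lt_of_lt_of_le (by positivity) hlow
    rw [hg] at herr
    obtain ⟨h1, h2, h3⟩ := clustering_error_le h.K_pos hgne hgapP herr hgap0 hε hgmax hU hkm
    rw [hg]
    set gap := α * ((nMin T Θ : ℝ) / Cl - Cl) - -(α * Cl⁻¹) with hgapdef
    rcases hrate with hvM | ⟨hRT, hvR⟩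
    · refine errors_le_errorBound hε rfl h1 h2 ?_
      calc 128 * (e / gap) ^ 2 = 128 * (e ^ 2 / gap ^ 2) := by rw [div_pow]
        _ ≤ 128 * ((36 * C0 ^ 2 * (MR * M)) / (α * nMin T Θ / (2 * Cl ^ 3)) ^ 2) := by
            rw [he2]; gcongr
        _ = 128 * (144 * C0 ^ 2 * Cl ^ 6 * MR) * (M / (α ^ 2 * (nMin T Θ : ℝ) ^ 2)) := by
            field_simp; ring
        _ ≤ _ := by
          rw [errorConstant]
          gcongr
          exact le_add_of_nonneg_right (by positivity)
    -- The width at the cap is used only if `T` exceeds the cap, hence exceeds `exp ((2 + τ) * n)`,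
    -- so the condition on `ε` must hold. Recovery is then exact, and nonnegativity of the bound
    -- suffices.
    · have hε' : ε ≤ Real.exp n := by
        rcases hcase with h4 | h4
        · exact h4
        · linarith
      obtain ⟨h4, h5⟩ := h3 (recovery_arith hn hKn hα hC0 hCl hε' hmin
        (by exact_mod_cast h.nMin_le) hcpos hcα hR2 hvR he2 hlow)
      refine errors_le_errorBound (m := 0) (x := 0) hε (by simp) h4 (by simpa using h5) ?_
      have := errorConstant_pos (C0 := C0) (c₀ := c₀) (L := L) hCl0 h.Wmax_pos.le hCα0
      rw [mul_zero]
      positivity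

end

/-- A lower bound on a probability from an upper bound on that of an event covering the
complement. -/
lemma one_sub_le_measureReal {Ω : Type*} [MeasurableSpace Ω] {μ : Measure Ω}
    [IsProbabilityMeasure μ] {S B : Set Ω} {p : ℝ} (hB : μ.real B ≤ p) (h : Bᶜ ⊆ S) :
    1 - p ≤ μ.real S := by
  -- Covering the space by `S` and `B` needs subadditivity only, so the event need not be
  -- measurable.
  have h1 : (Set.univ : Set Ω) ⊆ S ∪ B := fun ω _ => by
    by_cases hω : ω ∈ B
    · exact Or.inr hω
    · exact Or.inl (h hω)
  have h2 := (measureReal_mono h1 (measure_ne_top μ _)).trans (measureReal_union_le S B)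
  rw [probReal_univ] at h2
  linarith

end DSBM

/-! ### The main theorem. -/

theorem theorem1 (τ c₀ Cα Wmax : ℝ) (hτ : 0 < τ) (hc₀ : 0 < c₀) (hCα : 1 ≤ Cα)
    (hWmax : 0 < Wmax) :
    ∃ Cstar : ℝ, 0 < Cstar ∧ ∀ C0 : ℝ, Cstar ≤ C0 →
    ∀ β L Cl : ℝ, 0 < β → 0 < L → 1 ≤ Cl →
    ∃ CR : ℝ, 0 < CR ∧
    ∀ (n K T s : ℕ) (α ε a : ℝ) (W : Fin 3 → ℕ → ℤ → ℝ)
      (H : ℤ → Matrix (Fin K) (Fin K) ℝ) (Θ : ℤ → Matrix (Fin n) (Fin K) ℝ)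
      (Ω : Type*) [MeasurableSpace Ω] (μ : Measure Ω) [IsProbabilityMeasure μ]
      (A : ℤ → Ω → Matrix (Fin n) (Fin n) ℝ),
      0 < K → 0 < T → 0 < α → 0 < ε → 10 ≤ a →
      (∀ t ∈ Finset.Icc (1 : ℤ) T, Θ t ∈ DSBM.clusteringMatrices n K) →
      (∀ t ∈ Finset.Icc (1 : ℤ) T, ∀ k, (DSBM.community (Θ t) k).Nonempty) →
      DSBM.IsConnectivity T α Cα H →
      DSBM.SmoothConnectivity T β L H →
      DSBM.FewSwitches T s Θ →
      DSBM.EigenvalueBounds T Cl H →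
      DSBM.IsKernel (DSBM.holderOrder β) Wmax W →
      Cα⁻¹ * c₀ * Real.log n / n ≤ α →
      DSBM.IsAdjacencySample μ T a (fun t => DSBM.edgeProb α (H t) (Θ t)) A →
      (α ≤ DSBM.δ₂ n T s (DSBM.nMax T Θ) α β ∨ Cl ^ 2 ≤ (DSBM.nMin T Θ : ℝ)) →
      -- the bounds at a fixed time
      ((α ≤ DSBM.δ₂ n T s (DSBM.nMax T Θ) α β ∨ min ε T ≤ Real.exp n) →
        ∀ t ∈ Finset.Icc (1 : ℤ) T,
        1 - 4 * (n : ℝ) ^ (-τ) ≤ μ.real {ω | ∀ Θhat : Matrix (Fin n) (Fin K) ℝ,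
          DSBM.IsClusteringOutput T W C0 α ε (fun u => A u ω) t Θhat →
          DSBM.communityError Θhat (Θ t)
            ≤ DSBM.errorBound CR ε n K T s (DSBM.nMin T Θ) (DSBM.nMax T Θ) α β ∧
          (DSBM.errorBound CR ε n K T s (DSBM.nMin T Θ) (DSBM.nMax T Θ) α β ≤ 1 →
            DSBM.overallError Θhat (Θ t)
              ≤ DSBM.errorBound CR ε n K T s (DSBM.nMin T Θ) (DSBM.nMax T Θ) α β *
                ((DSBM.nMax T Θ : ℝ) / n))}) ∧
      -- the bounds uniformly over time
      (∀ τ₁ : ℝ, (T : ℝ) ≤ (n : ℝ) ^ τ₁ →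
        1 - 4 * (n : ℝ) ^ (-(τ - τ₁)) ≤ μ.real {ω | ∀ Θhat : ℤ → Matrix (Fin n) (Fin K) ℝ,
          (∀ t ∈ Finset.Icc (1 : ℤ) T,
            DSBM.IsClusteringOutput T W C0 α ε (fun u => A u ω) t (Θhat t)) →
          DSBM.maxCommunityError T Θhat Θ
            ≤ DSBM.errorBound CR ε n K T s (DSBM.nMin T Θ) (DSBM.nMax T Θ) α β ∧
          DSBM.maxOverallError T Θhat Θ
            ≤ DSBM.errorBound CR ε n K T s (DSBM.nMin T Θ) (DSBM.nMax T Θ) α β *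
              ((DSBM.nMax T Θ : ℝ) / n)}) := by
  have hl2 : 0 < Real.log 2 := Real.log_pos (by norm_num)
  have hCα0 : 0 < Cα := by linarith
  set m : ℝ := 256 / (c₀ * Real.log 2) + 1 with hm
  have hD₀ : 0 < 2 * 10 ^ 7 * Cα / c₀ + 1 := by positivity
  obtain ⟨Cstar, hCstar, hconst⟩ := DSBM.exists_tuning_constant (c := 2 * Wmax * √Cα)
    (B := 256 + 8 * (64 * (2 + (4 + τ + m) / c₀) + 3072 + 768 * (14 + τ + m)))
    (by positivity) hD₀ (294 + 2 * τ)
  refine ⟨Cstar, by linarith, fun C0 hC0 β L Cl hβ hL hCl => ?_⟩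
  obtain ⟨C, hC, hCexp, hClin⟩ := hconst C0 hC0
  have hC01 : 1 ≤ C0 := hCstar.trans hC0
  refine ⟨DSBM.errorConstant C0 Cα c₀ L Cl Wmax,
    DSBM.errorConstant_pos (by linarith) hWmax.le hCα0, ?_⟩
  intro n K T s α ε a W H Θ Ω _ μ _ A hK hT hα hε _ hΘ hne hconn hsm hsw hev hW hdense hA hcase
  have h : DSBM.Model T s α Cα c₀ β L Cl Wmax W H Θ :=
    ⟨hc₀, hCα, hWmax, hβ, hL, hCl, hK, hT, hα, hΘ, hne, hconn, hsm, hsw, hev, hW, hdense⟩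
  have hn1 := h.n_pos
  have hprob := fun (hn : 2 ≤ n) (t : ℤ) (ht : t ∈ Finset.Icc (1 : ℤ) T) =>
    h.deviation_prob hA hn ht (C0 := C0) (D := (2 * 10 ^ 7 * Cα / c₀ + 1) * C0 ^ 2) hτ hC
      (by
        have : 0 ≤ 2 * 10 ^ 7 * Cα / c₀ := by positivity
        nlinarith [one_le_pow₀ hC01 (n := 2)])
      (by rwa [sub_sub]) hm
      (le_trans (le_of_eq (by ring)) hClin)
  refine ⟨fun hcase' t ht => ?_, fun τ₁ hτ₁ => ?_⟩
  -- For `n = 1` the claimed lower bound is negative.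
  · rcases (show n = 1 ∨ 2 ≤ n by omega) with rfl | hn
    · exact (sub_nonpos.2 (by norm_num)).trans measureReal_nonneg
    · refine DSBM.one_sub_le_measureReal (hprob hn t ht) fun ω hω Θhat hΘhat => ?_
      have hdev := not_not.1 hω
      have hcond : α ≤ DSBM.δ₂ n T s (DSBM.nMax T Θ) α β ∨ Cl ^ 2 ≤ (DSBM.nMin T Θ : ℝ) ∧
          (ε ≤ Real.exp n ∨ (T : ℝ) ≤ Real.exp ((2 + τ) * n)) := by
        rcases hcase with h1 | h1
        · exact Or.inl h1
        · rcases hcase' with h2 | h2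
          · exact Or.inl h2
          · refine Or.inr ⟨h1, (min_le_iff.1 h2).imp_right fun h3 => h3.trans ?_⟩
            have : (0 : ℝ) ≤ n := Nat.cast_nonneg n
            exact Real.exp_le_exp.2 (by nlinarith)
      have := h.clustering_errors_le hn hτ hC01 hε ht hdev hcond hΘhat
      exact ⟨this.1, fun _ => this.2⟩
  -- If the claimed lower bound is not positive, nothing is to be shown. Otherwise `n ≥ 2` and `τ₁ ≤
  -- τ`, so that `T` is at most `exp ((2 + τ) * n)` and no condition on `ε` is needed.
  · by_cases hsmall : 1 ≤ 4 * (n : ℝ) ^ (-(τ - τ₁))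
    · exact (sub_nonpos.2 hsmall).trans measureReal_nonneg
    have hsmall := not_le.1 hsmall
    have hn : 2 ≤ n := by
      by_contra hn
      have : n = 1 := by omega
      rw [this, Nat.cast_one, Real.one_rpow] at hsmall
      linarith
    have hn0 : (0 : ℝ) < n := by positivity
    have hn1' : (1 : ℝ) ≤ n := by exact_mod_cast hn1
    have hττ : τ₁ ≤ τ := by
      by_contra hlt
      have : 1 ≤ (n : ℝ) ^ (-(τ - τ₁)) := Real.one_le_rpow hn1' (by linarith)
      linarith
    have hTexp : (T : ℝ) ≤ Real.exp ((2 + τ) * n) := by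
      refine hτ₁.trans ((Real.rpow_le_rpow_of_exponent_le hn1' hττ).trans ?_)
      rw [Real.rpow_def_of_pos hn0]
      refine Real.exp_le_exp.2 ?_
      have := Real.log_le_self hn0.le
      nlinarith
    have hcond : α ≤ DSBM.δ₂ n T s (DSBM.nMax T Θ) α β ∨ Cl ^ 2 ≤ (DSBM.nMin T Θ : ℝ) ∧
        (ε ≤ Real.exp n ∨ (T : ℝ) ≤ Real.exp ((2 + τ) * n)) :=
      hcase.imp_right fun h1 => ⟨h1, Or.inr hTexp⟩
    -- The union over the `T ≤ n ^ τ₁` times costs the factor `n ^ τ₁`.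
    have hbad := (measureReal_biUnion_finset_le (μ := μ) (Finset.Icc (1 : ℤ) T) _).trans
      (Finset.sum_le_sum (hprob hn))
    refine DSBM.one_sub_le_measureReal (hbad.trans ?_) fun ω hω Θhat hΘhat => ?_
    · rw [Finset.sum_const, nsmul_eq_mul, Int.card_Icc, add_sub_cancel_right, Int.toNat_natCast]
      calc (T : ℝ) * (4 * (n : ℝ) ^ (-τ)) ≤ (n : ℝ) ^ τ₁ * (4 * (n : ℝ) ^ (-τ)) := by gcongr
        _ = 4 * ((n : ℝ) ^ τ₁ * (n : ℝ) ^ (-τ)) := by ring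
        _ = _ := by rw [← Real.rpow_add hn0]; congr 2; ring
    · have hne : Nonempty (Finset.Icc (1 : ℤ) T) :=
        ⟨⟨1, Finset.mem_Icc.2 ⟨le_rfl, by exact_mod_cast hT⟩⟩⟩
      have hall := fun t : Finset.Icc (1 : ℤ) T =>
        h.clustering_errors_le hn hτ hC01 hε t.2 (not_not.1 fun hnot =>
          hω (Set.mem_biUnion (x := t.1) t.2 hnot)) hcond (hΘhat t t.2)
      exact ⟨ciSup_le fun t => (hall t).1, ciSup_le fun t => (hall t).2⟩
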